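/- An *S-manifold* is a space obtained from a collection of Euclidean equilateral triangles of side length $1$, forming a two-dimensional simplicial complex, in which every edge is shared by exactly two triangles and every vertex is shared by exactly five, six or seven triangles, which form one cycle around the vertex. A vertex is called *elliptic*, *Euclidean* or *hyperbolic* if it is shared by five, six or seven triangles, respectively. A *line* of an S-manifold is the trace of a piecewise linear curve, parametrized by arc length on all of $\mathbb{R}$, which is straight in the Euclidean sense within each triangle and each pair of adjacent triangles laid flat in the plane, and which makes two equal angles at each vertex it passes (two angles of $150^\circ$, $180^\circ$ or $210^\circ$ at an elliptic, Euclidean or hyperbolic vertex). Two lines are *parallel* if they have no point in common. Let $l$ be a line and $P$ a point not on $l$. The point $P$ is *Euclidean* with respect to $l$ if exactly one line through $P$ is parallel to $l$; *elliptic* if no line through $P$ is parallel to $l$; *hyperbolic* if at least two lines through $P$ are parallel to $l$; and *regularly hyperbolic* if it is hyperbolic and infinitely many lines through $P$ are parallel to $l$ and infinitely many lines through $P$ are not. A geometry is *semi-paradoxist* if it has Euclidean, elliptic and regularly hyperbolic points (each with respect to some line). **Theorem.** There is an S-manifold $M$, homeomorphic to the plane, with a hyperbolic vertex $h$ and an elliptic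 vertex $e$ that are joined by an edge, all of whose other vertices are Euclidean, and in $M$ there is a line $l$ such that, with respect to this one line $l$, there are a point $P$ that is Euclidean (exactly one parallel to $l$ through $P$), a point $Q$ that is elliptic (no parallel to $l$ through $Q$), and a point $R$ that is regularly hyperbolic (infinitely many parallels and infinitely many non-parallels to $l$ through $R$). In particular, $M$ is semi-paradoxist. -/

import Mathlib

/-- `w` runs once cyclically around the vertex `v` of the family of triangles `F`: the triangles of
`F` containing `v` are exactly the triangles `v, w i, w (i + 1)`, for `i` in `ℤ/n`. -/
structure IsLinkCycle {V : Type*} [DecidableEq V] (F : Set (Finset V)) (v : V) {n : ℕ}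
    (w : ZMod n → V) : Prop where
  injective : Function.Injective w
  faces_iff : ∀ f : Finset V, (f ∈ F ∧ v ∈ f) ↔ ∃ i : ZMod n, f = {v, w i, w (i + 1)}

/-- An S-manifold, as a (simplicial) collection of triangles on the vertex set `V`: every edge lies
in exactly two triangles, and every vertex lies in exactly five, six or seven triangles, which form
one cycle around it (so that the space is a surface). Each triangle is given by its set of three
vertices, and is realized below as a Euclidean equilateral triangle of side length one. -/
structure SManifold (V : Type*) [DecidableEq V] where
  /-- the vertex sets of the triangles -/
  faces : Set (Finset V)
  card_face : ∀ f ∈ faces, f.card = 3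
  edge_shared : ∀ f ∈ faces, ∀ e ⊆ f, e.card = 2 → {g ∈ faces | e ⊆ g}.ncard = 2
  vertex_shared : ∀ v : V, {f ∈ faces | v ∈ f}.ncard ∈ ({5, 6, 7} : Set ℕ)
  link_cycle : ∀ v : V, ∃ w : ZMod {f ∈ faces | v ∈ f}.ncard → V, IsLinkCycle faces v w

namespace SManifold

variable {V : Type*} [DecidableEq V]

/-- The number of triangles around a vertex. -/
noncomputable def degree (M : SManifold V) (v : V) : ℕ := {f ∈ M.faces | v ∈ f}.ncard

def IsEllipticVertex (M : SManifold V) (v : V) : Prop := M.degree v = 5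

def IsEuclideanVertex (M : SManifold V) (v : V) : Prop := M.degree v = 6

def IsHyperbolicVertex (M : SManifold V) (v : V) : Prop := M.degree v = 7

/-- Two vertices are adjacent if they are the two ends of an edge of some triangle. -/
def Adjacent (M : SManifold V) (v w : V) : Prop := v ≠ w ∧ ∃ f ∈ M.faces, v ∈ f ∧ w ∈ f

/-- The closed triangular disk with vertex set `f`, in barycentric coordinates. -/
def disk (f : Finset V) : Set (V → ℝ) :=
  {x | (∀ v, 0 ≤ x v) ∧ (∀ v, v ∉ f → x v = 0) ∧ ∑ v ∈ f, x v = 1}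

/-- The points of an S-manifold: those of its triangular disks. The topology is the one induced
from `V → ℝ`, which is the usual topology of the realization as the triangulation is locally
finite. -/
def points (M : SManifold V) : Set (V → ℝ) := {x | ∃ f ∈ M.faces, x ∈ disk f}

/-- The third vertex of the unit equilateral triangle over the segment from `0` to `1`. -/
noncomputable def ζ : ℂ := Complex.exp ((Real.pi / 3 : ℝ) * Complex.I)

/-- Two adjacent triangles `a, b, c` and `d, b, c`, laid flat in the plane: `b` is placed at `0`,
`c` at `1`, `a` at `ζ` and `d` at the conjugate of `ζ`. -/
noncomputable def unfold (a c d : V) (x : V → ℝ) : ℂ :=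
  (x c : ℂ) + (x a : ℂ) * ζ + (x d : ℂ) * (starRingEnd ℂ) ζ

/-- Around the parameter `t`, the curve `γ` stays in two adjacent triangles and is a straight
segment of unit speed when these are laid flat. -/
def StraightAt (M : SManifold V) (γ : ℝ → V → ℝ) (t : ℝ) : Prop :=
  ∃ a b c d : V, a ≠ d ∧ {a, b, c} ∈ M.faces ∧ {d, b, c} ∈ M.faces ∧
    ∃ z u : ℂ, ‖u‖ = 1 ∧ ∃ ε > 0, ∀ s : ℝ, |s| < ε →
      γ (t + s) ∈ disk {a, b, c} ∪ disk {d, b, c} ∧ unfold a c d (γ (t + s)) = z + s * u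

/-- `x` is the point at distance `r` from the vertex `p` of the triangle `p, q, q'`, on the ray that
leaves `p` at the angle `α` from the edge `p, q`. -/
def OnRay (p q q' : V) (α r : ℝ) (x : V → ℝ) : Prop :=
  x ∈ disk {p, q, q'} ∧ (x q : ℂ) + (x q' : ℂ) * ζ = r * Complex.exp (α * Complex.I)

/-- At the parameter `t` the curve `γ` passes through a vertex `p`; near `t` it consists of two
unit speed segments ending at `p`, which make two equal angles at `p`: with `n` triangles around
`p`, whose angles add up to `n * (π / 3)`, each of the two angles is `n * (π / 6)`. -/
def BisectsAt (M : SManifold V) (γ : ℝ → V → ℝ) (t : ℝ) : Prop :=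
  ∃ (p : V) (w : ZMod (M.degree p) → V), IsLinkCycle M.faces p w ∧
    ∃ α ∈ Set.Icc 0 (Real.pi / 3), ∃ β ∈ Set.Icc 0 (Real.pi / 3), ∃ k : ℕ, k < M.degree p ∧
      k * (Real.pi / 3) + β - α = M.degree p * (Real.pi / 6) ∧
      ∃ ε > 0, ∀ s : ℝ, 0 ≤ s → s < ε →
        OnRay p (w 0) (w 1) α s (γ (t + s)) ∧
        OnRay p (w (k : ZMod (M.degree p))) (w ((k : ZMod (M.degree p)) + 1)) β s (γ (t - s))

/-- The lines (complete geodesics) of an S-manifold, as sets of points: traces of curves, defined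
on all of `ℝ` and of unit speed, which are straight in adjacent triangles and make two equal angles
at each vertex they pass. -/
def IsLine (M : SManifold V) (l : Set (V → ℝ)) : Prop :=
  ∃ γ : ℝ → V → ℝ, (∀ t, M.StraightAt γ t ∨ M.BisectsAt γ t) ∧ l = Set.range γ

/-- The lines through `P` parallel to `l`, that is, without a common point with `l`. -/
def parallels (M : SManifold V) (l : Set (V → ℝ)) (P : V → ℝ) : Set (Set (V → ℝ)) :=
  {m | M.IsLine m ∧ P ∈ m ∧ Disjoint m l}

/-- The lines through `P` that are not parallel to `l`. -/
def nonParallels (M : SManifold V) (l : Set (V → ℝ)) (P : V → ℝ) : Set (Set (V → ℝ)) :=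
  {m | M.IsLine m ∧ P ∈ m ∧ ¬ Disjoint m l}

/-- `P` is a point of the S-manifold outside the line `l`. -/
def PointOff (M : SManifold V) (l : Set (V → ℝ)) (P : V → ℝ) : Prop :=
  M.IsLine l ∧ P ∈ M.points ∧ P ∉ l

/-- `P` is Euclidean with respect to `l`: exactly one parallel. -/
def IsEuclideanPoint (M : SManifold V) (l : Set (V → ℝ)) (P : V → ℝ) : Prop :=
  M.PointOff l P ∧ ∃! m, m ∈ M.parallels l P

/-- `P` is elliptic with respect to `l`: no parallels. -/
def IsEllipticPoint (M : SManifold V) (l : Set (V → ℝ)) (P : V → ℝ) : Prop :=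
  M.PointOff l P ∧ M.parallels l P = ∅

/-- `P` is hyperbolic with respect to `l`: at least two parallels. -/
def IsHyperbolicPoint (M : SManifold V) (l : Set (V → ℝ)) (P : V → ℝ) : Prop :=
  M.PointOff l P ∧ (M.parallels l P).Nontrivial

/-- `P` is regularly hyperbolic with respect to `l`: hyperbolic, with infinitely many parallels and
infinitely many non-parallels. -/
def IsRegularlyHyperbolicPoint (M : SManifold V) (l : Set (V → ℝ)) (P : V → ℝ) : Prop :=
  M.IsHyperbolicPoint l P ∧ (M.parallels l P).Infinite ∧ (M.nonParallels l P).Infinite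

/-- A geometry is semi-paradoxist if it has Euclidean, elliptic and regularly hyperbolic points
(each with respect to some line). -/
def IsSemiParadoxist (M : SManifold V) : Prop :=
  (∃ l P, M.IsEuclideanPoint l P) ∧ (∃ l P, M.IsEllipticPoint l P) ∧
    ∃ l P, M.IsRegularlyHyperbolicPoint l P

/-- The triangulation type of the semi-paradoxist model: the space is homeomorphic to the plane, `h`
is a hyperbolic vertex, `e` is an elliptic vertex adjacent to it, and all other vertices are
Euclidean. -/
structure IsModel (M : SManifold V) (h e : V) : Prop where
  plane : Nonempty (M.points ≃ₜ EuclideanSpace ℝ (Fin 2))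
  hyperbolic : M.IsHyperbolicVertex h
  elliptic : M.IsEllipticVertex e
  adjacent : M.Adjacent h e
  euclidean : ∀ v : V, v ≠ h → v ≠ e → M.IsEuclideanVertex v

end SManifold

/-! Take the triangular lattice, drawn as unit squares with falling diagonals, and turn the
diagonals of the squares `(i, 0)` with `0 ≤ i`. Only two degrees change: `(0, 0)` gets seven
triangles and `(0, 1)` gets five. Call the edge between these two vertices the special edge. The
surface has two flat descriptions. Away from the right half of the strip between rows 0 and 1,
vertices sit at their lattice positions (`pos₀`). Away from the left half of the strip, they do so
after the rows from 1 upwards are shifted one step to the left (`pos₁`), which straightens the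
turned diagonals. Below the strip the two descriptions agree, and above it they differ by a
translation. Across the special edge they differ by a rotation of 60°: a direction `(α, β)`,
standing for `α + β * ζ`, becomes `(-β, α + β)`.

Let `l` be the line `2 * shearCoord + rowCoord = 1 / 2`, perpendicular to the rows, in the right
description. The side of `l` away from the special edge is a flat half plane, so through a point `P`
there only the perpendicular to the rows avoids `l`. The point `Q` lies on row 1, slightly to the
left of the elliptic vertex. Orient a line through `Q` to the right, or straight down. If it rises,
it passes above the strip and reaches `l`. If it is horizontal, it runs into the elliptic vertex and
leaves at 30° upwards. If it descends, it crosses the special edge, and the turn by 60° makes it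
approach `l`. The point `R` is the midpoint of the special edge. A line through `R` with direction
`(α, r * α)` on the left, `0 < r`, has direction `(-r * α, (1 + r) * α)` on the right, which
approaches `l` exactly when `r < 1`; its left half never meets `l`. Irrational `r` keep the line
away from all vertices, so only straightness has to be checked.

Statements about all lines rest on charts: a geodesic is straight in every flat chart
(`straightIn_of_straightAt`, `straightIn_of_bisectsAt`), and `eq_ray_of_locally_straight` continues
a ray as long as it stays in the chart. The passages between charts are `leaves_edge` and
`leaves_elliptic`. Existence of lines comes from `straightAt₀` and `straightAt₁`, and the
homeomorphism with the plane from the hat functions of the triangulation. -/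

namespace SManifold

open Complex

/-! ### The triangular lattice in the complex plane. -/

section Zeta

theorem ζ_eq : ζ = ⟨1 / 2, √3 / 2⟩ := by
  unfold ζ
  rw [Complex.exp_ofReal_mul_I]
  apply Complex.ext <;> simp

theorem ζ_re : ζ.re = 1 / 2 := by rw [ζ_eq]

theorem ζ_im : ζ.im = √3 / 2 := by rw [ζ_eq]

theorem sqrt_three_sq : √3 * √3 = (3 : ℝ) := Real.mul_self_sqrt (by norm_num)

theorem sqrt_three_pos : 0 < √(3 : ℝ) := Real.sqrt_pos.2 (by norm_num)

theorem ζ_mul_conj : ζ * (starRingEnd ℂ) ζ = 1 := by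
  have := sqrt_three_sq
  apply Complex.ext
  · simp [ζ_re, ζ_im]; linarith
  · simp [ζ_re, ζ_im]; ring

theorem ζ_sq : ζ * ζ = ζ - 1 := by
  have := sqrt_three_sq
  apply Complex.ext
  · simp [ζ_re, ζ_im]; linarith
  · simp [ζ_re, ζ_im]; ring

theorem ζ_add_conj : ζ + (starRingEnd ℂ) ζ = 1 := by
  apply Complex.ext
  · simp [ζ_re]; norm_num
  · simp

theorem conj_ζ : (starRingEnd ℂ) ζ = 1 - ζ := by
  rw [← ζ_add_conj]; ring

/-- The squared norm in lattice coordinates. -/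
theorem normSq_lattice (α β : ℝ) : ‖(α + β * ζ : ℂ)‖ ^ 2 = α ^ 2 + α * β + β ^ 2 := by
  have := sqrt_three_sq
  rw [← Complex.normSq_eq_norm_sq, Complex.normSq_apply]
  simp [ζ_re, ζ_im]
  linear_combination β ^ 2 / 4 * this

theorem norm_lattice_eq_one {α β : ℝ} (h : α ^ 2 + α * β + β ^ 2 = 1) : ‖(α + β * ζ : ℂ)‖ = 1 := by
  have := normSq_lattice α β
  rw [h] at this
  exact (pow_eq_one_iff_of_nonneg (norm_nonneg _) two_ne_zero).1 this

theorem lattice_ext {a b c d : ℝ} (h : (a + b * ζ : ℂ) = c + d * ζ) : a = c ∧ b = d := by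
  have h1 := congrArg Complex.re h
  have h2 := congrArg Complex.im h
  have := sqrt_three_pos
  simp [ζ_re, ζ_im] at h1 h2
  subst h2
  exact ⟨by linarith, rfl⟩

theorem exists_lattice (u : ℂ) : ∃ α β : ℝ, u = α + β * ζ := by
  have := sqrt_three_pos
  refine ⟨u.re - u.im / √3, 2 * u.im / √3, Complex.ext ?_ ?_⟩
  · simp [ζ_re, ζ_im]; ring
  · simp [ζ_re, ζ_im]; field_simp

/-- The third vertex of a unit equilateral triangle over a given edge. -/
theorem eq_mul_ζ_or {z w : ℂ} (hz : ‖z‖ = 1) (hw : ‖w‖ = 1) (hzw : ‖z - w‖ = 1) :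
    w = z * ζ ∨ w = z * (starRingEnd ℂ) ζ := by
  have hz0 : z ≠ 0 := by rintro rfl; simp at hz
  obtain ⟨τ, rfl⟩ : ∃ τ, w = z * τ := ⟨w / z, by field_simp⟩
  -- The unit circles about `0` and `1` meet exactly in `ζ` and its conjugate.
  have h1 : ‖τ‖ = 1 := by simpa [hz] using hw
  have h2 : ‖1 - τ‖ = 1 := by
    have : z - z * τ = z * (1 - τ) := by ring
    rw [this, norm_mul, hz, one_mul] at hzw
    exact hzw
  have h1' : τ.re * τ.re + τ.im * τ.im = 1 := by
    rw [← Complex.normSq_apply, Complex.normSq_eq_norm_sq, h1]; norm_num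
  have h2' : (1 - τ.re) * (1 - τ.re) + τ.im * τ.im = 1 := by
    have : (1 - τ).re * (1 - τ).re + (1 - τ).im * (1 - τ).im = 1 := by
      rw [← Complex.normSq_apply, Complex.normSq_eq_norm_sq, h2]; norm_num
    simpa using this
  have hre : τ.re = 1 / 2 := by linarith
  have him : (τ.im - √3 / 2) * (τ.im + √3 / 2) = 0 := by
    rw [hre] at h1'
    linear_combination h1' - sqrt_three_sq / 4
  rcases mul_eq_zero.1 him with h | h
  · left; congr 1
    apply Complex.ext
    · rw [hre, ζ_re]
    · rw [ζ_im]; linarith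
  · right; congr 1
    apply Complex.ext
    · rw [hre]; simp [ζ_re]
    · simp [ζ_im]; linarith

end Zeta

variable {V : Type*} [DecidableEq V]

/-! ### Barycentric coordinates and weighted sums. -/

section WeightedSum

variable {E : Type*} [AddCommGroup E] [Module ℝ E]

/-- The weighted sum of the values of `g`, with weights `x`. -/
noncomputable def wsum (g : V → E) (x : V → ℝ) : E := ∑ᶠ v, x v • g v

theorem wsum_of_mem_disk (g : V → E) {f : Finset V} {x : V → ℝ} (hx : x ∈ disk f) :
    wsum g x = ∑ v ∈ f, x v • g v := by
  apply finsum_eq_sum_of_support_subset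
  intro v hv
  by_contra h
  exact hv (by simp [hx.2.1 v (by simpa using h)])

theorem mem_disk_triple {p q r : V} (hpq : p ≠ q) (hpr : p ≠ r) (hqr : q ≠ r) {x : V → ℝ} :
    x ∈ disk {p, q, r} ↔ 0 ≤ x p ∧ 0 ≤ x q ∧ 0 ≤ x r ∧
      (∀ v, v ≠ p → v ≠ q → v ≠ r → x v = 0) ∧ x p + x q + x r = 1 := by
  have hs : ∑ v ∈ ({p, q, r} : Finset V), x v = x p + x q + x r := by
    rw [Finset.sum_insert (by simp [hpq, hpr]), Finset.sum_insert (by simp [hqr]),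
      Finset.sum_singleton]
    ring
  constructor
  · rintro ⟨h1, h2, h3⟩
    exact ⟨h1 p, h1 q, h1 r, fun v h h' h'' => h2 v (by simp [h, h', h'']), by rw [← hs, h3]⟩
  · rintro ⟨h1, h2, h3, h4, h5⟩
    refine ⟨fun v => ?_, fun v hv => ?_, by rw [hs, h5]⟩
    · by_cases hp : v = p
      · rw [hp]; exact h1
      by_cases hq : v = q
      · rw [hq]; exact h2
      by_cases hr : v = r
      · rw [hr]; exact h3
      exact (h4 v hp hq hr).ge
    · simp only [Finset.mem_insert, Finset.mem_singleton, not_or] at hv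
      exact h4 v hv.1 hv.2.1 hv.2.2

theorem wsum_triple (g : V → E) {p q r : V} (hpq : p ≠ q) (hpr : p ≠ r) (hqr : q ≠ r) {x : V → ℝ}
    (hx : x ∈ disk {p, q, r}) : wsum g x = x p • g p + x q • g q + x r • g r := by
  rw [wsum_of_mem_disk g hx, Finset.sum_insert (by simp [hpq, hpr]),
    Finset.sum_insert (by simp [hqr]), Finset.sum_singleton, add_assoc]

end WeightedSum

theorem ne_of_card_triple {p q r : V} (h : ({p, q, r} : Finset V).card = 3) :
    p ≠ q ∧ p ≠ r ∧ q ≠ r := by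
  have key : ∀ a b : V, ({p, q, r} : Finset V) ⊆ {a, b} → False := fun a b hs => by
    have := (Finset.card_le_card hs).trans Finset.card_le_two
    omega
  refine ⟨?_, ?_, ?_⟩ <;> rintro rfl
  · exact key p r (by simp)
  · exact key p q (by intro v; simp; tauto)
  · exact key p q (by simp)

theorem ne_of_mem_faces (M : SManifold V) {p q r : V} (h : {p, q, r} ∈ M.faces) :
    p ≠ q ∧ p ≠ r ∧ q ≠ r := ne_of_card_triple (M.card_face _ h)

theorem mem_disk_symm {p q r : V} {x : V → ℝ} (hx : x ∈ disk {p, q, r}) : x ∈ disk {p, r, q} := by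
  rwa [Finset.pair_comm r q]

end SManifold

namespace SManifold

open Complex

variable {V : Type*} [DecidableEq V]

/-! ### Unfolding two adjacent triangles. -/

section Unfold

variable {M : SManifold V}

theorem unfold_of_mem_disk {a b c d : V} (had : a ≠ d) (h : {d, b, c} ∈ M.faces) {x : V → ℝ}
    (hx : x ∈ disk {a, b, c}) : unfold a c d x = x c + x a * ζ := by
  obtain ⟨h1, h2, -⟩ := M.ne_of_mem_faces h
  have : x d = 0 := hx.2.1 d (by simp [h1, h2, had.symm])
  simp [unfold, this]

theorem unfold_of_mem_disk' {a b c d : V} (had : a ≠ d) (h : {a, b, c} ∈ M.faces) {x : V → ℝ}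
    (hx : x ∈ disk {d, b, c}) : unfold a c d x = x c + x d * (starRingEnd ℂ) ζ := by
  obtain ⟨h1, h2, -⟩ := M.ne_of_mem_faces h
  have : x a = 0 := hx.2.1 a (by simp [h1, h2, had])
  simp [unfold, this]

omit [DecidableEq V] in
theorem unfold_swap (a c d : V) (x : V → ℝ) :
    unfold d c a x = (starRingEnd ℂ) (unfold a c d x) := by
  simp [unfold]; ring

-- The sign of the imaginary part tells on which side of the common edge a point lies, because `x a`
-- or `x d` vanishes on each of the two triangles.
omit [DecidableEq V] in
theorem unfold_im (a c d : V) (x : V → ℝ) : (unfold a c d x).im = √3 / 2 * (x a - x d) := by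
  simp [unfold, ζ_im]; ring

omit [DecidableEq V] in
theorem unfold_re (a c d : V) (x : V → ℝ) : (unfold a c d x).re = x c + (x a + x d) / 2 := by
  simp [unfold, ζ_re]; ring

end Unfold

theorem StraightAt.mem_points {M : SManifold V} {γ : ℝ → V → ℝ} {t : ℝ} (h : M.StraightAt γ t) :
    γ t ∈ M.points := by
  obtain ⟨a, b, c, d, -, h1, h2, z, u, -, ε, hε, H⟩ := h
  obtain ⟨H, -⟩ := H 0 (by simpa using hε)
  rw [add_zero] at H
  exact H.elim (fun H => ⟨_, h1, H⟩) (fun H => ⟨_, h2, H⟩)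

theorem _root_.IsLinkCycle.mem {F : Set (Finset V)} {v : V} {n : ℕ} {w : ZMod n → V}
    (h : IsLinkCycle F v w) (i : ZMod n) : {v, w i, w (i + 1)} ∈ F :=
  ((h.faces_iff _).2 ⟨i, rfl⟩).1

theorem BisectsAt.mem_points {M : SManifold V} {γ : ℝ → V → ℝ} {t : ℝ} (h : M.BisectsAt γ t) :
    γ t ∈ M.points := by
  obtain ⟨p, w, hw, α, -, β, -, k, -, -, ε, hε, H⟩ := h
  have := (H 0 le_rfl hε).1.1
  rw [add_zero] at this
  exact ⟨_, by simpa using hw.mem 0, this⟩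

/-! ### Planar charts, in which geodesics are straight. -/

/-- A planar chart of an S-manifold: a collection of triangles `G`, placed in the plane as unit
equilateral triangles with distinct vertices at distinct positions. -/
structure IsChart (M : SManifold V) (G : Set (Finset V)) (pos : V → ℂ) : Prop where
  dist_eq_one : ∀ f ∈ G, ∀ v ∈ f, ∀ w ∈ f, v ≠ w → ‖pos v - pos w‖ = 1
  inj : ∀ f ∈ G, ∀ g ∈ G, ∀ v ∈ f, ∀ w ∈ g, pos v = pos w → v = w

namespace IsChart

variable {M : SManifold V} {G : Set (Finset V)} {pos : V → ℂ}

theorem third_vertex (hc : M.IsChart G pos) {p q r : V} (hf : {p, q, r} ∈ G)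
    (hpq : p ≠ q) (hpr : p ≠ r) (hqr : q ≠ r) :
    pos r - pos p = (pos q - pos p) * ζ ∨ pos r - pos p = (pos q - pos p) * (starRingEnd ℂ) ζ := by
  apply eq_mul_ζ_or
  · exact hc.dist_eq_one _ hf q (by simp) p (by simp) hpq.symm
  · exact hc.dist_eq_one _ hf r (by simp) p (by simp) hpr.symm
  · rw [sub_sub_sub_cancel_right]
    exact hc.dist_eq_one _ hf q (by simp) r (by simp) hqr

theorem wsum_eq {p q r : V} (hpq : p ≠ q) (hpr : p ≠ r) (hqr : q ≠ r) {τ : ℂ}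
    (hτ : pos r - pos p = (pos q - pos p) * τ) {x : V → ℝ} (hx : x ∈ disk {p, q, r}) :
    wsum pos x = pos p + (pos q - pos p) * (x q + x r * τ) := by
  rw [wsum_triple pos hpq hpr hqr hx]
  obtain ⟨-, -, -, -, h⟩ := (mem_disk_triple hpq hpr hqr).1 hx
  have h' : (x p : ℂ) = 1 - x q - x r := by
    rw [eq_sub_of_add_eq (add_assoc _ _ (x r) ▸ h : x p + (x q + x r) = 1)]; push_cast; ring
  simp only [real_smul]
  rw [h']
  linear_combination (x r : ℂ) * hτ

/-- In a chart, two adjacent triangles are unfolded as in the plane, up to orientation. -/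
theorem wsum_unfold (hc : M.IsChart G pos) {a b c d : V} (had : a ≠ d)
    (ha : {a, b, c} ∈ M.faces) (hd : {d, b, c} ∈ M.faces)
    (haG : {a, b, c} ∈ G) (hdG : {d, b, c} ∈ G) :
    (∀ x ∈ disk {a, b, c} ∪ disk {d, b, c},
      wsum pos x = pos b + (pos c - pos b) * unfold a c d x) ∨
    (∀ x ∈ disk {a, b, c} ∪ disk {d, b, c},
      wsum pos x = pos b + (pos c - pos b) * (starRingEnd ℂ) (unfold a c d x)) := by
  obtain ⟨hab, hac, hbc⟩ := M.ne_of_mem_faces ha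
  obtain ⟨hdb, hdc, -⟩ := M.ne_of_mem_faces hd
  have ea : ({a, b, c} : Finset V) = {b, c, a} := by
    rw [Finset.insert_comm, Finset.pair_comm]
  have ed : ({d, b, c} : Finset V) = {b, c, d} := by
    rw [Finset.insert_comm, Finset.pair_comm]
  -- Distinct apexes have distinct positions, so they lie on opposite sides of the common edge: one
  -- at `ζ`, the other at its conjugate.
  have hne : pos a ≠ pos d := fun h => had (hc.inj _ haG _ hdG a (by simp) d (by simp) h)
  have hA := hc.third_vertex (ea ▸ haG) hbc hab.symm hac.symm
  have hD := hc.third_vertex (ed ▸ hdG) hbc hdb.symm hdc.symm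
  have hu : ∀ x ∈ disk {a, b, c}, unfold a c d x = x c + x a * ζ :=
    fun x hx => unfold_of_mem_disk had hd hx
  have hu' : ∀ x ∈ disk {d, b, c}, unfold a c d x = x c + x d * (starRingEnd ℂ) ζ :=
    fun x hx => unfold_of_mem_disk' had ha hx
  rcases hA with hA | hA <;> rcases hD with hD | hD
  · exact absurd (by linear_combination hA - hD) hne
  · left
    rintro x (hx | hx)
    · rw [hu x hx, wsum_eq hbc hab.symm hac.symm hA (ea ▸ hx)]
    · rw [hu' x hx, wsum_eq hbc hdb.symm hdc.symm hD (ed ▸ hx)]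
  · right
    rintro x (hx | hx)
    · rw [hu x hx, wsum_eq hbc hab.symm hac.symm hA (ea ▸ hx)]; simp
    · rw [hu' x hx, wsum_eq hbc hdb.symm hdc.symm hD (ed ▸ hx)]; simp
  · exact absurd (by linear_combination hA - hD) hne

/-- A triangle of a chart is unfolded as in the plane, up to orientation. -/
theorem wsum_unfold_single (hc : M.IsChart G pos) {a b c d : V} (had : a ≠ d)
    (ha : {a, b, c} ∈ M.faces) (hd : {d, b, c} ∈ M.faces) (haG : {a, b, c} ∈ G) :
    (∀ x ∈ disk {a, b, c}, wsum pos x = pos b + (pos c - pos b) * unfold a c d x) ∨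
    (∀ x ∈ disk {a, b, c},
      wsum pos x = pos b + (pos c - pos b) * (starRingEnd ℂ) (unfold a c d x)) := by
  obtain ⟨hab, hac, hbc⟩ := M.ne_of_mem_faces ha
  have ea : ({a, b, c} : Finset V) = {b, c, a} := by
    rw [Finset.insert_comm, Finset.pair_comm]
  refine (hc.third_vertex (ea ▸ haG) hbc hab.symm hac.symm).imp (fun hA x hx => ?_)
    (fun hA x hx => ?_)
  · rw [unfold_of_mem_disk had hd hx, wsum_eq hbc hab.symm hac.symm hA (ea ▸ hx)]
  · rw [unfold_of_mem_disk had hd hx, wsum_eq hbc hab.symm hac.symm hA (ea ▸ hx)]; simp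

/-- In the chart, the curve is at the parameter `t` a straight segment of unit speed. -/
def StraightIn (_ : M.IsChart G pos) (γ : ℝ → V → ℝ) (t : ℝ) : Prop :=
  ∃ u : ℂ, ‖u‖ = 1 ∧ ∃ ε > 0, ∀ s : ℝ, |s| < ε →
    (∃ f ∈ G, γ (t + s) ∈ disk f) ∧ wsum pos (γ (t + s)) = wsum pos (γ t) + s * u

theorem straightIn_of_affine (hc : M.IsChart G pos) {γ : ℝ → V → ℝ} {t : ℝ} {z u : ℂ}
    (hu : ‖u‖ = 1) {ε : ℝ} (hε : 0 < ε)
    (h : ∀ s : ℝ, |s| < ε → (∃ f ∈ G, γ (t + s) ∈ disk f) ∧ wsum pos (γ (t + s)) = z + s * u) :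
    hc.StraightIn γ t := by
  have h0 := (h 0 (by simpa using hε)).2
  simp only [add_zero, ofReal_zero, zero_mul] at h0
  exact ⟨u, hu, ε, hε, fun s hs => ⟨(h s hs).1, by rw [h0, (h s hs).2]⟩⟩

/-- Both forms of `hU` are Euclidean isometries, preserving or reversing orientation, and either
carries a unit speed segment to one. -/
theorem straightIn_of_eqOn (hc : M.IsChart G pos) {γ : ℝ → V → ℝ} {t : ℝ} {z u p q : ℂ}
    (hu : ‖u‖ = 1) (hq : ‖q‖ = 1) {ε : ℝ} (hε : 0 < ε) {D : Set (V → ℝ)} {U : (V → ℝ) → ℂ}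
    (hD : ∀ x ∈ D, ∃ f ∈ G, x ∈ disk f)
    (hU : (∀ x ∈ D, wsum pos x = p + q * U x) ∨
      ∀ x ∈ D, wsum pos x = p + q * (starRingEnd ℂ) (U x))
    (h : ∀ s : ℝ, |s| < ε → γ (t + s) ∈ D ∧ U (γ (t + s)) = z + s * u) :
    hc.StraightIn γ t := by
  rcases hU with hU | hU
  · refine hc.straightIn_of_affine (z := p + q * z) (u := q * u) (by simp [hu, hq]) hε
      fun s hs => ⟨hD _ (h s hs).1, ?_⟩
    rw [hU _ (h s hs).1, (h s hs).2]; ring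
  · refine hc.straightIn_of_affine (z := p + q * (starRingEnd ℂ) z) (u := q * (starRingEnd ℂ) u)
      (by simp [hu, hq]) hε fun s hs => ⟨hD _ (h s hs).1, ?_⟩
    rw [hU _ (h s hs).1, (h s hs).2]; simp; ring

/-- If the second triangle is outside the chart, then `γ t` is off the common edge, since otherwise
`hG` would put that triangle into the chart. The curve then stays in the first triangle for a short
time, which the sign of the imaginary part detects. -/
theorem straightIn_of_mem (hc : M.IsChart G pos) {γ : ℝ → V → ℝ} {t : ℝ}
    (hG : ∀ f ∈ M.faces, γ t ∈ disk f → f ∈ G) {a b c d : V} (had : a ≠ d)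
    (ha : {a, b, c} ∈ M.faces) (hd : {d, b, c} ∈ M.faces) {z u : ℂ} (hu : ‖u‖ = 1)
    {ε : ℝ} (hε : 0 < ε)
    (H : ∀ s : ℝ, |s| < ε →
      γ (t + s) ∈ disk {a, b, c} ∪ disk {d, b, c} ∧ unfold a c d (γ (t + s)) = z + s * u)
    (hx : γ t ∈ disk {a, b, c}) : hc.StraightIn γ t := by
  have haG := hG _ ha hx
  obtain ⟨hab, hac, hbc⟩ := M.ne_of_mem_faces ha
  obtain ⟨hdb, hdc, -⟩ := M.ne_of_mem_faces hd
  have hq : ‖pos c - pos b‖ = 1 := hc.dist_eq_one _ haG c (by simp) b (by simp) hbc.symm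
  by_cases hdG : {d, b, c} ∈ G
  · exact hc.straightIn_of_eqOn hu hq hε
      (fun x hx => hx.elim (fun h => ⟨_, haG, h⟩) fun h => ⟨_, hdG, h⟩)
      (hc.wsum_unfold had ha hd haG hdG) H
  have hxa : 0 < γ t a := by
    refine (hx.1 a).lt_of_ne fun h0 => hdG (hG _ hd ?_)
    obtain ⟨h1, h2, h3, h4, h5⟩ := (mem_disk_triple hab hac hbc).1 hx
    have hd0 : γ t d = 0 := h4 d had.symm hdb hdc
    refine (mem_disk_triple hdb hdc hbc).2 ⟨hd0.ge, h2, h3, fun v hv hb hc => ?_, by linarith⟩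
    by_cases hva : v = a
    · rw [hva, ← h0]
    · exact h4 v hva hb hc
  have h0 := H 0 (by simpa using hε)
  simp only [add_zero, ofReal_zero, zero_mul] at h0
  have hz : 0 < z.im := by
    rw [← h0.2, unfold_im]
    have : γ t d = 0 := hx.2.1 d (by simp [hdb, hdc, had.symm])
    have := sqrt_three_pos
    rw [‹γ t d = 0›, sub_zero]; positivity
  have hcont : ∀ᶠ s : ℝ in nhds 0, 0 < (z + s * u).im := by
    have : Continuous fun s : ℝ => (z + s * u).im := by fun_prop
    exact this.continuousAt.eventually (lt_mem_nhds (by simpa using hz))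
  obtain ⟨δ, hδ, hδ'⟩ := Metric.eventually_nhds_iff.1 hcont
  refine hc.straightIn_of_eqOn (D := disk {a, b, c}) hu hq (lt_min hε hδ) (fun x hx => ⟨_, haG, hx⟩)
    (hc.wsum_unfold_single had ha hd haG) (z := z) fun s hs => ?_
  have hs1 := H s (hs.trans_le (min_le_left _ _))
  refine ⟨hs1.1.resolve_right fun hm => ?_, hs1.2⟩
  have hs2 := hδ' (y := s) (by simpa using hs.trans_le (min_le_right _ _))
  rw [← hs1.2, unfold_im] at hs2
  have ha0 : γ (t + s) a = 0 := hm.2.1 a (by simp [hab, hac, had])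
  have := hm.1 d
  have := sqrt_three_pos
  rw [ha0] at hs2
  nlinarith

theorem straightIn_of_straightAt (hc : M.IsChart G pos) {γ : ℝ → V → ℝ} {t : ℝ}
    (hG : ∀ f ∈ M.faces, γ t ∈ disk f → f ∈ G) (h : M.StraightAt γ t) : hc.StraightIn γ t := by
  obtain ⟨a, b, c, d, had, ha, hd, z, u, hu, ε, hε, H⟩ := h
  have h0 := (H 0 (by simpa using hε)).1
  rw [add_zero] at h0
  rcases h0 with h0 | h0
  · exact hc.straightIn_of_mem hG had ha hd hu hε H h0
  · refine hc.straightIn_of_mem hG had.symm hd ha (z := (starRingEnd ℂ) z)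
      (u := (starRingEnd ℂ) u) (by simpa) hε (fun s hs => ⟨(H s hs).1.symm, ?_⟩) h0
    rw [unfold_swap, (H s hs).2]; simp

end IsChart

/-- A point on a ray at distance zero is the vertex. -/
theorem OnRay.eq_single {p q r : V} (hpq : p ≠ q) (hpr : p ≠ r) (hqr : q ≠ r) {α : ℝ} {x : V → ℝ}
    (h : OnRay p q r α 0 x) : x = Pi.single p 1 := by
  obtain ⟨hx, h⟩ := h
  obtain ⟨h1, h2, h3, h4, h5⟩ := (mem_disk_triple hpq hpr hqr).1 hx
  have := lattice_ext (a := x q) (b := x r) (c := 0) (d := 0) (by simpa using h)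
  funext v
  by_cases hv : v = p
  · subst hv; simp; linarith
  · rw [Pi.single_eq_of_ne hv]
    by_cases hq : v = q
    · rw [hq]; exact this.1
    by_cases hr : v = r
    · rw [hr]; exact this.2
    exact h4 v hv hq hr

theorem single_mem_disk {p : V} {f : Finset V} (hp : p ∈ f) :
    (Pi.single p 1 : V → ℝ) ∈ disk f := by
  refine ⟨fun v => ?_, fun v hv => ?_, ?_⟩
  · by_cases hv : v = p
    · subst hv; simp
    · simp [hv]
  · have : v ≠ p := by rintro rfl; exact hv hp
    simp [this]
  · simp [Pi.single_apply, hp]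

theorem wsum_single {E : Type*} [AddCommGroup E] [Module ℝ E] (g : V → E) (p : V) :
    wsum g (Pi.single p 1) = g p := by
  rw [wsum_of_mem_disk g (f := {p}) (single_mem_disk (by simp))]
  simp

theorem degree_mem (M : SManifold V) (p : V) : 5 ≤ M.degree p ∧ M.degree p ≤ 7 := by
  have := M.vertex_shared p
  simp only [Set.mem_insert_iff, Set.mem_singleton_iff] at this
  unfold degree
  omega

theorem ζ_pow (k : ℕ) : ζ ^ k = exp ((k * (Real.pi / 3) : ℝ) * I) := by
  rw [ζ, ← Complex.exp_nat_mul]; congr 1; push_cast; ring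

/-- `ζ` is a primitive sixth root of unity; the fifth and seventh powers are not real. -/
theorem six_of_ζ_pow {n : ℕ} (h5 : 5 ≤ n) (h7 : n ≤ 7) (h : ζ ^ n = 1) : n = 6 := by
  have h3 := sqrt_three_pos
  have z2 : ζ ^ 2 = ζ - 1 := by rw [sq, ζ_sq]
  have z3 : ζ ^ 3 = -1 := by rw [pow_succ, z2]; linear_combination ζ_sq
  interval_cases n
  · have : ζ ^ 5 = 1 - ζ := by
      rw [show 5 = 3 + 2 from rfl, pow_add, z2, z3]; ring
    rw [this] at h
    have := congrArg Complex.im h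
    simp [ζ_im] at this
  · rfl
  · have : ζ ^ 7 = ζ := by
      rw [show 7 = 3 + 3 + 1 from rfl, pow_add, pow_add, z3]; ring
    rw [this] at h
    have := congrArg Complex.im h
    simp [ζ_im] at this

theorem _root_.IsLinkCycle.natCast_ne {F : Set (Finset V)} {v : V} {n : ℕ} {w : ZMod n → V}
    (h : IsLinkCycle F v w) (i : ZMod n) {j : ℕ} (h0 : 0 < j) (hj : j < n) :
    w (i + j) ≠ w i := by
  intro h'
  have := h.injective h'
  rw [add_eq_left, ZMod.natCast_eq_zero_iff] at this
  exact absurd (Nat.le_of_dvd h0 this) (by omega)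

namespace IsChart

variable {M : SManifold V} {G : Set (Finset V)} {pos : V → ℂ}

/-- Around a vertex inside a chart, the neighbours are placed at a regular polygon. -/
theorem pos_link (hc : M.IsChart G pos) {p : V} {n : ℕ} (hn : 5 ≤ n) {w : ZMod n → V}
    (hw : IsLinkCycle M.faces p w) (hG : ∀ f ∈ M.faces, p ∈ f → f ∈ G) :
    ∃ τ : ℂ, (τ = ζ ∨ τ = (starRingEnd ℂ) ζ) ∧
      ∀ i : ZMod n, pos (w (i + 1)) - pos p = (pos (w i) - pos p) * τ := by
  have hg : ∀ i, {p, w i, w (i + 1)} ∈ G := fun i => hG _ (hw.mem i) (by simp)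
  have hne := fun i => M.ne_of_mem_faces (hw.mem i)
  have h1 := fun i => hc.third_vertex (hg i) (hne i).1 (hne i).2.1 (hne i).2.2
  have hstep : ∀ (i : ZMod n) (τ : ℂ), (τ = ζ ∨ τ = (starRingEnd ℂ) ζ) →
      pos (w (i + 1)) - pos p = (pos (w i) - pos p) * τ →
      pos (w (i + 1 + 1)) - pos p = (pos (w (i + 1)) - pos p) * τ := by
    intro i τ hτ hi
    -- With at least five neighbours, `w (i + 2)` differs from `w i`, so the polygon cannot turn
    -- back: every step rotates in the same sense as the one before.
    have hback : pos (w (i + 1 + 1)) ≠ pos (w i) := fun h => by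
      have := hc.inj _ (hg (i + 1)) _ (hg i) (w (i + 1 + 1)) (by simp) (w i) (by simp) h
      refine hw.natCast_ne i (j := 2) (by norm_num) (by omega) ?_
      rw [← this, add_assoc]; norm_num
    have hz := ζ_mul_conj
    rcases hτ with rfl | rfl <;> rcases h1 (i + 1) with h | h
    · exact h
    · refine absurd ?_ hback
      linear_combination h + (starRingEnd ℂ) ζ * hi + (pos (w i) - pos p) * hz
    · refine absurd ?_ hback
      linear_combination h + ζ * hi + (pos (w i) - pos p) * hz
    · exact h
  have : NeZero n := ⟨by omega⟩
  obtain ⟨τ, hτ, h0⟩ : ∃ τ : ℂ, (τ = ζ ∨ τ = (starRingEnd ℂ) ζ) ∧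
      pos (w (0 + 1)) - pos p = (pos (w 0) - pos p) * τ := by
    rcases h1 0 with h | h
    exacts [⟨_, Or.inl rfl, h⟩, ⟨_, Or.inr rfl, h⟩]
  refine ⟨τ, hτ, fun i => ?_⟩
  rw [← ZMod.natCast_zmod_val i]
  induction i.val with
  | zero => simpa using h0
  | succ k ih =>
    have := hstep _ τ hτ ih
    push_cast
    exact this

omit [DecidableEq V] in
theorem pos_link_pow {p : V} {n : ℕ} {w : ZMod n → V} {τ : ℂ}
    (h : ∀ i : ZMod n, pos (w (i + 1)) - pos p = (pos (w i) - pos p) * τ) (k : ℕ) :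
    pos (w k) - pos p = (pos (w 0) - pos p) * τ ^ k := by
  induction k with
  | zero => simp
  | succ k ih => push_cast; rw [h, ih]; ring

/-- The position of a point on a ray from a vertex. -/
theorem wsum_onRay {p q r : V} (hpq : p ≠ q) (hpr : p ≠ r) (hqr : q ≠ r) {α s : ℝ} {x : V → ℝ}
    (hx : OnRay p q r α s x) :
    (pos r - pos p = (pos q - pos p) * ζ →
      wsum pos x = pos p + (pos q - pos p) * (s * exp (α * I))) ∧
    (pos r - pos p = (pos q - pos p) * (starRingEnd ℂ) ζ →
      wsum pos x = pos p + (pos q - pos p) * (starRingEnd ℂ) (s * exp (α * I))) := by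
  refine ⟨fun h => ?_, fun h => ?_⟩
  · rw [wsum_eq hpq hpr hqr h hx.1, hx.2]
  · rw [wsum_eq hpq hpr hqr h hx.1, ← hx.2]; simp

/-- With six triangles each of the two angles is `π`, so the rays are opposite. -/
theorem exp_opposite {k : ℕ} {α β : ℝ} (h : k * (Real.pi / 3) + β - α = 6 * (Real.pi / 6)) :
    ζ ^ k * exp (β * I) = -exp (α * I) := by
  rw [ζ_pow, ← Complex.exp_add, ← Complex.exp_add_pi_mul_I]
  congr 1
  have : (k * (Real.pi / 3) : ℝ) + β = α + Real.pi := by linarith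
  rw [← add_mul, ← add_mul]
  exact_mod_cast congrArg (fun x : ℝ => (x : ℂ) * I) this

/-- Going once around the vertex in the chart gives `τ ^ n = 1` for a rotation `τ` by 60°, where `n`
is the degree. Hence the degree is six, and equal angles mean that the two rays are opposite. -/
theorem straightIn_of_bisectsAt (hc : M.IsChart G pos) {γ : ℝ → V → ℝ} {t : ℝ}
    (hG : ∀ f ∈ M.faces, γ t ∈ disk f → f ∈ G) (h : M.BisectsAt γ t) : hc.StraightIn γ t := by
  obtain ⟨p, w, hw, α, -, β, -, k, -, hk, ε, hε, H⟩ := h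
  obtain ⟨hn5, hn7⟩ := M.degree_mem p
  have hne := fun i => M.ne_of_mem_faces (hw.mem i)
  have h01 : (0 : ZMod (M.degree p)) + 1 = 1 := zero_add 1
  have hne0 := hne 0
  rw [h01] at hne0
  have hp : γ t = Pi.single p 1 := by
    have := (H 0 le_rfl hε).1
    rw [add_zero] at this
    exact this.eq_single hne0.1 hne0.2.1 hne0.2.2
  have hG' : ∀ f ∈ M.faces, p ∈ f → f ∈ G := fun f hf hpf =>
    hG f hf (hp ▸ single_mem_disk hpf)
  obtain ⟨τ, hτ, hlink⟩ := hc.pos_link hn5 hw hG'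
  have hpow := pos_link_pow hlink
  have hgi : ∀ i, {p, w i, w (i + 1)} ∈ G := fun i => hG' _ (hw.mem i) (by simp)
  have hq : ‖pos (w 0) - pos p‖ = 1 :=
    hc.dist_eq_one _ (hgi 0) (w 0) (by simp) p (by simp) hne0.1.symm
  have hq0 : pos (w 0) - pos p ≠ 0 := fun h => by rw [h] at hq; simp at hq
  have hτn : τ ^ M.degree p = 1 := by
    have := hpow (M.degree p)
    rw [ZMod.natCast_self] at this
    exact (mul_left_cancel₀ hq0 (by rw [mul_one]; exact this)).symm
  have hdeg : M.degree p = 6 := by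
    apply six_of_ζ_pow hn5 hn7
    rcases hτ with rfl | rfl
    · exact hτn
    · rw [← map_pow] at hτn
      simpa using congrArg (starRingEnd ℂ) hτn
  have hk' : k * (Real.pi / 3) + β - α = 6 * (Real.pi / 6) := by
    rw [hk, hdeg]; norm_num
  have hexp := exp_opposite hk'
  have hl0 := hlink 0
  rw [h01] at hl0
  have hmem : ∀ s : ℝ, |s| < ε → ∃ f ∈ G, γ (t + s) ∈ disk f := by
    intro s hs
    rcases le_total 0 s with h0 | h0
    · exact ⟨_, h01 ▸ hgi 0, (H s h0 (by rwa [abs_of_nonneg h0] at hs)).1.1⟩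
    · have := (H (-s) (by linarith) (by rwa [abs_of_nonpos h0] at hs)).2.1
      rw [sub_neg_eq_add] at this
      exact ⟨_, hgi _, this⟩
  have h1 : ‖exp (α * I)‖ = 1 := Complex.norm_exp_ofReal_mul_I α
  rcases hτ with rfl | rfl
  · refine hc.straightIn_of_affine (z := pos p) (u := (pos (w 0) - pos p) * exp (α * I))
      (by simp [hq, h1]) hε fun s hs => ⟨hmem s hs, ?_⟩
    rcases le_total 0 s with h0 | h0
    · rw [(wsum_onRay hne0.1 hne0.2.1 hne0.2.2 (H s h0 (by rwa [abs_of_nonneg h0] at hs)).1).1 hl0]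
      ring
    · have := (H (-s) (by linarith) (by rwa [abs_of_nonpos h0] at hs)).2
      rw [sub_neg_eq_add] at this
      rw [(wsum_onRay (hne _).1 (hne _).2.1 (hne _).2.2 this).1 (hlink _), hpow]
      push_cast
      linear_combination -(pos (w 0) - pos p) * s * hexp
  · refine hc.straightIn_of_affine (z := pos p)
      (u := (pos (w 0) - pos p) * (starRingEnd ℂ) (exp (α * I)))
      (by simp [hq, h1]) hε fun s hs => ⟨hmem s hs, ?_⟩
    have hexp' := congrArg (starRingEnd ℂ) hexp
    rw [map_mul, map_pow, map_neg] at hexp'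
    rcases le_total 0 s with h0 | h0
    · rw [(wsum_onRay hne0.1 hne0.2.1 hne0.2.2 (H s h0 (by rwa [abs_of_nonneg h0] at hs)).1).2 hl0]
      rw [map_mul, conj_ofReal]; ring
    · have := (H (-s) (by linarith) (by rwa [abs_of_nonpos h0] at hs)).2
      rw [sub_neg_eq_add] at this
      rw [(wsum_onRay (hne _).1 (hne _).2.1 (hne _).2.2 this).2 (hlink _), hpow, map_mul,
        conj_ofReal]
      push_cast
      linear_combination -(pos (w 0) - pos p) * s * hexp'

end IsChart

/-! ### Parametrized geodesics and the continuation of rays. -/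

/-- A parametrized line of an S-manifold. -/
def IsGeodesic (M : SManifold V) (γ : ℝ → V → ℝ) : Prop :=
  ∀ t, M.StraightAt γ t ∨ M.BisectsAt γ t

theorem IsGeodesic.mem_points {M : SManifold V} {γ : ℝ → V → ℝ} (h : M.IsGeodesic γ) (t : ℝ) :
    γ t ∈ M.points := (h t).elim StraightAt.mem_points BisectsAt.mem_points

theorem IsGeodesic.straightIn {M : SManifold V} {γ : ℝ → V → ℝ} (h : M.IsGeodesic γ) {t : ℝ}
    {G : Set (Finset V)} {pos : V → ℂ} (hc : M.IsChart G pos)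
    (hG : ∀ f ∈ M.faces, γ t ∈ disk f → f ∈ G) : hc.StraightIn γ t :=
  (h t).elim (hc.straightIn_of_straightAt hG) (hc.straightIn_of_bisectsAt hG)

end SManifold

/-- A continuous curve which is straight in `Ω`, and starts on a ray, follows the ray as long as the
ray stays in `Ω`. -/
theorem eq_ray_of_locally_straight {E : Type*} [NormedAddCommGroup E] [NormedSpace ℝ E]
    {f : ℝ → E} (hf : Continuous f) {Ω : Set E}
    (hloc : ∀ t, f t ∈ Ω → ∃ u, ∃ ε > 0, ∀ s : ℝ, |s| < ε → f (t + s) = f t + s • u)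
    {t₀ : ℝ} {z u : E} {δ : ℝ} (hδ : 0 < δ) (h0 : ∀ s : ℝ, 0 ≤ s → s < δ → f (t₀ + s) = z + s • u)
    {S : ℝ} (hΩ : ∀ s : ℝ, 0 < s → s < S → z + s • u ∈ Ω) :
    ∀ s : ℝ, 0 ≤ s → s ≤ S → f (t₀ + s) = z + s • u := by
  by_contra! hcon
  obtain ⟨s₁, hs₁0, hs₁S, hs₁⟩ := hcon
  -- The infimum of the bad times is at least `δ`, hence positive, so `Ω` is never needed at the
  -- start, which may be a vertex or a point of an edge. At the end `S` continuity suffices.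
  set B : Set ℝ := {s | 0 ≤ s ∧ f (t₀ + s) ≠ z + s • u} with hB
  have hBne : B.Nonempty := ⟨s₁, hs₁0, hs₁⟩
  have hlb : ∀ s ∈ B, δ ≤ s := fun s hs => by
    by_contra! h
    exact hs.2 (h0 s hs.1 h)
  have hbdd : BddBelow B := ⟨δ, hlb⟩
  set T := sInf B with hT
  have hTδ : δ ≤ T := le_csInf hBne hlb
  have hlt : ∀ s, 0 ≤ s → s < T → f (t₀ + s) = z + s • u := fun s hs hsT => by
    by_contra h
    exact absurd (csInf_le hbdd (show s ∈ B from ⟨hs, h⟩)) (not_le.2 hsT)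
  have hTeq : f (t₀ + T) = z + T • u := by
    have h1 : Filter.Tendsto (fun s => f (t₀ + s)) (nhdsWithin T (Set.Iio T))
        (nhds (f (t₀ + T))) :=
      (Continuous.tendsto (by fun_prop) T).mono_left nhdsWithin_le_nhds
    have h2 : Filter.Tendsto (fun s : ℝ => z + s • u) (nhdsWithin T (Set.Iio T))
        (nhds (z + T • u)) :=
      (Continuous.tendsto (by fun_prop) T).mono_left nhdsWithin_le_nhds
    refine tendsto_nhds_unique_of_eventuallyEq h1 h2 ?_
    filter_upwards [self_mem_nhdsWithin, mem_nhdsWithin_of_mem_nhds (lt_mem_nhds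
      (hδ.trans_le hTδ))] with s hs hs0
    exact hlt s (le_of_lt hs0) hs
  have hTS : T < S := by
    refine lt_of_le_of_ne ((csInf_le hbdd (show s₁ ∈ B from ⟨hs₁0, hs₁⟩)).trans hs₁S) fun h => ?_
    have : s₁ = T := le_antisymm (h ▸ hs₁S) (csInf_le hbdd ⟨hs₁0, hs₁⟩)
    exact hs₁ (this ▸ hTeq)
  obtain ⟨u', ε, hε, hu'⟩ := hloc (t₀ + T) (hTeq ▸ hΩ T (hδ.trans_le hTδ) hTS)
  -- Just before `T` the curve still follows the ray, and this determines the direction at `T`.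
  have huu : u' = u := by
    set r := min (ε / 2) (T / 2) with hr
    have hr0 : 0 < r := lt_min (by linarith) (by linarith)
    have hr1 : r ≤ ε / 2 := min_le_left _ _
    have hr2 : r ≤ T / 2 := min_le_right _ _
    have e1 := hu' (-r) (by rw [abs_neg, abs_of_pos hr0]; linarith)
    have e2 := hlt (T - r) (by linarith) (by linarith)
    rw [show t₀ + T + -r = t₀ + (T - r) by ring, e2, hTeq, sub_smul, neg_smul] at e1
    have e3 : r • u' = r • u := by
      have e4 := sub_eq_zero.2 e1
      rw [← sub_eq_zero, ← e4]; abel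
    exact smul_right_injective E hr0.ne' e3
  obtain ⟨s, hs, hsT⟩ := exists_lt_of_csInf_lt hBne (show sInf B < T + ε by linarith)
  have hTs : T ≤ s := csInf_le hbdd hs
  refine hs.2 ?_
  have := hu' (s - T) (by rw [abs_of_nonneg (by linarith)]; linarith)
  rw [show t₀ + T + (s - T) = t₀ + s by ring, hTeq, huu, sub_smul] at this
  rw [this]; abel

/-! ### Continuity, reversal and behaviour at vertices. -/

namespace SManifold

open Complex

variable {V : Type*} [DecidableEq V] {M : SManifold V}

/-- The coordinates at the two apexes are the positive and negative parts of one multiple of the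
imaginary part. Thus barycentric coordinates depend continuously on the unfolded position, even
across the common edge. -/
theorem coords_of_unfold {a b c d : V} (had : a ≠ d) (ha : {a, b, c} ∈ M.faces)
    (hd : {d, b, c} ∈ M.faces) {x : V → ℝ} (hx : x ∈ disk {a, b, c} ∪ disk {d, b, c}) :
    x a = max 0 (2 / √3 * (unfold a c d x).im) ∧ x d = max 0 (-(2 / √3 * (unfold a c d x).im)) ∧
      x c = (unfold a c d x).re - (x a + x d) / 2 ∧ x b = 1 - x a - x d - x c ∧ 0 ≤ x b ∧ 0 ≤ x c ∧
      ∀ {E : Type} [AddCommGroup E] [Module ℝ E] (g : V → E),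
        wsum g x = x a • g a + x d • g d + x b • g b + x c • g c := by
  obtain ⟨hab, hac, hbc⟩ := M.ne_of_mem_faces ha
  obtain ⟨hdb, hdc, -⟩ := M.ne_of_mem_faces hd
  have h3 := sqrt_three_pos
  have him : 2 / √3 * (unfold a c d x).im = x a - x d := by
    rw [unfold_im]; field_simp
  rw [him, unfold_re]
  rcases hx with hx | hx
  · obtain ⟨h1, h2, h3, h4, h5⟩ := (mem_disk_triple hab hac hbc).1 hx
    have h0 : x d = 0 := h4 d had.symm hdb hdc
    refine ⟨?_, ?_, by ring, by linarith, h2, h3, fun g => ?_⟩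
    · rw [h0, max_eq_right] <;> linarith
    · rw [h0, max_eq_left]; linarith
    · rw [wsum_triple g hab hac hbc hx, h0]; simp
  · obtain ⟨h1, h2, h3, h4, h5⟩ := (mem_disk_triple hdb hdc hbc).1 hx
    have h0 : x a = 0 := h4 a had hab hac
    refine ⟨?_, ?_, by ring, by linarith, h2, h3, fun g => ?_⟩
    · rw [h0, max_eq_left]; linarith
    · rw [h0, max_eq_right] <;> linarith
    · rw [wsum_triple g hdb hdc hbc hx, h0]; simp

theorem OnRay.coords {p q r : V} {α s : ℝ} {x : V → ℝ} (hx : OnRay p q r α s x) :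
    x r = s * (2 / √3 * Real.sin α) ∧ x q = s * (Real.cos α - Real.sin α / √3) := by
  have h3 := sqrt_three_pos
  have h1 := congrArg Complex.re hx.2
  have h2 := congrArg Complex.im hx.2
  rw [Complex.exp_ofReal_mul_I] at h1 h2
  simp [ζ_re, ζ_im] at h1 h2
  rw [Complex.cos_ofReal_re] at h1
  rw [Complex.sin_ofReal_re] at h2
  have hr : x r = s * (2 / √3 * Real.sin α) := by
    field_simp
    linarith
  refine ⟨hr, ?_⟩
  rw [hr] at h1
  have : x q = s * Real.cos α - s * (2 / √3 * Real.sin α) * (1 / 2) := by linarith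
  rw [this]; ring

/-- Near `t` the barycentric coordinates are explicit continuous functions of the affine motion `z +
s * u`. -/
theorem StraightAt.continuousAt {γ : ℝ → V → ℝ} {t : ℝ} (h : M.StraightAt γ t) (g : V → ℝ) :
    ContinuousAt (fun t => wsum g (γ t)) t := by
  obtain ⟨a, b, c, d, had, ha, hd, z, u, hu, ε, hε, H⟩ := h
  set U : ℝ → ℂ := fun s => z + s * u with hU
  have hUc : Continuous U := by fun_prop
  set A : ℝ → ℝ := fun s => max 0 (2 / √3 * (U s).im) with hA
  set D : ℝ → ℝ := fun s => max 0 (-(2 / √3 * (U s).im)) with hD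
  set C : ℝ → ℝ := fun s => (U s).re - (A s + D s) / 2 with hC
  have hAc : Continuous A := by fun_prop
  have hDc : Continuous D := by fun_prop
  have hCc : Continuous C := by fun_prop
  have hcont : Continuous fun s => A s • g a + D s • g d + (1 - A s - D s - C s) • g b
      + C s • g c := by fun_prop
  have key : (fun τ => (fun s => A s • g a + D s • g d + (1 - A s - D s - C s) • g b
      + C s • g c) (τ - t)) =ᶠ[nhds t] fun t => wsum g (γ t) := by
    filter_upwards [Metric.ball_mem_nhds t hε] with τ hτ
    have hs : |τ - t| < ε := by simpa [Real.dist_eq] using hτ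
    obtain ⟨h1, h2⟩ := H _ hs
    rw [add_sub_cancel] at h1 h2
    obtain ⟨ea, ed, ec, eb, -, -, ew⟩ := coords_of_unfold had ha hd h1
    have hU' : U (τ - t) = unfold a c d (γ τ) := by rw [h2]
    have hA' : A (τ - t) = γ τ a := by rw [ea, ← hU']
    have hD' : D (τ - t) = γ τ d := by rw [ed, ← hU']
    have hC' : C (τ - t) = γ τ c := by rw [ec, ← hU', ← hA', ← hD']
    change A (τ - t) • g a + D (τ - t) • g d + (1 - A (τ - t) - D (τ - t) - C (τ - t)) • g b
      + C (τ - t) • g c = _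
    rw [ew g, hA', hD', hC', ← eb]
  exact (hcont.comp (continuous_id.sub continuous_const)).continuousAt.congr key

theorem OnRay.wsum_eq {p q r : V} (hpq : p ≠ q) (hpr : p ≠ r) (hqr : q ≠ r) {α s : ℝ}
    {x : V → ℝ} (hx : OnRay p q r α s x) (g : V → ℝ) :
    wsum g x = g p + s * ((Real.cos α - Real.sin α / √3) * (g q - g p)
      + (2 / √3 * Real.sin α) * (g r - g p)) := by
  obtain ⟨-, -, -, -, h⟩ := (mem_disk_triple hpq hpr hqr).1 hx.1
  obtain ⟨h1, h2⟩ := hx.coords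
  rw [wsum_triple g hpq hpr hqr hx.1, show x p = 1 - x q - x r by linarith, h1, h2]
  simp only [smul_eq_mul]
  ring

/-- The weighted sum is affine along each of the two rays, and both start at the value `g p`, so the
one-sided limits agree. -/
theorem BisectsAt.continuousAt {γ : ℝ → V → ℝ} {t : ℝ} (h : M.BisectsAt γ t) (g : V → ℝ) :
    ContinuousAt (fun t => wsum g (γ t)) t := by
  obtain ⟨p, w, hw, α, -, β, -, k, -, -, ε, hε, H⟩ := h
  have hne := fun i => M.ne_of_mem_faces (hw.mem i)
  have hne0 := hne 0
  rw [zero_add] at hne0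
  have e0 := (H 0 le_rfl hε).1.wsum_eq hne0.1 hne0.2.1 hne0.2.2 g
  rw [zero_mul, add_zero, add_zero] at e0
  rw [continuousAt_iff_continuous_left_right]
  constructor
  · set C := (Real.cos β - Real.sin β / √3) * (g (w k) - g p)
      + (2 / √3 * Real.sin β) * (g (w (k + 1)) - g p) with hC
    have hc : ContinuousWithinAt (fun τ => g p + (t - τ) * C) (Set.Iic t) t :=
      Continuous.continuousWithinAt (by fun_prop)
    refine hc.congr_of_eventuallyEq ?_ (by simp [e0])
    filter_upwards [self_mem_nhdsWithin, mem_nhdsWithin_of_mem_nhds (Metric.ball_mem_nhds t hε)]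
      with τ h1 h2
    have h1 : τ ≤ t := h1
    rw [Metric.mem_ball, Real.dist_eq, abs_of_nonpos (by linarith)] at h2
    have := (H (t - τ) (by linarith) (by linarith)).2.wsum_eq (hne _).1 (hne _).2.1 (hne _).2.2 g
    rw [sub_sub_cancel] at this
    exact this
  · set C := (Real.cos α - Real.sin α / √3) * (g (w 0) - g p)
      + (2 / √3 * Real.sin α) * (g (w 1) - g p) with hC
    have hc : ContinuousWithinAt (fun τ => g p + (τ - t) * C) (Set.Ici t) t :=
      Continuous.continuousWithinAt (by fun_prop)
    refine hc.congr_of_eventuallyEq ?_ (by simp [e0])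
    filter_upwards [self_mem_nhdsWithin, mem_nhdsWithin_of_mem_nhds (Metric.ball_mem_nhds t hε)]
      with τ h1 h2
    have h1 : t ≤ τ := h1
    rw [Metric.mem_ball, Real.dist_eq, abs_of_nonneg (by linarith)] at h2
    have := (H (τ - t) (by linarith) (by linarith)).1.wsum_eq hne0.1 hne0.2.1 hne0.2.2 g
    rw [add_sub_cancel] at this
    exact this

theorem IsGeodesic.continuous {γ : ℝ → V → ℝ} (h : M.IsGeodesic γ) (g : V → ℝ) :
    Continuous fun t => wsum g (γ t) :=
  continuous_iff_continuousAt.2 fun t => (h t).elim (·.continuousAt g) (·.continuousAt g)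

section Reverse

theorem StraightAt.reverse {γ : ℝ → V → ℝ} {t : ℝ} (h : M.StraightAt γ t) :
    M.StraightAt (fun s => γ (-s)) (-t) := by
  obtain ⟨a, b, c, d, had, ha, hd, z, u, hu, ε, hε, H⟩ := h
  refine ⟨a, b, c, d, had, ha, hd, z, -u, by simpa, ε, hε, fun s hs => ?_⟩
  have := H (-s) (by simpa using hs)
  beta_reduce
  rw [show -(-t + s) = t + -s by ring]
  refine ⟨this.1, ?_⟩
  rw [this.2]; push_cast; ring

/-- Reflection in the bisector of the angle at `p`. -/
theorem OnRay.flip {p q r : V} {α s : ℝ} {x : V → ℝ} (hx : OnRay p q r α s x) :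
    OnRay p r q (Real.pi / 3 - α) s x := by
  refine ⟨mem_disk_symm hx.1, ?_⟩
  have h1 := congrArg (starRingEnd ℂ) hx.2
  have h2 : exp ((Real.pi / 3 - α : ℝ) * I) = ζ * (starRingEnd ℂ) (exp (α * I)) := by
    rw [ζ, ← Complex.exp_conj, ← Complex.exp_add]
    congr 1
    simp; ring
  rw [h2]
  simp only [map_add, map_mul, conj_ofReal] at h1
  linear_combination ζ * h1 - (x r : ℂ) * ζ_mul_conj

theorem _root_.IsLinkCycle.reflect {F : Set (Finset V)} {p : V} {n : ℕ} {w : ZMod n → V}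
    (h : IsLinkCycle F p w) (c : ZMod n) : IsLinkCycle F p fun i => w (c - i) := by
  refine ⟨fun i j hij => sub_right_injective (h.injective hij), fun f => ?_⟩
  rw [h.faces_iff]
  constructor
  · rintro ⟨i, rfl⟩
    refine ⟨c - i - 1, ?_⟩
    rw [show c - (c - i - 1) = i + 1 by ring, show c - (c - i - 1 + 1) = i by ring,
      Finset.pair_comm]
  · rintro ⟨i, rfl⟩
    refine ⟨c - (i + 1), ?_⟩
    rw [show c - (i + 1) + 1 = c - i by ring, Finset.pair_comm]

/-- Reversal exchanges the two rays. The reflected cycle `i ↦ w (k + 1 - i)` makes the second ray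
start in triangle `0` and the first one in triangle `k`, and replaces each angle by its complement
in `π / 3`. -/
theorem BisectsAt.reverse {γ : ℝ → V → ℝ} {t : ℝ} (h : M.BisectsAt γ t) :
    M.BisectsAt (fun s => γ (-s)) (-t) := by
  obtain ⟨p, w, hw, α, hα, β, hβ, k, hk, hkn, ε, hε, H⟩ := h
  refine ⟨p, _, hw.reflect (k + 1), Real.pi / 3 - β, ⟨by linarith [hβ.2], by linarith [hβ.1]⟩,
    Real.pi / 3 - α, ⟨by linarith [hα.2], by linarith [hα.1]⟩, k, hk, by linarith, ε, hε,
    fun s h0 hs => ?_⟩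
  obtain ⟨h1, h2⟩ := H s h0 hs
  beta_reduce
  rw [show -(-t + s) = t - s by ring, show -(-t - s) = t + s by ring]
  refine ⟨?_, ?_⟩
  · rw [sub_zero, add_sub_cancel_right]; exact h2.flip
  · rw [add_sub_cancel_left, show (k : ZMod (M.degree p)) + 1 - (k + 1) = 0 by ring]
    exact h1.flip

theorem IsGeodesic.reverse {γ : ℝ → V → ℝ} (h : M.IsGeodesic γ) :
    M.IsGeodesic fun s => γ (-s) := fun t => by
  have := (h (-t)).imp StraightAt.reverse BisectsAt.reverse
  rwa [neg_neg] at this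

end Reverse

/-- A curve is not straight at a vertex. -/
theorem StraightAt.ne_single {γ : ℝ → V → ℝ} {t : ℝ} (h : M.StraightAt γ t) (v : V) :
    γ t ≠ Pi.single v 1 := by
  intro hv
  obtain ⟨a, b, c, d, had, ha, hd, z, u, hu, ε, hε, H⟩ := h
  obtain ⟨hab, hac, hbc⟩ := M.ne_of_mem_faces ha
  obtain ⟨hdb, hdc, -⟩ := M.ne_of_mem_faces hd
  have h3 := sqrt_three_pos
  have hpm : |ε / 2| < ε := by rw [abs_of_pos] <;> linarith
  obtain ⟨hp, ep⟩ := H (ε / 2) hpm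
  obtain ⟨hm, em⟩ := H (-(ε / 2)) (by rwa [abs_neg])
  obtain ⟨h0, e0⟩ := H 0 (by simpa using hε)
  simp only [add_zero, ofReal_zero, zero_mul] at h0 e0
  set x := γ (t + ε / 2)
  set y := γ (t + -(ε / 2))
  obtain ⟨xa, xd, -, xb, xb0, xc0, -⟩ := coords_of_unfold had ha hd hp
  obtain ⟨ya, yd, -, yb, yb0, yc0, -⟩ := coords_of_unfold had ha hd hm
  have xa0 : 0 ≤ x a := xa ▸ le_max_left _ _
  have xd0 : 0 ≤ x d := xd ▸ le_max_left _ _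
  have ya0 : 0 ≤ y a := ya ▸ le_max_left _ _
  have yd0 : 0 ≤ y d := yd ▸ le_max_left _ _
  -- The vertex would be the midpoint of the unfolded `x` and `y`. All four corners of the rhombus
  -- are extreme points, so `x` and `y` would coincide, although they are `ε` apart.
  have esum : unfold a c d x + unfold a c d y = 2 * unfold a c d (γ t) := by
    rw [ep, em, e0]; push_cast; ring
  have hre := congrArg Complex.re esum
  have him := congrArg Complex.im esum
  simp only [add_re, add_im, mul_re, mul_im, re_ofNat, im_ofNat, zero_mul, sub_zero, add_zero]
    at hre him
  rw [unfold_re, unfold_re, unfold_re] at hre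
  rw [unfold_im, unfold_im, unfold_im] at him
  have him' : x a - x d + (y a - y d) = 2 * (γ t a - γ t d) := by
    have : √3 / 2 ≠ 0 := by positivity
    apply mul_left_cancel₀ this
    linarith
  have hne : unfold a c d x ≠ unfold a c d y := by
    rw [ep, em]
    intro h
    have : (ε : ℂ) * u = 0 := by push_cast at h; linear_combination h
    rw [mul_eq_zero] at this
    rcases this with h | h
    · exact hε.ne' (by exact_mod_cast h)
    · rw [h] at hu; simp at hu
  apply hne
  have hfin : x a = y a → x d = y d → x c = y c → unfold a c d x = unfold a c d y := by
    intro h1 h2 h3; simp [unfold, h1, h2, h3]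
  have hmem : v = a ∨ v = b ∨ v = c ∨ v = d := by
    by_contra! hcon
    obtain ⟨h1, h2, h3, h4⟩ := hcon
    have hv1 : γ t v = 1 := by rw [hv]; simp
    have : γ t v = 0 := h0.elim (fun h => h.2.1 v (by simp [h1, h2, h3]))
      fun h => h.2.1 v (by simp [h4, h2, h3])
    linarith
  have single_ne : ∀ w, w ≠ v → γ t w = 0 := fun w hw => by rw [hv]; simp [hw]
  have single_eq : γ t v = 1 := by rw [hv]; simp
  rcases hmem with rfl | rfl | rfl | rfl
  · have := single_ne d had.symm
    have := single_ne c hac.symm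
    apply hfin <;> linarith
  · have := single_ne a hab
    have := single_ne c hbc.symm
    have := single_ne d hdb
    apply hfin <;> linarith
  · have := single_ne a hac
    have := single_ne d hdc
    apply hfin <;> linarith
  · have := single_ne a had
    have := single_ne c hdc.symm
    apply hfin <;> linarith

/-- In a link cycle, the neighbours of `w i` are `w (i - 1)` and `w (i + 1)`. -/
theorem _root_.IsLinkCycle.eq_or_of_mem {p : V} {n : ℕ} {w : ZMod n → V}
    (hw : IsLinkCycle M.faces p w) {i : ZMod n} {v : V} (hv : {p, w i, v} ∈ M.faces) :
    v = w (i - 1) ∨ v = w (i + 1) := by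
  obtain ⟨hpi, hpv, hiv⟩ := M.ne_of_mem_faces hv
  obtain ⟨j, hj⟩ := (hw.faces_iff _).1 ⟨hv, by simp⟩
  have h1 : w i ∈ ({p, w j, w (j + 1)} : Finset V) := by rw [← hj]; simp
  have h2 : v ∈ ({p, w j, w (j + 1)} : Finset V) := by rw [← hj]; simp
  simp only [Finset.mem_insert, Finset.mem_singleton, hpi.symm, hpv.symm, false_or] at h1 h2
  rcases h1 with h1 | h1
  · have := hw.injective h1
    subst this
    rcases h2 with h2 | h2
    · exact absurd h2.symm hiv
    · exact Or.inr h2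
  · have := hw.injective h1
    subst this
    rcases h2 with h2 | h2
    · left; rw [add_sub_cancel_right]; exact h2
    · exact absurd h2.symm hiv

/-- A curve which reaches an elliptic vertex along an edge leaves it perpendicularly to the opposite
edge of the link. -/
theorem BisectsAt.of_edge {p : V} {m : ZMod 5 → V} (hm : IsLinkCycle M.faces p m)
    (hdeg : M.degree p = 5) {γ : ℝ → V → ℝ} {t : ℝ} (h : M.BisectsAt γ t)
    (hp : γ t = Pi.single p 1) {δ : ℝ} (hδ : 0 < δ)
    (hin : ∀ s, 0 < s → s < δ → 0 < γ (t - s) (m 0) ∧ ∀ v, v ≠ p → v ≠ m 0 → γ (t - s) v = 0) :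
    ∃ ε > 0, ∀ s, 0 ≤ s → s < ε → γ (t + s) ∈ disk {p, m 2, m 3} ∧
      γ (t + s) (m 2) = s / √3 ∧ γ (t + s) (m 3) = s / √3 := by
  obtain ⟨q, w, hw, α, hα, β, hβ, k, hk, hkn, ε, hε, H⟩ := h
  have hne := fun i => M.ne_of_mem_faces (hw.mem i)
  have hne0 := hne 0
  rw [zero_add] at hne0
  have hpq : p = q := by
    have := (H 0 le_rfl hε).1
    rw [add_zero] at this
    have h1 := this.eq_single hne0.1 hne0.2.1 hne0.2.2
    rw [hp] at h1
    by_contra hc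
    have := congrFun h1 p
    simp [hc] at this
  subst hpq
  have h3 := sqrt_three_pos
  have hpi := Real.pi_pos
  rw [hdeg] at hkn
  obtain ⟨s, hs0, hs⟩ : ∃ s, 0 < s ∧ s < min δ ε := exists_between (lt_min hδ hε)
  have hsδ := hs.trans_le (min_le_left _ _)
  have hsε := hs.trans_le (min_le_right _ _)
  obtain ⟨hpos, hzero⟩ := hin s hs0 hsδ
  have hray := (H s hs0.le hsε).2
  obtain ⟨e1, e2⟩ := hray.coords
  have hm0 : p ≠ m 0 := (M.ne_of_mem_faces (hm.mem 0)).1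
  have hmem : m 0 ∈ ({p, w k, w (k + 1)} : Finset V) := by
    by_contra hc
    exact hpos.ne' (hray.1.2.1 _ hc)
  simp only [Finset.mem_insert, Finset.mem_singleton, hm0.symm, false_or] at hmem
  -- The arriving ray lies on the edge to `m 0`, which bounds two triangles, so either `β = 0` or `β
  -- = π / 3`. A total angle of `5 * π / 6` then forces `k = 3` or `k = 2` respectively; in both
  -- cases the edge ends at `w 3` and `α = π / 6`.
  have hw3α : w (3 : ℕ) = m 0 ∧ α = Real.pi / 6 := by
    rcases hmem with hmem | hmem
    · have h0 : γ (t - s) (w (k + 1)) = 0 :=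
        hzero _ (hne _).2.1.symm (by rw [hmem]; exact (hne _).2.2.symm)
      rw [h0] at e1
      have hsin : Real.sin β = 0 := by
        have : s * (2 / √3) ≠ 0 := by positivity
        exact (mul_eq_zero.1 (by linarith : s * (2 / √3) * Real.sin β = 0)).resolve_left this
      have hβ0 : β = 0 :=
        (Real.sin_eq_zero_iff_of_lt_of_lt (by linarith [hβ.1]) (by linarith [hβ.2])).1 hsin
      subst hβ0
      have hk3 : k = 3 := by
        have h1 : (2 : ℝ) < k := by
          by_contra! hc
          nlinarith [hα.1]
        have h2 : (k : ℝ) < 4 := by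
          by_contra! hc
          nlinarith [hα.2]
        have h1' : 2 < k := by exact_mod_cast h1
        have h2' : k < 4 := by exact_mod_cast h2
        omega
      subst hk3
      refine ⟨hmem.symm, ?_⟩
      push_cast at hkn
      linarith
    · have h0 : γ (t - s) (w k) = 0 :=
        hzero _ (hne _).1.symm (by rw [hmem]; exact (hne _).2.2)
      obtain ⟨e1', -⟩ := hray.flip.coords
      rw [h0] at e1'
      have hsin : Real.sin (Real.pi / 3 - β) = 0 := by
        have : s * (2 / √3) ≠ 0 := by positivity
        exact (mul_eq_zero.1 (by linarith :
          s * (2 / √3) * Real.sin (Real.pi / 3 - β) = 0)).resolve_left this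
      have hβ0 : Real.pi / 3 - β = 0 :=
        (Real.sin_eq_zero_iff_of_lt_of_lt (by linarith [hβ.2]) (by linarith [hβ.1])).1 hsin
      have hβ1 : β = Real.pi / 3 := by linarith
      subst hβ1
      have hk3 : k = 2 := by
        have h1 : (1 : ℝ) < k := by
          by_contra! hc
          nlinarith [hα.1]
        have h2 : (k : ℝ) < 3 := by
          by_contra! hc
          nlinarith [hα.2]
        have h1' : 1 < k := by exact_mod_cast h1
        have h2' : k < 3 := by exact_mod_cast h2
        omega
      subst hk3
      refine ⟨?_, ?_⟩
      · rw [hmem]; congr 1; push_cast; norm_num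
      · push_cast at hkn
        linarith
  obtain ⟨hw3, rfl⟩ := hw3α
  have hn5 : ∀ (i : ZMod (M.degree p)) (j : ℕ), 0 < j → j < 5 → w (i + j) ≠ w i :=
    fun i j h0 hj => hw.natCast_ne i h0 (by omega)
  have hw2 : w (3 : ℕ) = w 3 := by congr 1
  rw [hw2] at hw3
  -- `w 0` and `w 1` are neither `m 0 = w 3` nor next to it. In the five-cycle `m` this leaves only
  -- `m 2` and `m 3`.
  have hnb : ∀ v, {p, m 0, v} ∈ M.faces → v ≠ w 0 ∧ v ≠ w 1 := by
    intro v hv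
    rw [← hw3] at hv
    rcases hw.eq_or_of_mem hv with rfl | rfl
    · constructor
      · have := hn5 0 2 (by norm_num) (by norm_num)
        rwa [show (0 : ZMod (M.degree p)) + (2 : ℕ) = 3 - 1 by push_cast; ring] at this
      · have := hn5 1 1 (by norm_num) (by norm_num)
        rwa [show (1 : ZMod (M.degree p)) + (1 : ℕ) = 3 - 1 by push_cast; ring] at this
    · constructor
      · have := hn5 0 4 (by norm_num) (by norm_num)
        rwa [show (0 : ZMod (M.degree p)) + (4 : ℕ) = 3 + 1 by push_cast; ring] at this
      · have := hn5 1 3 (by norm_num) (by norm_num)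
        rwa [show (1 : ZMod (M.degree p)) + (3 : ℕ) = 3 + 1 by push_cast; ring] at this
  have hm01 : m 0 ≠ w 0 ∧ m 0 ≠ w 1 := by
    rw [← hw3]
    constructor
    · have := hn5 0 3 (by norm_num) (by norm_num)
      rwa [show (0 : ZMod (M.degree p)) + (3 : ℕ) = 3 by push_cast; ring] at this
    · have := hn5 1 2 (by norm_num) (by norm_num)
      rwa [show (1 : ZMod (M.degree p)) + (2 : ℕ) = 3 by push_cast; ring] at this
  have hface : {p, w 0, w 1} ∈ M.faces := by simpa using hw.mem 0
  obtain ⟨i, hi⟩ := (hm.faces_iff _).1 ⟨hface, by simp⟩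
  have hmne := fun i => M.ne_of_mem_faces (hm.mem i)
  have key : ∀ j : ZMod 5, m j ≠ w 0 ∧ m j ≠ w 1 → j ≠ i ∧ j ≠ i + 1 := by
    intro j hj
    have : m j ∉ ({p, m i, m (i + 1)} : Finset V) := by
      rw [← hi]; simp [hj.1, hj.2, (hmne j).1.symm]
    constructor <;> rintro rfl <;> exact this (by simp)
  have k0 := key 0 hm01
  have k1 := key 1 (hnb _ (by simpa using hm.mem 0))
  have k4 := key 4 (hnb _ (by
    have := hm.mem 4
    rwa [show (4 : ZMod 5) + 1 = 0 from rfl, Finset.pair_comm] at this))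
  have hi2 : i = 2 := by
    clear hi key
    revert k0 k1 k4; revert i; decide
  subst hi2
  rw [show (2 : ZMod 5) + 1 = 3 from rfl] at hi
  -- Which of `m 2`, `m 3` is `w 0` stays open; it does not matter, as the two coordinates on the
  -- bisecting ray are equal.
  have hx : ∀ v ∈ ({p, m 2, m 3} : Finset V), v ≠ p → v = w 0 ∨ v = w 1 := by
    intro v hv hvp
    rw [← hi] at hv
    simpa [hvp] using hv
  refine ⟨ε, hε, fun s h0 hs => ?_⟩
  have hr := (H s h0 hs).1
  obtain ⟨c1, c2⟩ := hr.coords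
  rw [Real.sin_pi_div_six] at c1 c2
  rw [Real.cos_pi_div_six] at c2
  have c2' : γ (t + s) (w 0) = s / √3 := by
    rw [c2]; field_simp; nlinarith [sqrt_three_sq]
  have c1' : γ (t + s) (w 1) = s / √3 := by rw [c1]; field_simp
  refine ⟨hi ▸ hr.1, ?_, ?_⟩
  · rcases hx (m 2) (by simp) (hmne 2).1.symm with h | h <;> rw [h] <;> assumption
  · rcases hx (m 3) (by simp) (hmne 3).1.symm with h | h <;> rw [h] <;> assumption

/-- A curve which is affine in planar coordinates of two adjacent triangles is straight. -/
theorem straightAt_of_affine {pos : V → ℂ} {a b c d : V} (had : a ≠ d) (ha : {a, b, c} ∈ M.faces)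
    (hd : {d, b, c} ∈ M.faces) (hbc : ‖pos c - pos b‖ = 1)
    (hpa : pos a - pos b = (pos c - pos b) * ζ)
    (hpd : pos d - pos b = (pos c - pos b) * (starRingEnd ℂ) ζ)
    {γ : ℝ → V → ℝ} {t : ℝ} {z u : ℂ} (hu : ‖u‖ = 1) {ε : ℝ} (hε : 0 < ε)
    (h : ∀ s : ℝ, |s| < ε → γ (t + s) ∈ disk {a, b, c} ∪ disk {d, b, c} ∧
      wsum pos (γ (t + s)) = z + s * u) : M.StraightAt γ t := by
  obtain ⟨hab, hac, hbc'⟩ := M.ne_of_mem_faces ha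
  obtain ⟨hdb, hdc, -⟩ := M.ne_of_mem_faces hd
  have ea : ({a, b, c} : Finset V) = {b, c, a} := by
    rw [Finset.insert_comm, Finset.pair_comm]
  have ed : ({d, b, c} : Finset V) = {b, c, d} := by
    rw [Finset.insert_comm, Finset.pair_comm]
  have hq0 : pos c - pos b ≠ 0 := fun h => by rw [h] at hbc; simp at hbc
  refine ⟨a, b, c, d, had, ha, hd, (z - pos b) / (pos c - pos b), u / (pos c - pos b),
    by rw [norm_div, hu, hbc, div_one], ε, hε, fun s hs => ⟨(h s hs).1, ?_⟩⟩
  have key : pos b + (pos c - pos b) * unfold a c d (γ (t + s)) = z + s * u := by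
    rw [← (h s hs).2]
    rcases (h s hs).1 with hx | hx
    · rw [unfold_of_mem_disk had hd hx,
        IsChart.wsum_eq hbc' hab.symm hac.symm hpa (ea ▸ hx)]
    · rw [unfold_of_mem_disk' had ha hx,
        IsChart.wsum_eq hbc' hdb.symm hdc.symm hpd (ed ▸ hx)]
  field_simp
  linear_combination key

end SManifold

/-! ### S-manifolds from link cycles. -/

section LinkCycle

variable {V : Type*} [DecidableEq V] {F : Set (Finset V)} {v : V} {n : ℕ} {w : ZMod n → V}

theorem IsLinkCycle.ne_center (hF : ∀ f ∈ F, f.card = 3) (h : IsLinkCycle F v w) (i : ZMod n) :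
    v ≠ w i :=
  (SManifold.ne_of_card_triple (hF _ (h.mem i))).1

/-- If `i ≠ j` gave the same triangle, then `i = j + 1` and `i + 1 = j`, so `2 = 0` in `ZMod n`,
which `3 ≤ n` excludes. -/
theorem IsLinkCycle.face_injective (hF : ∀ f ∈ F, f.card = 3) (hn : 3 ≤ n)
    (h : IsLinkCycle F v w) :
    Function.Injective fun i : ZMod n => ({v, w i, w (i + 1)} : Finset V) := by
  intro i j hij
  have hc := h.ne_center hF
  have hi : w i ∈ ({v, w j, w (j + 1)} : Finset V) := by
    beta_reduce at hij; rw [← hij]; simp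
  have hi1 : w (i + 1) ∈ ({v, w j, w (j + 1)} : Finset V) := by
    beta_reduce at hij; rw [← hij]; simp
  simp only [Finset.mem_insert, Finset.mem_singleton, (hc _).symm, false_or,
    h.injective.eq_iff] at hi hi1
  rcases hi with hi | hi
  · exact hi
  · rcases hi1 with hi1 | hi1
    · exfalso
      have h2 : ((2 : ℕ) : ZMod n) = 0 := by push_cast; linear_combination hi1 - hi
      rw [ZMod.natCast_eq_zero_iff] at h2
      exact absurd (Nat.le_of_dvd (by norm_num) h2) (by omega)
    · linear_combination hi1

theorem IsLinkCycle.ncard_eq (hF : ∀ f ∈ F, f.card = 3) (hn : 3 ≤ n) (h : IsLinkCycle F v w) :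
    {f ∈ F | v ∈ f}.ncard = n := by
  have : {f ∈ F | v ∈ f} = Set.range fun i : ZMod n => ({v, w i, w (i + 1)} : Finset V) := by
    ext f
    rw [Set.mem_ofPred_eq, h.faces_iff, Set.mem_range]
    simp only [eq_comm]
  rw [this, ← Set.image_univ, Set.ncard_image_of_injective _ (h.face_injective hF hn),
    Set.ncard_univ, Nat.card_zmod]

theorem IsLinkCycle.edge_shared (hF : ∀ f ∈ F, f.card = 3) (hn : 3 ≤ n) (h : IsLinkCycle F v w)
    {f : Finset V} (hf : f ∈ F) {u : V} (huv : u ≠ v) (hv : v ∈ f) (hu : u ∈ f) :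
    {g ∈ F | {v, u} ⊆ g}.ncard = 2 := by
  have hc := h.ne_center hF
  obtain ⟨i, hi⟩ : ∃ i, u = w i := by
    obtain ⟨i, rfl⟩ := (h.faces_iff f).1 ⟨hf, hv⟩
    simp only [Finset.mem_insert, Finset.mem_singleton, huv, false_or] at hu
    exact hu.elim (fun h => ⟨_, h⟩) fun h => ⟨_, h⟩
  subst hi
  rw [Set.ncard_eq_two]
  refine ⟨{v, w i, w (i + 1)}, {v, w (i - 1), w (i - 1 + 1)}, fun he => ?_, ?_⟩
  · have := h.face_injective hF hn he
    have h1 : ((1 : ℕ) : ZMod n) = 0 := by push_cast; linear_combination this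
    rw [ZMod.natCast_eq_zero_iff] at h1
    exact absurd (Nat.le_of_dvd (by norm_num) h1) (by omega)
  · ext g
    simp only [Set.mem_ofPred_eq, Set.mem_insert_iff, Set.mem_singleton_iff,
      Finset.insert_subset_iff, Finset.singleton_subset_iff]
    constructor
    · rintro ⟨hg, hvg, hug⟩
      obtain ⟨j, rfl⟩ := (h.faces_iff g).1 ⟨hg, hvg⟩
      simp only [Finset.mem_insert, Finset.mem_singleton, huv, false_or, h.injective.eq_iff] at hug
      rcases hug with rfl | rfl
      · exact Or.inl rfl
      · right; rw [add_sub_cancel_right]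
    · rintro (rfl | rfl)
      · exact ⟨h.mem i, by simp, by simp⟩
      · exact ⟨h.mem (i - 1), by simp, by simp⟩

/-- An S-manifold is determined by triangles with link cycles of length five, six or seven. -/
def SManifold.ofLinkCycles (F : Set (Finset V)) (hF : ∀ f ∈ F, f.card = 3) (n : V → ℕ)
    (hn : ∀ v, n v ∈ ({5, 6, 7} : Set ℕ)) (hw : ∀ v, ∃ w : ZMod (n v) → V, IsLinkCycle F v w) :
    SManifold V :=
  have h3 : ∀ v, 3 ≤ n v := fun v => by
    have := hn v
    simp only [Set.mem_insert_iff, Set.mem_singleton_iff] at this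
    omega
  have hcard : ∀ v, {f ∈ F | v ∈ f}.ncard = n v := fun v =>
    (hw v).elim fun _ h => h.ncard_eq hF (h3 v)
  { faces := F
    card_face := hF
    edge_shared := fun f hf e hef he => by
      obtain ⟨v, u, hvu, rfl⟩ := Finset.card_eq_two.1 he
      obtain ⟨w, h⟩ := hw v
      exact h.edge_shared hF (h3 v) hf hvu.symm (hef (by simp)) (hef (by simp))
    vertex_shared := fun v => by rw [hcard]; exact hn v
    link_cycle := fun v => by rw [hcard]; exact hw v }

end LinkCycle

/-! ### The triangulation of the model and its link cycles. -/

namespace SemiParadoxist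

/-- The unit squares with the other diagonal: the right half of the row of height zero. -/
def Turned (i j : ℤ) : Prop := j = 0 ∧ 0 ≤ i

/-- The triangles of the model: the unit squares of the plane are cut into two triangles each, by
the falling diagonal, except for the right half of one row, where the rising diagonal is used. -/
inductive Face : Finset (ℤ × ℤ) → Prop
  | lower (i j : ℤ) (h : ¬ Turned i j) : Face {(i, j), (i + 1, j), (i, j + 1)}
  | upper (i j : ℤ) (h : ¬ Turned i j) : Face {(i + 1, j), (i, j + 1), (i + 1, j + 1)}
  | right (i j : ℤ) (h : Turned i j) : Face {(i, j), (i + 1, j), (i + 1, j + 1)}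
  | left (i j : ℤ) (h : Turned i j) : Face {(i, j), (i, j + 1), (i + 1, j + 1)}

theorem Face.card {f : Finset (ℤ × ℤ)} (hf : Face f) : f.card = 3 := by
  rcases hf with ⟨i, j, -⟩ | ⟨i, j, -⟩ | ⟨i, j, -⟩ | ⟨i, j, -⟩ <;>
  · rw [Finset.card_eq_three]
    exact ⟨_, _, _, by simp, by simp, by simp, rfl⟩

/-- The neighbours of a vertex in the regular part. -/
def link6 : ZMod 6 → ℤ × ℤ := ![(1, 0), (0, 1), (-1, 1), (-1, 0), (0, -1), (1, -1)]

/-- The neighbours of a vertex below the turned squares. -/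
def link6b : ZMod 6 → ℤ × ℤ := ![(1, 0), (1, 1), (0, 1), (-1, 0), (0, -1), (1, -1)]

/-- The neighbours of a vertex above the turned squares. -/
def link6a : ZMod 6 → ℤ × ℤ := ![(1, 0), (0, 1), (-1, 1), (-1, 0), (-1, -1), (0, -1)]

/-- The neighbours of the hyperbolic vertex. -/
def link7 : ZMod 7 → ℤ × ℤ := ![(1, 0), (1, 1), (0, 1), (-1, 1), (-1, 0), (0, -1), (1, -1)]

/-- The neighbours of the elliptic vertex. -/
def link5 : ZMod 5 → ℤ × ℤ := ![(-1, 0), (0, -1), (1, 0), (0, 1), (-1, 1)]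

theorem link_of {n : ℕ} {a : ZMod n → ℤ × ℤ} (ha : Function.Injective a) {v : ℤ × ℤ}
    (h1 : ∀ i, Face {v, v + a i, v + a (i + 1)})
    (h2 : ∀ f, Face f → v ∈ f → ∃ i, f = {v, v + a i, v + a (i + 1)}) :
    IsLinkCycle {f | Face f} v fun i => v + a i :=
  ⟨fun _ _ h => ha (add_left_cancel h), fun f => ⟨fun h => h2 f h.1 h.2,
    fun ⟨i, hi⟩ => hi ▸ ⟨h1 i, by simp⟩⟩⟩

theorem Face.of_eq {f g : Finset (ℤ × ℤ)} (hf : Face f) (h : f = g) : Face g := h ▸ hf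

theorem link6_succ : ∀ i, link6 (i + 1) =
    ![(0, 1), (-1, 1), (-1, 0), (0, -1), (1, -1), (1, 0)] i := by
  intro i; fin_cases i <;> rfl

/-- The hypotheses say that none of the four squares around the vertex is turned. -/
theorem isLinkCycle_link6 {k l : ℤ} (h₀ : ¬ (l = 0 ∧ 0 ≤ k)) (h₁ : ¬ (l = 1 ∧ 0 ≤ k)) :
    IsLinkCycle {f | Face f} (k, l) fun i : ZMod 6 => (k, l) + link6 i := by
  refine link_of (by decide) (fun i => ?_) ?_
  · rw [link6_succ]
    change Fin 6 at i
    fin_cases i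
    · refine (Face.lower k l ?_).of_eq ?_
      on_goal 2 => ext ⟨p, q⟩
      all_goals simp [link6, Turned]
      all_goals try omega
    · refine (Face.upper (k - 1) l ?_).of_eq ?_
      on_goal 2 => ext ⟨p, q⟩
      all_goals simp [link6, Turned]
      all_goals try omega
    · refine (Face.lower (k - 1) l ?_).of_eq ?_
      on_goal 2 => ext ⟨p, q⟩
      all_goals simp [link6, Turned]
      all_goals try omega
    · refine (Face.upper (k - 1) (l - 1) ?_).of_eq ?_
      on_goal 2 => ext ⟨p, q⟩
      all_goals simp [link6, Turned]
      all_goals try omega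
    · refine (Face.lower k (l - 1) ?_).of_eq ?_
      on_goal 2 => ext ⟨p, q⟩
      all_goals simp [link6, Turned]
      all_goals try omega
    · refine (Face.upper k (l - 1) ?_).of_eq ?_
      on_goal 2 => ext ⟨p, q⟩
      all_goals simp [link6, Turned]
      all_goals try omega
  -- Twelve cases: four kinds of triangles, each with three corners at which the vertex may sit. The
  -- kinds excluded by the position of the vertex are contradictory.
  · rintro _ (⟨i, j, h⟩ | ⟨i, j, h⟩ | ⟨i, j, h⟩ | ⟨i, j, h⟩) hv
    all_goals
      simp only [link6_succ]
      unfold Turned at h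
      simp at hv
      rcases hv with hv | hv | hv
    · refine ⟨(0 : Fin 6), ?_⟩
      ext ⟨p, q⟩; simp [link6]; omega
    · refine ⟨(2 : Fin 6), ?_⟩
      ext ⟨p, q⟩; simp [link6]; omega
    · refine ⟨(4 : Fin 6), ?_⟩
      ext ⟨p, q⟩; simp [link6]; omega
    · refine ⟨(1 : Fin 6), ?_⟩
      ext ⟨p, q⟩; simp [link6]; omega
    · refine ⟨(5 : Fin 6), ?_⟩
      ext ⟨p, q⟩; simp [link6]; omega
    · refine ⟨(3 : Fin 6), ?_⟩
      ext ⟨p, q⟩; simp [link6]; omega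
    · omega
    · omega
    · omega
    · omega
    · omega
    · omega

theorem link6b_succ : ∀ i, link6b (i + 1) =
    ![(1, 1), (0, 1), (-1, 0), (0, -1), (1, -1), (1, 0)] i := by
  intro i; fin_cases i <;> rfl

theorem isLinkCycle_link6b {k l : ℤ} (h₀ : l = 0 ∧ 0 < k) :
    IsLinkCycle {f | Face f} (k, l) fun i : ZMod 6 => (k, l) + link6b i := by
  refine link_of (by decide) (fun i => ?_) ?_
  · rw [link6b_succ]
    change Fin 6 at i
    fin_cases i
    · refine (Face.right k l ?_).of_eq ?_
      on_goal 2 => ext ⟨p, q⟩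
      all_goals simp [link6b, Turned]
      all_goals try omega
    · refine (Face.left k l ?_).of_eq ?_
      on_goal 2 => ext ⟨p, q⟩
      all_goals simp [link6b, Turned]
      all_goals try omega
    · refine (Face.right (k - 1) l ?_).of_eq ?_
      on_goal 2 => ext ⟨p, q⟩
      all_goals simp [link6b, Turned]
      all_goals try omega
    · refine (Face.upper (k - 1) (l - 1) ?_).of_eq ?_
      on_goal 2 => ext ⟨p, q⟩
      all_goals simp [link6b, Turned]
      all_goals try omega
    · refine (Face.lower k (l - 1) ?_).of_eq ?_
      on_goal 2 => ext ⟨p, q⟩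
      all_goals simp [link6b, Turned]
      all_goals try omega
    · refine (Face.upper k (l - 1) ?_).of_eq ?_
      on_goal 2 => ext ⟨p, q⟩
      all_goals simp [link6b, Turned]
      all_goals try omega
  · rintro _ (⟨i, j, h⟩ | ⟨i, j, h⟩ | ⟨i, j, h⟩ | ⟨i, j, h⟩) hv
    all_goals
      simp only [link6b_succ]
      unfold Turned at h
      simp at hv
      rcases hv with hv | hv | hv
    · omega
    · omega
    · refine ⟨(4 : Fin 6), ?_⟩
      ext ⟨p, q⟩; simp [link6b]; omega
    · omega
    · refine ⟨(5 : Fin 6), ?_⟩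
      ext ⟨p, q⟩; simp [link6b]; omega
    · refine ⟨(3 : Fin 6), ?_⟩
      ext ⟨p, q⟩; simp [link6b]; omega
    · refine ⟨(0 : Fin 6), ?_⟩
      ext ⟨p, q⟩; simp [link6b]; omega
    · refine ⟨(2 : Fin 6), ?_⟩
      ext ⟨p, q⟩; simp [link6b]; omega
    · omega
    · refine ⟨(1 : Fin 6), ?_⟩
      ext ⟨p, q⟩; simp [link6b]; omega
    · omega
    · omega

theorem link6a_succ : ∀ i, link6a (i + 1) =
    ![(0, 1), (-1, 1), (-1, 0), (-1, -1), (0, -1), (1, 0)] i := by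
  intro i; fin_cases i <;> rfl

theorem isLinkCycle_link6a {k l : ℤ} (h₁ : l = 1 ∧ 0 < k) :
    IsLinkCycle {f | Face f} (k, l) fun i : ZMod 6 => (k, l) + link6a i := by
  refine link_of (by decide) (fun i => ?_) ?_
  · rw [link6a_succ]
    change Fin 6 at i
    fin_cases i
    · refine (Face.lower k l ?_).of_eq ?_
      on_goal 2 => ext ⟨p, q⟩
      all_goals simp [link6a, Turned]
      all_goals try omega
    · refine (Face.upper (k - 1) l ?_).of_eq ?_
      on_goal 2 => ext ⟨p, q⟩
      all_goals simp [link6a, Turned]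
      all_goals try omega
    · refine (Face.lower (k - 1) l ?_).of_eq ?_
      on_goal 2 => ext ⟨p, q⟩
      all_goals simp [link6a, Turned]
      all_goals try omega
    · refine (Face.left (k - 1) (l - 1) ?_).of_eq ?_
      on_goal 2 => ext ⟨p, q⟩
      all_goals simp [link6a, Turned]
      all_goals try omega
    · refine (Face.right (k - 1) (l - 1) ?_).of_eq ?_
      on_goal 2 => ext ⟨p, q⟩
      all_goals simp [link6a, Turned]
      all_goals try omega
    · refine (Face.left k (l - 1) ?_).of_eq ?_
      on_goal 2 => ext ⟨p, q⟩
      all_goals simp [link6a, Turned]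
      all_goals try omega
  · rintro _ (⟨i, j, h⟩ | ⟨i, j, h⟩ | ⟨i, j, h⟩ | ⟨i, j, h⟩) hv
    all_goals
      simp only [link6a_succ]
      unfold Turned at h
      simp at hv
      rcases hv with hv | hv | hv
    · refine ⟨(0 : Fin 6), ?_⟩
      ext ⟨p, q⟩; simp [link6a]; omega
    · refine ⟨(2 : Fin 6), ?_⟩
      ext ⟨p, q⟩; simp [link6a]; omega
    · omega
    · refine ⟨(1 : Fin 6), ?_⟩
      ext ⟨p, q⟩; simp [link6a]; omega
    · omega
    · omega
    · omega
    · omega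
    · refine ⟨(4 : Fin 6), ?_⟩
      ext ⟨p, q⟩; simp [link6a]; omega
    · omega
    · refine ⟨(5 : Fin 6), ?_⟩
      ext ⟨p, q⟩; simp [link6a]; omega
    · refine ⟨(3 : Fin 6), ?_⟩
      ext ⟨p, q⟩; simp [link6a]; omega

theorem link7_succ : ∀ i, link7 (i + 1) =
    ![(1, 1), (0, 1), (-1, 1), (-1, 0), (0, -1), (1, -1), (1, 0)] i := by
  intro i; fin_cases i <;> rfl

theorem isLinkCycle_link7 :
    IsLinkCycle {f | Face f} (0, 0) fun i : ZMod 7 => (0, 0) + link7 i := by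
  refine link_of (by decide) (fun i => ?_) ?_
  · rw [link7_succ]
    change Fin 7 at i
    fin_cases i
    · refine (Face.right 0 0 ?_).of_eq ?_
      on_goal 2 => ext ⟨p, q⟩
      all_goals simp [link7, Turned]
    · refine (Face.left 0 0 ?_).of_eq ?_
      on_goal 2 => ext ⟨p, q⟩
      all_goals simp [link7, Turned]
      all_goals try omega
    · refine (Face.upper (-1) 0 ?_).of_eq ?_
      on_goal 2 => ext ⟨p, q⟩
      all_goals simp [link7, Turned]
      all_goals try omega
    · refine (Face.lower (-1) 0 ?_).of_eq ?_
      on_goal 2 => ext ⟨p, q⟩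
      all_goals simp [link7, Turned]
      all_goals try omega
    · refine (Face.upper (-1) (-1) ?_).of_eq ?_
      on_goal 2 => ext ⟨p, q⟩
      all_goals simp [link7, Turned]
      all_goals try omega
    · refine (Face.lower 0 (-1) ?_).of_eq ?_
      on_goal 2 => ext ⟨p, q⟩
      all_goals simp [link7, Turned]
      all_goals try omega
    · refine (Face.upper 0 (-1) ?_).of_eq ?_
      on_goal 2 => ext ⟨p, q⟩
      all_goals simp [link7, Turned]
      all_goals try omega
  · rintro _ (⟨i, j, h⟩ | ⟨i, j, h⟩ | ⟨i, j, h⟩ | ⟨i, j, h⟩) hv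
    all_goals
      simp only [link7_succ]
      unfold Turned at h
      simp at hv
      rcases hv with hv | hv | hv
    · omega
    · refine ⟨(3 : Fin 7), ?_⟩
      ext ⟨p, q⟩; simp [link7]; omega
    · refine ⟨(5 : Fin 7), ?_⟩
      ext ⟨p, q⟩; simp [link7]; omega
    · refine ⟨(2 : Fin 7), ?_⟩
      ext ⟨p, q⟩; simp [link7]; omega
    · refine ⟨(6 : Fin 7), ?_⟩
      ext ⟨p, q⟩; simp [link7]; omega
    · refine ⟨(4 : Fin 7), ?_⟩
      ext ⟨p, q⟩; simp [link7]; omega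
    · refine ⟨(0 : Fin 7), ?_⟩
      ext ⟨p, q⟩; simp [link7]; omega
    · omega
    · omega
    · refine ⟨(1 : Fin 7), ?_⟩
      ext ⟨p, q⟩; simp [link7]; omega
    · omega
    · omega

theorem link5_succ : ∀ i, link5 (i + 1) =
    ![(0, -1), (1, 0), (0, 1), (-1, 1), (-1, 0)] i := by
  intro i; fin_cases i <;> rfl

theorem isLinkCycle_link5 :
    IsLinkCycle {f | Face f} (0, 1) fun i : ZMod 5 => (0, 1) + link5 i := by
  refine link_of (by decide) (fun i => ?_) ?_
  · rw [link5_succ]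
    change Fin 5 at i
    fin_cases i
    · refine (Face.upper (-1) 0 ?_).of_eq ?_
      on_goal 2 => ext ⟨p, q⟩
      all_goals simp [link5, Turned]
      all_goals try omega
    · refine (Face.left 0 0 ?_).of_eq ?_
      on_goal 2 => ext ⟨p, q⟩
      all_goals simp [link5, Turned]
      all_goals try omega
    · refine (Face.lower 0 1 ?_).of_eq ?_
      on_goal 2 => ext ⟨p, q⟩
      all_goals simp [link5, Turned]
    · refine (Face.upper (-1) 1 ?_).of_eq ?_
      on_goal 2 => ext ⟨p, q⟩
      all_goals simp [link5, Turned]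
      all_goals try omega
    · refine (Face.lower (-1) 1 ?_).of_eq ?_
      on_goal 2 => ext ⟨p, q⟩
      all_goals simp [link5, Turned]
      all_goals try omega
  · rintro _ (⟨i, j, h⟩ | ⟨i, j, h⟩ | ⟨i, j, h⟩ | ⟨i, j, h⟩) hv
    all_goals
      simp only [link5_succ]
      unfold Turned at h
      simp at hv
      rcases hv with hv | hv | hv
    · refine ⟨(2 : Fin 5), ?_⟩
      ext ⟨p, q⟩; simp [link5]; omega
    · refine ⟨(4 : Fin 5), ?_⟩
      ext ⟨p, q⟩; simp [link5]; omega
    · omega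
    · refine ⟨(3 : Fin 5), ?_⟩
      ext ⟨p, q⟩; simp [link5]; omega
    · omega
    · refine ⟨(0 : Fin 5), ?_⟩
      ext ⟨p, q⟩; simp [link5]; omega
    · omega
    · omega
    · omega
    · omega
    · refine ⟨(1 : Fin 5), ?_⟩
      ext ⟨p, q⟩; simp [link5]; omega
    · omega

/-- The number of triangles around a vertex of the model. -/
def linkNumber (v : ℤ × ℤ) : ℕ := if v = (0, 0) then 7 else if v = (0, 1) then 5 else 6

theorem exists_isLinkCycle (v : ℤ × ℤ) :
    ∃ w : ZMod (linkNumber v) → ℤ × ℤ, IsLinkCycle {f | Face f} v w := by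
  by_cases h7 : v = (0, 0)
  · subst h7; exact ⟨_, isLinkCycle_link7⟩
  by_cases h5 : v = (0, 1)
  · subst h5; exact ⟨_, isLinkCycle_link5⟩
  rw [linkNumber, if_neg h7, if_neg h5]
  obtain ⟨k, l⟩ := v
  simp only [Prod.mk.injEq] at h7 h5
  by_cases h0 : l = 0 ∧ 0 ≤ k
  · exact ⟨_, isLinkCycle_link6b (by omega)⟩
  by_cases h1 : l = 1 ∧ 0 ≤ k
  · exact ⟨_, isLinkCycle_link6a (by omega)⟩
  exact ⟨_, isLinkCycle_link6 h0 h1⟩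

/-- The plane with one hyperbolic vertex and one elliptic vertex, which are adjacent. -/
def model : SManifold (ℤ × ℤ) :=
  SManifold.ofLinkCycles {f | Face f} (fun _ hf => hf.card) linkNumber
    (fun v => by unfold linkNumber; split_ifs <;> simp) exists_isLinkCycle

theorem mem_faces {f : Finset (ℤ × ℤ)} : f ∈ model.faces ↔ Face f := Iff.rfl

theorem degree_eq (v : ℤ × ℤ) : model.degree v = linkNumber v := by
  obtain ⟨w, hw⟩ := exists_isLinkCycle v
  refine hw.ncard_eq (fun _ hf => Face.card hf) ?_
  unfold linkNumber; split_ifs <;> omega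

end SemiParadoxist

/-! ### Coordinates and hat functions: the model is a plane. -/

namespace SemiParadoxist

open SManifold

/-- The horizontal coordinate of a point of the model, in units of squares. -/
noncomputable def colCoord (x : ℤ × ℤ → ℝ) : ℝ := wsum (fun v => (v.1 : ℝ)) x

/-- The vertical coordinate of a point of the model, in units of squares. -/
noncomputable def rowCoord (x : ℤ × ℤ → ℝ) : ℝ := wsum (fun v => (v.2 : ℝ)) x

theorem exists_mem_disk {V : Type*} [DecidableEq V] {p q r : V} (hpq : p ≠ q) (hpr : p ≠ r)
    (hqr : q ≠ r) {α β γ : ℝ} (hα : 0 ≤ α) (hβ : 0 ≤ β) (hγ : 0 ≤ γ) (h : α + β + γ = 1) :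
    ∃ x ∈ disk {p, q, r}, x p = α ∧ x q = β ∧ x r = γ := by
  refine ⟨fun v => if v = p then α else if v = q then β else if v = r then γ else 0, ?_, ?_⟩
  · rw [mem_disk_triple hpq hpr hqr]
    simp only [hpq.symm, hpr.symm, hqr.symm, if_true, if_false]
    refine ⟨hα, hβ, hγ, fun v h1 h2 h3 => by simp [h1, h2, h3], h⟩
  · simp [hpq.symm, hpr.symm, hqr.symm]

section Triangles

variable {i j : ℤ} {x : ℤ × ℤ → ℝ}

/-- Inside one triangle the barycentric coordinates are affine functions of `colCoord` and
`rowCoord`; this reduces questions about the model to linear inequalities. -/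
theorem mem_lower : x ∈ disk {(i, j), (i + 1, j), (i, j + 1)} →
    (∀ v, v ≠ (i, j) → v ≠ (i + 1, j) → v ≠ (i, j + 1) → x v = 0) ∧
    x (i, j) = 1 - (colCoord x - i) - (rowCoord x - j) ∧ x (i + 1, j) = colCoord x - i ∧
    x (i, j + 1) = rowCoord x - j ∧
    0 ≤ x (i, j) ∧ 0 ≤ x (i + 1, j) ∧ 0 ≤ x (i, j + 1) := by
  intro hx
  have h1 : (i, j) ≠ (i + 1, j) := by simp
  have h2 : (i, j) ≠ (i, j + 1) := by simp
  have h3 : (i + 1, j) ≠ (i, j + 1) := by simp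
  rw [colCoord, rowCoord, wsum_triple _ h1 h2 h3 hx, wsum_triple _ h1 h2 h3 hx]
  obtain ⟨p, q, r, h0, h⟩ := (mem_disk_triple h1 h2 h3).1 hx
  simp only [smul_eq_mul]
  push_cast
  exact ⟨h0, by linear_combination (1 + i + j) * h, by linear_combination -i * h,
    by linear_combination -j * h, p, q, r⟩

theorem mem_upper : x ∈ disk {(i + 1, j), (i, j + 1), (i + 1, j + 1)} →
    (∀ v, v ≠ (i + 1, j) → v ≠ (i, j + 1) → v ≠ (i + 1, j + 1) → x v = 0) ∧
    x (i + 1, j) = 1 - (rowCoord x - j) ∧ x (i, j + 1) = 1 - (colCoord x - i) ∧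
    x (i + 1, j + 1) = (colCoord x - i) + (rowCoord x - j) - 1 ∧
    0 ≤ x (i + 1, j) ∧ 0 ≤ x (i, j + 1) ∧ 0 ≤ x (i + 1, j + 1) := by
  intro hx
  have h1 : (i + 1, j) ≠ (i, j + 1) := by simp
  have h2 : (i + 1, j) ≠ (i + 1, j + 1) := by simp
  have h3 : (i, j + 1) ≠ (i + 1, j + 1) := by simp
  rw [colCoord, rowCoord, wsum_triple _ h1 h2 h3 hx, wsum_triple _ h1 h2 h3 hx]
  obtain ⟨p, q, r, h0, h⟩ := (mem_disk_triple h1 h2 h3).1 hx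
  simp only [smul_eq_mul]
  push_cast
  exact ⟨h0, by linear_combination (j + 1) * h, by linear_combination (i + 1) * h,
    by linear_combination -(i + j + 1) * h, p, q, r⟩

theorem mem_right : x ∈ disk {(i, j), (i + 1, j), (i + 1, j + 1)} →
    (∀ v, v ≠ (i, j) → v ≠ (i + 1, j) → v ≠ (i + 1, j + 1) → x v = 0) ∧
    x (i, j) = 1 - (colCoord x - i) ∧ x (i + 1, j) = (colCoord x - i) - (rowCoord x - j) ∧
    x (i + 1, j + 1) = rowCoord x - j ∧
    0 ≤ x (i, j) ∧ 0 ≤ x (i + 1, j) ∧ 0 ≤ x (i + 1, j + 1) := by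
  intro hx
  have h1 : (i, j) ≠ (i + 1, j) := by simp
  have h2 : (i, j) ≠ (i + 1, j + 1) := by simp
  have h3 : (i + 1, j) ≠ (i + 1, j + 1) := by simp
  rw [colCoord, rowCoord, wsum_triple _ h1 h2 h3 hx, wsum_triple _ h1 h2 h3 hx]
  obtain ⟨p, q, r, h0, h⟩ := (mem_disk_triple h1 h2 h3).1 hx
  simp only [smul_eq_mul]
  push_cast
  exact ⟨h0, by linear_combination (1 + i) * h, by linear_combination (j - i) * h,
    by linear_combination -j * h, p, q, r⟩

theorem mem_left : x ∈ disk {(i, j), (i, j + 1), (i + 1, j + 1)} →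
    (∀ v, v ≠ (i, j) → v ≠ (i, j + 1) → v ≠ (i + 1, j + 1) → x v = 0) ∧
    x (i, j) = 1 - (rowCoord x - j) ∧ x (i, j + 1) = (rowCoord x - j) - (colCoord x - i) ∧
    x (i + 1, j + 1) = colCoord x - i ∧
    0 ≤ x (i, j) ∧ 0 ≤ x (i, j + 1) ∧ 0 ≤ x (i + 1, j + 1) := by
  intro hx
  have h1 : (i, j) ≠ (i, j + 1) := by simp
  have h2 : (i, j) ≠ (i + 1, j + 1) := by simp
  have h3 : (i, j + 1) ≠ (i + 1, j + 1) := by simp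
  rw [colCoord, rowCoord, wsum_triple _ h1 h2 h3 hx, wsum_triple _ h1 h2 h3 hx]
  obtain ⟨p, q, r, h0, h⟩ := (mem_disk_triple h1 h2 h3).1 hx
  simp only [smul_eq_mul]
  push_cast
  exact ⟨h0, by linear_combination (1 + j) * h, by linear_combination (i - j) * h,
    by linear_combination -i * h, p, q, r⟩

theorem exists_lower {a b : ℝ} (h1 : i ≤ a) (h2 : j ≤ b) (h3 : a - i + (b - j) ≤ 1) :
    ∃ x ∈ disk {(i, j), (i + 1, j), (i, j + 1)}, colCoord x = a ∧ rowCoord x = b := by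
  obtain ⟨x, hx, e1, e2, e3⟩ := exists_mem_disk (p := (i, j)) (q := (i + 1, j)) (r := (i, j + 1))
    (by simp) (by simp) (by simp) (α := 1 - (a - i) - (b - j)) (β := a - i) (γ := b - j)
    (by linarith) (by linarith) (by linarith) (by ring)
  obtain ⟨-, -, f2, f3, -⟩ := mem_lower hx
  exact ⟨x, hx, by linarith, by linarith⟩

theorem exists_upper {a b : ℝ} (h1 : a ≤ i + 1) (h2 : b ≤ j + 1) (h3 : 1 ≤ a - i + (b - j)) :
    ∃ x ∈ disk {(i + 1, j), (i, j + 1), (i + 1, j + 1)}, colCoord x = a ∧ rowCoord x = b := by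
  obtain ⟨x, hx, e1, e2, e3⟩ := exists_mem_disk (p := (i + 1, j)) (q := (i, j + 1))
    (r := (i + 1, j + 1)) (by simp) (by simp) (by simp)
    (α := 1 - (b - j)) (β := 1 - (a - i)) (γ := a - i + (b - j) - 1)
    (by linarith) (by linarith) (by linarith) (by ring)
  obtain ⟨-, f1, f2, f3, -⟩ := mem_upper hx
  exact ⟨x, hx, by linarith, by linarith⟩

theorem exists_right {a b : ℝ} (h1 : a ≤ i + 1) (h2 : j ≤ b) (h3 : b - j ≤ a - i) :
    ∃ x ∈ disk {(i, j), (i + 1, j), (i + 1, j + 1)}, colCoord x = a ∧ rowCoord x = b := by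
  obtain ⟨x, hx, e1, e2, e3⟩ := exists_mem_disk (p := (i, j)) (q := (i + 1, j))
    (r := (i + 1, j + 1)) (by simp) (by simp) (by simp)
    (α := 1 - (a - i)) (β := a - i - (b - j)) (γ := b - j)
    (by linarith) (by linarith) (by linarith) (by ring)
  obtain ⟨-, f1, f2, f3, -⟩ := mem_right hx
  exact ⟨x, hx, by linarith, by linarith⟩

theorem exists_left {a b : ℝ} (h1 : i ≤ a) (h2 : b ≤ j + 1) (h3 : a - i ≤ b - j) :
    ∃ x ∈ disk {(i, j), (i, j + 1), (i + 1, j + 1)}, colCoord x = a ∧ rowCoord x = b := by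
  obtain ⟨x, hx, e1, e2, e3⟩ := exists_mem_disk (p := (i, j)) (q := (i, j + 1))
    (r := (i + 1, j + 1)) (by simp) (by simp) (by simp)
    (α := 1 - (b - j)) (β := b - j - (a - i)) (γ := a - i)
    (by linarith) (by linarith) (by linarith) (by ring)
  obtain ⟨-, f1, f2, f3, -⟩ := mem_left hx
  exact ⟨x, hx, by linarith, by linarith⟩

end Triangles

section Hat

/-- In the upper half plane, one minus the hat function of a vertex. -/
noncomputable def gaugeAbove (v : ℤ × ℤ) (a b : ℝ) : ℝ :=
  -- Turned squares lie above these vertices: on both sides, except at column 0, where only the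
  -- right one is turned.
  if v.2 = 0 ∧ 0 ≤ v.1 then
    if v.1 = 0 then max a (max b (-a)) else max (b - a) (max b a)
  else max (a + b) (max b (-a))

/-- In the lower half plane, one minus the hat function of a vertex. -/
noncomputable def gaugeBelow (v : ℤ × ℤ) (a b : ℝ) : ℝ :=
  -- The same turned squares, seen from their upper corners.
  if v.2 = 1 ∧ 0 ≤ v.1 then
    if v.1 = 0 then max (-a - b) (a - b) else max (-a) (max (-b) (a - b))
  else max (-a - b) (max (-b) a)

/-- One minus the hat function of a vertex, at a given displacement from the vertex. -/
noncomputable def gauge (v : ℤ × ℤ) (a b : ℝ) : ℝ :=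
  if 0 ≤ b then gaugeAbove v a b else gaugeBelow v a b

/-- The hat function of a vertex: one at the vertex, zero at all other vertices, and affine in
every triangle. -/
noncomputable def hat (p : ℝ × ℝ) (v : ℤ × ℤ) : ℝ := max 0 (1 - gauge v (p.1 - v.1) (p.2 - v.2))

theorem gaugeAbove_zero (v : ℤ × ℤ) (a : ℝ) : gaugeAbove v a 0 = |a| := by
  unfold gaugeAbove
  split_ifs <;> rcases abs_cases a with ⟨h, h'⟩ | ⟨h, h'⟩ <;> rw [h] <;> simp only [max_def] <;>
    split_ifs <;> linarith

theorem gaugeBelow_zero (v : ℤ × ℤ) (a : ℝ) : gaugeBelow v a 0 = |a| := by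
  unfold gaugeBelow
  split_ifs <;> rcases abs_cases a with ⟨h, h'⟩ | ⟨h, h'⟩ <;> rw [h] <;> simp only [max_def] <;>
    split_ifs <;> linarith

/-- The formulas above and below agree on the horizontal line through the vertex, where both equal
`|a|`. -/
theorem continuous_hat : Continuous hat := by
  refine continuous_pi fun v => ?_
  have h1 : Continuous fun p : ℝ × ℝ => gaugeAbove v (p.1 - v.1) (p.2 - v.2) := by
    unfold gaugeAbove; split_ifs <;> fun_prop
  have h2 : Continuous fun p : ℝ × ℝ => gaugeBelow v (p.1 - v.1) (p.2 - v.2) := by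
    unfold gaugeBelow; split_ifs <;> fun_prop
  have h3 : Continuous fun p : ℝ × ℝ => gauge v (p.1 - v.1) (p.2 - v.2) := by
    unfold gauge
    refine Continuous.if_le h1 h2 continuous_const (by fun_prop) fun p hp => ?_
    rw [← hp, gaugeAbove_zero, gaugeBelow_zero]
  exact continuous_const.max (continuous_const.sub h3)

/-- The star of a vertex lies in the square of radius one around it; hence hats of distant vertices
vanish. -/
theorem abs_le_gauge (v : ℤ × ℤ) (a b : ℝ) : |a| ≤ gauge v a b ∧ |b| ≤ gauge v a b := by
  unfold gauge gaugeAbove gaugeBelow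
  constructor <;> rw [abs_le'] <;> split_ifs <;> constructor <;> simp only [le_max_iff] <;>
    by_contra! h <;> linarith

theorem hat_eq_zero {p : ℝ × ℝ} {v : ℤ × ℤ} (h : 1 ≤ gauge v (p.1 - v.1) (p.2 - v.2)) :
    hat p v = 0 := max_eq_left (by linarith)

theorem hat_eq {p : ℝ × ℝ} {v : ℤ × ℤ} {t : ℝ} (ht : 0 ≤ t)
    (h : gauge v (p.1 - v.1) (p.2 - v.2) = 1 - t) : hat p v = t := by
  rw [hat, h, sub_sub_cancel, max_eq_right ht]

/-- Away from the corners of its square, the hat functions vanish at a point. -/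
theorem hat_eq_zero_of_ne {p : ℝ × ℝ} {i j : ℤ} (h1 : i ≤ p.1) (h2 : p.1 ≤ i + 1) (h3 : j ≤ p.2)
    (h4 : p.2 ≤ j + 1) {v : ℤ × ℤ}
    (hv : v ≠ (i, j) ∧ v ≠ (i + 1, j) ∧ v ≠ (i, j + 1) ∧ v ≠ (i + 1, j + 1)) : hat p v = 0 := by
  obtain ⟨k, l⟩ := v
  simp only [ne_eq, Prod.mk.injEq] at hv
  apply hat_eq_zero
  obtain ⟨g1, g2⟩ := abs_le_gauge (k, l) (p.1 - k) (p.2 - l)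
  rw [abs_le'] at g1 g2
  dsimp only
  by_cases hk : k < i
  · have : (k : ℝ) + 1 ≤ i := by exact_mod_cast hk
    linarith [g1.1]
  by_cases hk' : i + 1 < k
  · have : (i : ℝ) + 1 + 1 ≤ k := by exact_mod_cast hk'
    linarith [g1.2]
  by_cases hl : l < j
  · have : (l : ℝ) + 1 ≤ j := by exact_mod_cast hl
    linarith [g2.1]
  by_cases hl' : j + 1 < l
  · have : (j : ℝ) + 1 + 1 ≤ l := by exact_mod_cast hl'
    linarith [g2.2]
  omega

theorem gauge_of_nonneg {v : ℤ × ℤ} {a b : ℝ} (hb : 0 ≤ b) : gauge v a b = gaugeAbove v a b :=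
  if_pos hb

theorem gauge_of_nonpos {v : ℤ × ℤ} {a b : ℝ} (hb : b ≤ 0) : gauge v a b = gaugeBelow v a b := by
  rcases hb.lt_or_eq with h | rfl
  · exact if_neg (not_le.2 h)
  · rw [gauge, if_pos le_rfl, gaugeAbove_zero, gaugeBelow_zero]

end Hat

end SemiParadoxist

namespace SemiParadoxist

open SManifold

theorem max_eq_of {a b t : ℝ} (ha : a ≤ t) (hb : b ≤ t) (h : a = t ∨ b = t) : max a b = t :=
  le_antisymm (max_le ha hb) (h.elim (fun h => h ▸ le_max_left _ _) fun h => h ▸ le_max_right _ _)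

theorem max_eq_of₃ {a b c t : ℝ} (ha : a ≤ t) (hb : b ≤ t) (hc : c ≤ t)
    (h : a = t ∨ b = t ∨ c = t) : max a (max b c) = t := by
  rcases h with h | h
  · exact max_eq_of ha (max_le hb hc) (Or.inl h)
  · exact max_eq_of ha (max_le hb hc) (Or.inr (max_eq_of hb hc h))

section HatOfMem

variable {i j : ℤ} {x : ℤ × ℤ → ℝ}

/-- At a corner of the triangle, the gauge is the affine form belonging to this triangle, and the
work is to see that this form is the maximum. At the fourth corner of the square the gauge is at
least one, and all other vertices are too far away. The next three lemmas have the same shape. -/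
theorem hat_of_mem_lower (h : ¬ Turned i j) (hx : x ∈ disk {(i, j), (i + 1, j), (i, j + 1)}) :
    hat (colCoord x, rowCoord x) = x := by
  obtain ⟨h0, e1, e2, e3, p1, p2, p3⟩ := mem_lower hx
  rw [e1] at p1; rw [e2] at p2; rw [e3] at p3
  unfold Turned at h
  funext v
  by_cases v1 : v = (i, j)
  · subst v1
    rw [e1]
    refine hat_eq p1 ?_
    rw [gauge_of_nonneg (by simpa using p3)]
    unfold gaugeAbove
    rw [if_neg h]
    refine max_eq_of₃ ?_ ?_ ?_ (Or.inl ?_) <;> dsimp only <;> linarith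
  by_cases v2 : v = (i + 1, j)
  · subst v2
    rw [e2]
    refine hat_eq p2 ?_
    rw [gauge_of_nonneg (by simpa using p3)]
    unfold gaugeAbove
    dsimp only
    push_cast
    split_ifs with c1 c2
    · refine max_eq_of₃ ?_ ?_ ?_ (Or.inr (Or.inr ?_)) <;> linarith
    · omega
    · refine max_eq_of₃ ?_ ?_ ?_ (Or.inr (Or.inr ?_)) <;> linarith
  by_cases v3 : v = (i, j + 1)
  · subst v3
    rw [e3]
    refine hat_eq p3 ?_
    rw [gauge_of_nonpos (by push_cast; linarith)]
    unfold gaugeBelow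
    dsimp only
    push_cast
    rw [if_neg (by omega)]
    refine max_eq_of₃ ?_ ?_ ?_ (Or.inr (Or.inl ?_)) <;> linarith
  rw [h0 v v1 v2 v3]
  by_cases v4 : v = (i + 1, j + 1)
  · subst v4
    refine hat_eq_zero ?_
    rw [gauge_of_nonpos (by push_cast; linarith)]
    unfold gaugeBelow
    dsimp only
    push_cast
    split_ifs with c1 c2
    · refine le_max_of_le_left ?_; linarith
    · omega
    · refine le_max_of_le_left ?_; linarith
  · exact hat_eq_zero_of_ne (by linarith) (by dsimp only; linarith) (by linarith)
      (by dsimp only; linarith) ⟨v1, v2, v3, v4⟩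

theorem hat_of_mem_upper (h : ¬ Turned i j)
    (hx : x ∈ disk {(i + 1, j), (i, j + 1), (i + 1, j + 1)}) :
    hat (colCoord x, rowCoord x) = x := by
  obtain ⟨h0, e1, e2, e3, p1, p2, p3⟩ := mem_upper hx
  rw [e1] at p1; rw [e2] at p2; rw [e3] at p3
  unfold Turned at h
  funext v
  by_cases v1 : v = (i + 1, j)
  · subst v1
    rw [e1]
    refine hat_eq p1 ?_
    rw [gauge_of_nonneg (by linarith)]
    unfold gaugeAbove
    dsimp only
    push_cast
    split_ifs with c1 c2
    · refine max_eq_of₃ ?_ ?_ ?_ (Or.inr (Or.inl ?_)) <;> linarith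
    · omega
    · refine max_eq_of₃ ?_ ?_ ?_ (Or.inr (Or.inl ?_)) <;> linarith
  by_cases v2 : v = (i, j + 1)
  · subst v2
    rw [e2]
    refine hat_eq p2 ?_
    rw [gauge_of_nonpos (by push_cast; linarith)]
    unfold gaugeBelow
    dsimp only
    push_cast
    rw [if_neg (by omega)]
    refine max_eq_of₃ ?_ ?_ ?_ (Or.inr (Or.inr ?_)) <;> linarith
  by_cases v3 : v = (i + 1, j + 1)
  · subst v3
    rw [e3]
    refine hat_eq p3 ?_
    rw [gauge_of_nonpos (by push_cast; linarith)]
    unfold gaugeBelow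
    dsimp only
    push_cast
    split_ifs with c1 c2
    · refine max_eq_of ?_ ?_ (Or.inl ?_) <;> linarith
    · omega
    · refine max_eq_of₃ ?_ ?_ ?_ (Or.inl ?_) <;> linarith
  rw [h0 v v1 v2 v3]
  by_cases v4 : v = (i, j)
  · subst v4
    refine hat_eq_zero ?_
    rw [gauge_of_nonneg (by linarith)]
    unfold gaugeAbove
    rw [if_neg h]
    refine le_max_of_le_left ?_
    dsimp only; linarith
  · exact hat_eq_zero_of_ne (by dsimp only; linarith) (by dsimp only; linarith)
      (by dsimp only; linarith) (by dsimp only; linarith) ⟨v4, v1, v2, v3⟩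

theorem hat_of_mem_right (h : Turned i j)
    (hx : x ∈ disk {(i, j), (i + 1, j), (i + 1, j + 1)}) :
    hat (colCoord x, rowCoord x) = x := by
  obtain ⟨h0, e1, e2, e3, p1, p2, p3⟩ := mem_right hx
  rw [e1] at p1; rw [e2] at p2; rw [e3] at p3
  unfold Turned at h
  funext v
  by_cases v1 : v = (i, j)
  · subst v1
    rw [e1]
    refine hat_eq p1 ?_
    rw [gauge_of_nonneg (by linarith)]
    unfold gaugeAbove
    rw [if_pos h]
    dsimp only
    split_ifs with c1
    · refine max_eq_of₃ ?_ ?_ ?_ (Or.inl ?_) <;> linarith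
    · refine max_eq_of₃ ?_ ?_ ?_ (Or.inr (Or.inr ?_)) <;> linarith
  by_cases v2 : v = (i + 1, j)
  · subst v2
    rw [e2]
    refine hat_eq p2 ?_
    rw [gauge_of_nonneg (by linarith)]
    unfold gaugeAbove
    dsimp only
    push_cast
    rw [if_pos (by omega), if_neg (by omega)]
    refine max_eq_of₃ ?_ ?_ ?_ (Or.inl ?_) <;> linarith
  by_cases v3 : v = (i + 1, j + 1)
  · subst v3
    rw [e3]
    refine hat_eq p3 ?_
    rw [gauge_of_nonpos (by push_cast; linarith)]
    unfold gaugeBelow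
    dsimp only
    push_cast
    rw [if_pos (by omega), if_neg (by omega)]
    refine max_eq_of₃ ?_ ?_ ?_ (Or.inr (Or.inl ?_)) <;> linarith
  rw [h0 v v1 v2 v3]
  by_cases v4 : v = (i, j + 1)
  · subst v4
    refine hat_eq_zero ?_
    rw [gauge_of_nonpos (by push_cast; linarith)]
    unfold gaugeBelow
    dsimp only
    push_cast
    rw [if_pos (by omega)]
    split_ifs with c1
    · refine le_max_of_le_right ?_; linarith
    · refine le_max_of_le_right (le_max_of_le_right ?_); linarith
  · exact hat_eq_zero_of_ne (by dsimp only; linarith) (by dsimp only; linarith)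
      (by dsimp only; linarith) (by dsimp only; linarith) ⟨v1, v2, v4, v3⟩

theorem hat_of_mem_left (h : Turned i j)
    (hx : x ∈ disk {(i, j), (i, j + 1), (i + 1, j + 1)}) :
    hat (colCoord x, rowCoord x) = x := by
  obtain ⟨h0, e1, e2, e3, p1, p2, p3⟩ := mem_left hx
  rw [e1] at p1; rw [e2] at p2; rw [e3] at p3
  unfold Turned at h
  funext v
  by_cases v1 : v = (i, j)
  · subst v1
    rw [e1]
    refine hat_eq p1 ?_
    rw [gauge_of_nonneg (by linarith)]
    unfold gaugeAbove
    rw [if_pos h]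
    dsimp only
    split_ifs with c1
    · refine max_eq_of₃ ?_ ?_ ?_ (Or.inr (Or.inl ?_)) <;> linarith
    · refine max_eq_of₃ ?_ ?_ ?_ (Or.inr (Or.inl ?_)) <;> linarith
  by_cases v2 : v = (i, j + 1)
  · subst v2
    rw [e2]
    refine hat_eq p2 ?_
    rw [gauge_of_nonpos (by push_cast; linarith)]
    unfold gaugeBelow
    dsimp only
    push_cast
    rw [if_pos (by omega)]
    split_ifs with c1
    · refine max_eq_of ?_ ?_ (Or.inr ?_) <;> linarith
    · refine max_eq_of₃ ?_ ?_ ?_ (Or.inr (Or.inr ?_)) <;> linarith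
  by_cases v3 : v = (i + 1, j + 1)
  · subst v3
    rw [e3]
    refine hat_eq p3 ?_
    rw [gauge_of_nonpos (by push_cast; linarith)]
    unfold gaugeBelow
    dsimp only
    push_cast
    rw [if_pos (by omega), if_neg (by omega)]
    refine max_eq_of₃ ?_ ?_ ?_ (Or.inl ?_) <;> linarith
  rw [h0 v v1 v2 v3]
  by_cases v4 : v = (i + 1, j)
  · subst v4
    refine hat_eq_zero ?_
    rw [gauge_of_nonneg (by linarith)]
    unfold gaugeAbove
    dsimp only
    push_cast
    rw [if_pos (by omega), if_neg (by omega)]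
    refine le_max_of_le_left ?_; linarith
  · exact hat_eq_zero_of_ne (by dsimp only; linarith) (by dsimp only; linarith)
      (by dsimp only; linarith) (by dsimp only; linarith) ⟨v1, v4, v2, v3⟩

end HatOfMem

/-- A point of the model is determined by its coordinates. -/
theorem hat_of_mem_points {x : ℤ × ℤ → ℝ} (hx : x ∈ model.points) :
    hat (colCoord x, rowCoord x) = x := by
  obtain ⟨f, hf, hx⟩ := hx
  rcases mem_faces.1 hf with ⟨i, j, h⟩ | ⟨i, j, h⟩ | ⟨i, j, h⟩ | ⟨i, j, h⟩
  exacts [hat_of_mem_lower h hx, hat_of_mem_upper h hx, hat_of_mem_right h hx,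
    hat_of_mem_left h hx]

theorem eq_of_coords {x y : ℤ × ℤ → ℝ} (hx : x ∈ model.points) (hy : y ∈ model.points)
    (h1 : colCoord x = colCoord y) (h2 : rowCoord x = rowCoord y) : x = y := by
  rw [← hat_of_mem_points hx, ← hat_of_mem_points hy, h1, h2]

theorem exists_point (a b : ℝ) : ∃ x ∈ model.points, colCoord x = a ∧ rowCoord x = b := by
  have h1 := Int.floor_le a
  have h2 := (Int.lt_floor_add_one a).le
  have h3 := Int.floor_le b
  have h4 := (Int.lt_floor_add_one b).le
  by_cases hT : Turned ⌊a⌋ ⌊b⌋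
  · rcases le_total (b - ⌊b⌋) (a - ⌊a⌋) with h | h
    · obtain ⟨x, hx, e⟩ := exists_right h2 h3 h
      exact ⟨x, ⟨_, Face.right _ _ hT, hx⟩, e⟩
    · obtain ⟨x, hx, e⟩ := exists_left h1 h4 h
      exact ⟨x, ⟨_, Face.left _ _ hT, hx⟩, e⟩
  · rcases le_total (a - ⌊a⌋ + (b - ⌊b⌋)) 1 with h | h
    · obtain ⟨x, hx, e⟩ := exists_lower h1 h3 h
      exact ⟨x, ⟨_, Face.lower _ _ hT, hx⟩, e⟩
    · obtain ⟨x, hx, e⟩ := exists_upper h2 h4 h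
      exact ⟨x, ⟨_, Face.upper _ _ hT, hx⟩, e⟩

/-- Some point with the given coordinates exists, and `hat` recovers it from them. -/
theorem hat_spec (p : ℝ × ℝ) :
    hat p ∈ model.points ∧ colCoord (hat p) = p.1 ∧ rowCoord (hat p) = p.2 := by
  obtain ⟨x, hx, h1, h2⟩ := exists_point p.1 p.2
  have : hat p = x := by rw [← hat_of_mem_points hx, h1, h2]
  rw [this]
  exact ⟨hx, h1, h2⟩

/-- Weighted sums depend continuously on the point. -/
theorem continuous_wsum (g : ℤ × ℤ → ℝ) : Continuous fun x : model.points => wsum g x := by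
  rw [continuous_iff_continuousAt]
  rintro ⟨x, f, hf, hx⟩
  obtain ⟨v, hv, hxv⟩ : ∃ v ∈ f, 0 < x v := by
    by_contra! hcon
    have : ∑ v ∈ f, x v = 0 := Finset.sum_eq_zero fun v hv => le_antisymm (hcon v hv) (hx.1 v)
    rw [hx.2.2] at this
    exact one_ne_zero this
  -- Some coordinate `x v` is positive and stays so nearby. All triangles at `v` lie in the box of
  -- radius one around `v`, so near `x` the weighted sum runs over a fixed finite set.
  have hc : Continuous fun y : model.points => ∑ w ∈ Finset.Icc (v - 1) (v + 1), y.1 w • g w :=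
    continuous_finsetSum _ fun w _ =>
      ((continuous_apply w).comp continuous_subtype_val).smul continuous_const
  refine hc.continuousAt.congr ?_
  have hpos : ∀ᶠ y : model.points in nhds ⟨x, f, hf, hx⟩, 0 < y.1 v := by
    have : Continuous fun y : model.points => y.1 v :=
      (continuous_apply v).comp continuous_subtype_val
    exact this.continuousAt.eventually (lt_mem_nhds hxv)
  filter_upwards [hpos] with y hy
  symm
  apply finsum_eq_sum_of_support_subset
  intro w hw
  obtain ⟨y, k, hk, hyk⟩ := y
  have hwk : w ∈ k := by
    by_contra h
    exact hw (by simp [hyk.2.1 w h])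
  have hvk : v ∈ k := by
    by_contra h
    exact hy.ne' (hyk.2.1 v h)
  rw [Finset.coe_Icc, Set.mem_Icc, Prod.le_def, Prod.le_def]
  simp only [Prod.fst_sub, Prod.fst_add, Prod.snd_sub, Prod.snd_add, Prod.fst_one, Prod.snd_one]
  rcases mem_faces.1 hk with ⟨i, j, h⟩ | ⟨i, j, h⟩ | ⟨i, j, h⟩ | ⟨i, j, h⟩
  all_goals
    simp only [Finset.mem_insert, Finset.mem_singleton] at hwk hvk
    rcases hwk with rfl | rfl | rfl <;> rcases hvk with rfl | rfl | rfl <;> dsimp only <;> omega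

/-- The model is homeomorphic to the plane. -/
noncomputable def planeHomeo : model.points ≃ₜ EuclideanSpace ℝ (Fin 2) where
  toFun x := !₂[colCoord x.1, rowCoord x.1]
  invFun p := ⟨hat (p 0, p 1), (hat_spec _).1⟩
  left_inv x := Subtype.ext (hat_of_mem_points x.2)
  right_inv p := by
    ext i
    fin_cases i
    · exact (hat_spec _).2.1
    · exact (hat_spec _).2.2
  continuous_toFun := by
    have h1 : Continuous fun x : model.points => colCoord x.1 := continuous_wsum _
    have h2 : Continuous fun x : model.points => rowCoord x.1 := continuous_wsum _
    fun_prop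
  continuous_invFun := by
    refine Continuous.subtype_mk (continuous_hat.comp ?_) _
    fun_prop

theorem isModel : model.IsModel (0, 0) (0, 1) where
  plane := ⟨planeHomeo⟩
  hyperbolic := by rw [IsHyperbolicVertex, degree_eq]; rfl
  elliptic := by rw [IsEllipticVertex, degree_eq]; rfl
  adjacent := ⟨by decide, _, Face.left 0 0 ⟨rfl, le_rfl⟩, by simp, by simp⟩
  euclidean v h0 h1 := by rw [IsEuclideanVertex, degree_eq, linkNumber, if_neg h0, if_neg h1]

end SemiParadoxist

/-! ### The flat charts on the left, on the right and at the special edge. -/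

namespace SemiParadoxist

open SManifold Complex

/-- The part of the unit height at most `b`. -/
noncomputable def clamp (b : ℝ) : ℝ := max 0 (min 1 b)

theorem clamp_of_nonpos {b : ℝ} (h : b ≤ 0) : clamp b = 0 :=
  max_eq_left ((min_le_right _ _).trans h)

theorem clamp_of_one_le {b : ℝ} (h : 1 ≤ b) : clamp b = 1 := by
  rw [clamp, min_eq_left h, max_eq_right zero_le_one]

theorem clamp_of_mem {b : ℝ} (h0 : 0 ≤ b) (h1 : b ≤ 1) : clamp b = b := by
  rw [clamp, min_eq_right h1, max_eq_right h0]

theorem clamp_nonneg (b : ℝ) : 0 ≤ clamp b := le_max_left _ _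

/-- The horizontal coordinate of a point of the model, as seen from the right of the two special
vertices. -/
noncomputable def shearCoord (x : ℤ × ℤ → ℝ) : ℝ := colCoord x - clamp (rowCoord x)

/-- The planar position of a vertex of the triangular lattice. -/
noncomputable def pos₀ (v : ℤ × ℤ) : ℂ := v.1 + v.2 * ζ

/-- The lattice position of a vertex of the model, as seen from the right. -/
def unshear (v : ℤ × ℤ) : ℤ × ℤ := (if 1 ≤ v.2 then v.1 - 1 else v.1, v.2)

/-- The planar position of a vertex of the model, as seen from the right. -/
noncomputable def pos₁ (v : ℤ × ℤ) : ℂ := pos₀ (unshear v)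

theorem pos₀_injective : Function.Injective pos₀ := by
  intro v w h
  unfold pos₀ at h
  have := lattice_ext (a := v.1) (b := v.2) (c := w.1) (d := w.2) (by exact_mod_cast h)
  exact Prod.ext (by exact_mod_cast this.1) (by exact_mod_cast this.2)

theorem unshear_injective : Function.Injective unshear := by
  rintro ⟨a, b⟩ ⟨c, d⟩ h
  simp only [unshear, Prod.mk.injEq] at h ⊢
  obtain ⟨h1, rfl⟩ := h
  split_ifs at h1 <;> omega

/-- Adjacency of vertices in the triangular lattice. -/
def LatticeAdj (v w : ℤ × ℤ) : Prop :=
  (v.1 = w.1 + 1 ∧ v.2 = w.2) ∨ (v.1 = w.1 - 1 ∧ v.2 = w.2) ∨ (v.1 = w.1 ∧ v.2 = w.2 + 1) ∨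
    (v.1 = w.1 ∧ v.2 = w.2 - 1) ∨ (v.1 = w.1 + 1 ∧ v.2 = w.2 - 1) ∨
    (v.1 = w.1 - 1 ∧ v.2 = w.2 + 1)

theorem LatticeAdj.norm_sub {v w : ℤ × ℤ} (h : LatticeAdj v w) : ‖pos₀ v - pos₀ w‖ = 1 := by
  have key : pos₀ v - pos₀ w = ((v.1 - w.1 : ℤ) : ℝ) + ((v.2 - w.2 : ℤ) : ℝ) * ζ := by
    simp only [pos₀]; push_cast; ring
  rw [key]
  apply norm_lattice_eq_one
  rcases h with h | h | h | h | h | h <;> rw [h.1, h.2] <;> push_cast <;> ring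

theorem wsum_pos₀ {x : ℤ × ℤ → ℝ} (hx : x ∈ model.points) :
    wsum pos₀ x = colCoord x + rowCoord x * ζ := by
  obtain ⟨f, hf, hx⟩ := hx
  rw [colCoord, rowCoord, wsum_of_mem_disk _ hx, wsum_of_mem_disk _ hx, wsum_of_mem_disk _ hx]
  push_cast
  rw [Finset.sum_mul, ← Finset.sum_add_distrib]
  refine Finset.sum_congr rfl fun v _ => ?_
  simp only [pos₀, real_smul, smul_eq_mul]
  push_cast
  ring

theorem pos₁_eq (v : ℤ × ℤ) : pos₁ v = pos₀ v - (if 1 ≤ v.2 then 1 else 0) := by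
  simp only [pos₁, unshear, pos₀]
  split_ifs
  · push_cast; ring
  · ring

/-- Each triangle lies between two consecutive rows, so the total weight of its vertices in the rows
from 1 upwards is `clamp (rowCoord x)`. This is the shift between `pos₀` and `pos₁`. -/
theorem wsum_pos₁ {x : ℤ × ℤ → ℝ} (hx : x ∈ model.points) :
    wsum pos₁ x = shearCoord x + rowCoord x * ζ := by
  have h0 := wsum_pos₀ hx
  obtain ⟨f, hf, hx⟩ := hx
  have key : ∑ v ∈ f, x v * (if 1 ≤ v.2 then (1 : ℝ) else 0) = clamp (rowCoord x) := by
    rcases mem_faces.1 hf with ⟨i, j, h⟩ | ⟨i, j, h⟩ | ⟨i, j, h⟩ | ⟨i, j, h⟩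
    · rw [Finset.sum_insert (by simp), Finset.sum_insert (by simp), Finset.sum_singleton]
      obtain ⟨-, e1, e2, e3, p1, p2, p3⟩ := mem_lower hx
      dsimp only
      rcases lt_trichotomy j 0 with hj | rfl | hj
      · have : (j : ℝ) + 1 ≤ 0 := by exact_mod_cast hj
        rw [if_neg (by omega), if_neg (by omega), clamp_of_nonpos (by linarith)]; ring
      · rw [clamp_of_mem (by push_cast at *; linarith) (by push_cast at *; linarith), e3]; simp
      · have : (1 : ℝ) ≤ j := by exact_mod_cast hj
        rw [if_pos (by omega), if_pos (by omega), clamp_of_one_le (by linarith)]; linarith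
    · rw [Finset.sum_insert (by simp), Finset.sum_insert (by simp), Finset.sum_singleton]
      obtain ⟨-, e1, e2, e3, p1, p2, p3⟩ := mem_upper hx
      dsimp only
      rcases lt_trichotomy j 0 with hj | rfl | hj
      · have : (j : ℝ) + 1 ≤ 0 := by exact_mod_cast hj
        rw [if_neg (by omega), if_neg (by omega), clamp_of_nonpos (by linarith)]; ring
      · rw [clamp_of_mem (by push_cast at *; linarith) (by push_cast at *; linarith), e3, e2]; simp
      · have : (1 : ℝ) ≤ j := by exact_mod_cast hj
        rw [if_pos (by omega), if_pos (by omega), clamp_of_one_le (by linarith)]; linarith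
    · rw [Finset.sum_insert (by simp), Finset.sum_insert (by simp), Finset.sum_singleton]
      obtain ⟨-, e1, e2, e3, p1, p2, p3⟩ := mem_right hx
      obtain ⟨rfl, h⟩ := h
      rw [clamp_of_mem (by push_cast at *; linarith) (by push_cast at *; linarith), e3]; simp
    · rw [Finset.sum_insert (by simp), Finset.sum_insert (by simp), Finset.sum_singleton]
      obtain ⟨-, e1, e2, e3, p1, p2, p3⟩ := mem_left hx
      obtain ⟨rfl, h⟩ := h
      rw [clamp_of_mem (by push_cast at *; linarith) (by push_cast at *; linarith), e3, e2]; simp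
  have : wsum pos₁ x = wsum pos₀ x - clamp (rowCoord x) := by
    rw [wsum_of_mem_disk _ hx, wsum_of_mem_disk _ hx, ← key]
    push_cast
    rw [← Finset.sum_sub_distrib]
    refine Finset.sum_congr rfl fun v _ => ?_
    rw [pos₁_eq, real_smul, real_smul]
    split_ifs <;> push_cast <;> ring
  rw [this, h0, shearCoord]
  push_cast; ring

/-- The triangles of the chart seen from the left. -/
def chart₀ : Set (Finset (ℤ × ℤ)) := {f | ∃ i j, ¬ Turned i j ∧
  (f = {(i, j), (i + 1, j), (i, j + 1)} ∨ f = {(i + 1, j), (i, j + 1), (i + 1, j + 1)})}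

/-- The triangles of the chart seen from the right. -/
def chart₁ : Set (Finset (ℤ × ℤ)) := {f | Face f ∧ ∃ i j, ¬ (j = 0 ∧ i < 0) ∧
  ((¬ Turned i j ∧
    (f = {(i, j), (i + 1, j), (i, j + 1)} ∨ f = {(i + 1, j), (i, j + 1), (i + 1, j + 1)})) ∨
  (Turned i j ∧
    (f = {(i, j), (i + 1, j), (i + 1, j + 1)} ∨ f = {(i, j), (i, j + 1), (i + 1, j + 1)})))}

/-- The two triangles at the edge between the two special vertices. -/
def chart₂ : Set (Finset (ℤ × ℤ)) := {f | f = {(0, 0), (-1, 1), (0, 1)} ∨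
  f = {(0, 0), (0, 1), (1, 1)}}

/-- The lattice positions of the two triangles at the edge between the two special vertices. -/
def fold (v : ℤ × ℤ) : ℤ × ℤ := if v = (1, 1) then (1, 0) else v

/-- The planar positions of the two triangles at the edge between the two special vertices. -/
noncomputable def pos₂ (v : ℤ × ℤ) : ℂ := pos₀ (fold v)

theorem isChart₀ : model.IsChart chart₀ pos₀ where
  dist_eq_one := by
    rintro f ⟨i, j, -, rfl | rfl⟩ v hv w hw hvw <;>
    · simp only [Finset.mem_insert, Finset.mem_singleton] at hv hw
      apply LatticeAdj.norm_sub
      unfold LatticeAdj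
      rcases hv with rfl | rfl | rfl <;> rcases hw with rfl | rfl | rfl <;>
        first | exact absurd rfl hvw | (dsimp only; omega)
  inj _ _ _ _ _ _ _ _ h := pos₀_injective h

theorem isChart₁ : model.IsChart chart₁ pos₁ where
  dist_eq_one := by
    rintro f ⟨-, i, j, h, ⟨hT, rfl | rfl⟩ | ⟨hT, rfl | rfl⟩⟩ v hv w hw hvw <;>
    · simp only [Finset.mem_insert, Finset.mem_singleton] at hv hw
      apply LatticeAdj.norm_sub
      unfold LatticeAdj unshear
      unfold Turned at hT
      rcases hv with rfl | rfl | rfl <;> rcases hw with rfl | rfl | rfl <;>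
        first | exact absurd rfl hvw | (dsimp only; split_ifs <;> omega)
  inj _ _ _ _ _ _ _ _ h := unshear_injective (pos₀_injective h)

theorem isChart₂ : model.IsChart chart₂ pos₂ where
  dist_eq_one := by
    rintro f (rfl | rfl) v hv w hw hvw <;>
    · simp only [Finset.mem_insert, Finset.mem_singleton] at hv hw
      apply LatticeAdj.norm_sub
      unfold LatticeAdj fold
      rcases hv with rfl | rfl | rfl <;> rcases hw with rfl | rfl | rfl <;>
        first | exact absurd rfl hvw | simp
  inj := by
    rintro f (rfl | rfl) g (rfl | rfl) v hv w hw hvw <;>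
    · simp only [Finset.mem_insert, Finset.mem_singleton] at hv hw
      have := pos₀_injective hvw
      revert this
      rcases hv with rfl | rfl | rfl <;> rcases hw with rfl | rfl | rfl <;> simp [fold]

/-- The region covered by the chart seen from the left. -/
def region₀ : Set (ℝ × ℝ) := {p | p.1 < 0 ∨ p.2 < 0 ∨ 1 < p.2}

/-- The region covered by the chart seen from the right. -/
def region₁ : Set (ℝ × ℝ) := {p | 0 < p.1 + p.2 ∨ p.2 < 0 ∨ 1 < p.2}

theorem mem_chart₀ {x : ℤ × ℤ → ℝ} (h : (colCoord x, rowCoord x) ∈ region₀) {f : Finset (ℤ × ℤ)}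
    (hf : f ∈ model.faces) (hx : x ∈ disk f) : f ∈ chart₀ := by
  unfold region₀ at h
  simp only [Set.mem_ofPred_eq] at h
  rcases mem_faces.1 hf with ⟨i, j, hT⟩ | ⟨i, j, hT⟩ | ⟨i, j, hT⟩ | ⟨i, j, hT⟩
  · exact ⟨i, j, hT, Or.inl rfl⟩
  · exact ⟨i, j, hT, Or.inr rfl⟩
  · exfalso
    obtain ⟨-, e1, e2, e3, p1, p2, p3⟩ := mem_right hx
    obtain ⟨rfl, hi⟩ := hT
    have : (0 : ℝ) ≤ i := by exact_mod_cast hi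
    push_cast at *
    rcases h with h | h | h <;> linarith
  · exfalso
    obtain ⟨-, e1, e2, e3, p1, p2, p3⟩ := mem_left hx
    obtain ⟨rfl, hi⟩ := hT
    have : (0 : ℝ) ≤ i := by exact_mod_cast hi
    push_cast at *
    rcases h with h | h | h <;> linarith

theorem mem_chart₁ {x : ℤ × ℤ → ℝ} (h : (shearCoord x, rowCoord x) ∈ region₁)
    {f : Finset (ℤ × ℤ)} (hf : f ∈ model.faces) (hx : x ∈ disk f) : f ∈ chart₁ := by
  have h' : 0 < colCoord x ∨ rowCoord x < 0 ∨ 1 < rowCoord x := by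
    by_contra! hc
    unfold region₁ shearCoord at h
    rw [clamp_of_mem hc.2.1 hc.2.2] at h
    simp only [Set.mem_ofPred_eq, sub_add_cancel] at h
    rcases h with h | h | h <;> linarith
  have hf' := mem_faces.1 hf
  rcases hf' with ⟨i, j, hT⟩ | ⟨i, j, hT⟩ | ⟨i, j, hT⟩ | ⟨i, j, hT⟩
  · refine ⟨mem_faces.1 hf, i, j, ?_, Or.inl ⟨hT, Or.inl rfl⟩⟩
    rintro ⟨rfl, hi⟩
    obtain ⟨-, e1, e2, e3, p1, p2, p3⟩ := mem_lower hx
    have : (i : ℝ) + 1 ≤ 0 := by exact_mod_cast hi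
    push_cast at *
    rcases h' with h | h | h <;> linarith
  · refine ⟨mem_faces.1 hf, i, j, ?_, Or.inl ⟨hT, Or.inr rfl⟩⟩
    rintro ⟨rfl, hi⟩
    obtain ⟨-, e1, e2, e3, p1, p2, p3⟩ := mem_upper hx
    have : (i : ℝ) + 1 ≤ 0 := by exact_mod_cast hi
    push_cast at *
    rcases h' with h | h | h <;> linarith
  · exact ⟨mem_faces.1 hf, i, j, by unfold Turned at hT; omega, Or.inr ⟨hT, Or.inl rfl⟩⟩
  · exact ⟨mem_faces.1 hf, i, j, by unfold Turned at hT; omega, Or.inr ⟨hT, Or.inr rfl⟩⟩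

theorem mem_chart₂ {x : ℤ × ℤ → ℝ} (h : colCoord x = 0) (h0 : 0 < rowCoord x)
    (h1 : rowCoord x < 1) {f : Finset (ℤ × ℤ)} (hf : f ∈ model.faces) (hx : x ∈ disk f) :
    f ∈ chart₂ := by
  have key : ∀ i j : ℤ, (i : ℝ) ≤ 0 → (0 : ℝ) ≤ i + 1 → (j : ℝ) ≤ rowCoord x →
      rowCoord x ≤ j + 1 → j = 0 ∧ (i = 0 ∨ i = -1) := by
    intro i j a1 a2 a3 a4
    have b1 : i ≤ 0 := by exact_mod_cast a1
    have b2 : 0 ≤ i + 1 := by exact_mod_cast a2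
    have b3 : j < 1 := by exact_mod_cast a3.trans_lt h1
    have b4 : 0 < j + 1 := by exact_mod_cast h0.trans_le a4
    omega
  rcases mem_faces.1 hf with ⟨i, j, hT⟩ | ⟨i, j, hT⟩ | ⟨i, j, hT⟩ | ⟨i, j, hT⟩
  · exfalso
    obtain ⟨-, e1, e2, e3, p1, p2, p3⟩ := mem_lower hx
    obtain ⟨rfl, rfl | rfl⟩ := key i j (by linarith) (by linarith) (by linarith) (by linarith)
    · exact hT ⟨rfl, le_rfl⟩
    · push_cast at *; linarith
  · obtain ⟨-, e1, e2, e3, p1, p2, p3⟩ := mem_upper hx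
    obtain ⟨rfl, rfl | rfl⟩ := key i j (by linarith) (by linarith) (by linarith) (by linarith)
    · exact absurd ⟨rfl, le_rfl⟩ hT
    · left; norm_num
  · exfalso
    obtain ⟨-, e1, e2, e3, p1, p2, p3⟩ := mem_right hx
    obtain ⟨rfl, rfl | rfl⟩ := key i j (by linarith) (by linarith) (by linarith) (by linarith)
    · push_cast at *; linarith
    · exact absurd hT.2 (by norm_num)
  · obtain ⟨-, e1, e2, e3, p1, p2, p3⟩ := mem_left hx
    obtain ⟨rfl, rfl | rfl⟩ := key i j (by linarith) (by linarith) (by linarith) (by linarith)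
    · right; norm_num
    · exact absurd hT.2 (by norm_num)

theorem mem_upper₂ {x : ℤ × ℤ → ℝ} (hx : x ∈ disk {(0, 0), (-1, 1), (0, 1)}) :
    colCoord x ≤ 0 ∧ 0 ≤ rowCoord x ∧ rowCoord x ≤ 1 ∧
      wsum pos₂ x = colCoord x + rowCoord x * ζ := by
  obtain ⟨-, e1, e2, e3, p1, p2, p3⟩ :=
    mem_upper (i := -1) (j := 0) (x := x) (by norm_num; exact hx)
  norm_num at e1 e2 e3 p1 p2 p3
  refine ⟨by linarith, by linarith, by linarith, ?_⟩
  rw [wsum_triple pos₂ (by simp) (by simp) (by simp) hx, e1, e2, e3]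
  simp [pos₂, fold, pos₀]
  ring

theorem mem_left₂ {x : ℤ × ℤ → ℝ} (hx : x ∈ disk {(0, 0), (0, 1), (1, 1)}) :
    0 ≤ colCoord x ∧ 0 ≤ rowCoord x ∧ rowCoord x ≤ 1 ∧
      wsum pos₂ x = colCoord x + (rowCoord x - colCoord x) * ζ := by
  obtain ⟨-, e1, e2, e3, p1, p2, p3⟩ :=
    mem_left (i := 0) (j := 0) (x := x) (by norm_num; exact hx)
  norm_num at e1 e2 e3 p1 p2 p3
  refine ⟨by linarith, by linarith, by linarith, ?_⟩
  rw [wsum_triple pos₂ (by simp) (by simp) (by simp) hx, e1, e2, e3]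
  simp [pos₂, fold, pos₀]
  ring

section Geodesic

variable {γ : ℝ → ℤ × ℤ → ℝ}

/-- Straightness in a chart, read in lattice coordinates; the equation for `α` and `β` is unit
speed. -/
theorem exists_direction {G : Set (Finset (ℤ × ℤ))} {pos : ℤ × ℤ → ℂ} (hc : model.IsChart G pos)
    {X : (ℤ × ℤ → ℝ) → ℝ} (hX : ∀ x ∈ model.points, wsum pos x = X x + rowCoord x * ζ)
    (hγ : model.IsGeodesic γ) {t : ℝ} (hG : ∀ f ∈ model.faces, γ t ∈ disk f → f ∈ G) :
    ∃ α β : ℝ, α ^ 2 + α * β + β ^ 2 = 1 ∧ ∃ ε > 0, ∀ s : ℝ, |s| < ε →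
      X (γ (t + s)) = X (γ t) + s * α ∧ rowCoord (γ (t + s)) = rowCoord (γ t) + s * β := by
  obtain ⟨u, hu, ε, hε, H⟩ := hγ.straightIn hc hG
  obtain ⟨α, β, rfl⟩ := exists_lattice u
  refine ⟨α, β, by rw [← normSq_lattice, hu, one_pow], ε, hε, fun s hs => lattice_ext ?_⟩
  rw [← hX _ (hγ.mem_points _), (H s hs).2, hX _ (hγ.mem_points _)]
  push_cast; ring

theorem exists_direction₀ (hγ : model.IsGeodesic γ) {t : ℝ}
    (h : (colCoord (γ t), rowCoord (γ t)) ∈ region₀) :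
    ∃ α β : ℝ, α ^ 2 + α * β + β ^ 2 = 1 ∧ ∃ ε > 0, ∀ s : ℝ, |s| < ε →
      colCoord (γ (t + s)) = colCoord (γ t) + s * α ∧
      rowCoord (γ (t + s)) = rowCoord (γ t) + s * β :=
  exists_direction isChart₀ (fun _ => wsum_pos₀) hγ fun _ => mem_chart₀ h

theorem exists_direction₁ (hγ : model.IsGeodesic γ) {t : ℝ}
    (h : (shearCoord (γ t), rowCoord (γ t)) ∈ region₁) :
    ∃ α β : ℝ, α ^ 2 + α * β + β ^ 2 = 1 ∧ ∃ ε > 0, ∀ s : ℝ, |s| < ε →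
      shearCoord (γ (t + s)) = shearCoord (γ t) + s * α ∧
      rowCoord (γ (t + s)) = rowCoord (γ t) + s * β :=
  exists_direction isChart₁ (fun _ => wsum_pos₁) hγ fun _ => mem_chart₁ h

/-- The two triangles at the special edge are flattened by `pos₂`. The lattice height there is
`rowCoord` on the left and `rowCoord - colCoord` on the right, whence the extra term `s * α` on one
side only. -/
theorem exists_direction₂ (hγ : model.IsGeodesic γ) {t : ℝ} (h : colCoord (γ t) = 0)
    (h0 : 0 < rowCoord (γ t)) (h1 : rowCoord (γ t) < 1) :
    ∃ α β : ℝ, ∃ ε > 0, ∀ s : ℝ, |s| < ε →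
      colCoord (γ (t + s)) = s * α ∧ 0 ≤ rowCoord (γ (t + s)) ∧ rowCoord (γ (t + s)) ≤ 1 ∧
      (s * α ≤ 0 → rowCoord (γ (t + s)) = rowCoord (γ t) + s * β) ∧
      (0 ≤ s * α → rowCoord (γ (t + s)) = rowCoord (γ t) + s * β + s * α) := by
  obtain ⟨u, hu, ε, hε, H⟩ := hγ.straightIn isChart₂ (t := t) fun _ => mem_chart₂ h h0 h1
  obtain ⟨α, β, rfl⟩ := exists_lattice u
  have e0 : wsum pos₂ (γ t) = (0 : ℝ) + rowCoord (γ t) * ζ := by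
    obtain ⟨⟨f, hf, hx⟩, -⟩ := H 0 (by simpa using hε)
    rw [add_zero] at hx
    rcases hf with rfl | rfl
    · rw [(mem_upper₂ hx).2.2.2, h]
    · rw [(mem_left₂ hx).2.2.2, h]; push_cast; ring
  refine ⟨α, β, ε, hε, fun s hs => ?_⟩
  obtain ⟨⟨f, hf, hx⟩, e⟩ := H s hs
  rw [e0] at e
  rcases hf with rfl | rfl
  · obtain ⟨p1, p2, p3, p4⟩ := mem_upper₂ hx
    obtain ⟨c1, c2⟩ := lattice_ext (a := colCoord (γ (t + s))) (b := rowCoord (γ (t + s)))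
      (c := s * α) (d := rowCoord (γ t) + s * β) (by
        rw [← p4, e]; push_cast; ring)
    exact ⟨c1, p2, p3, fun _ => c2, fun h => by rw [c2]; linarith⟩
  · obtain ⟨p1, p2, p3, p4⟩ := mem_left₂ hx
    obtain ⟨c1, c2⟩ := lattice_ext (a := colCoord (γ (t + s)))
      (b := rowCoord (γ (t + s)) - colCoord (γ (t + s)))
      (c := s * α) (d := rowCoord (γ t) + s * β) (by
        push_cast; rw [← p4, e]; push_cast; ring)
    exact ⟨c1, p2, p3, fun _ => by linarith, fun h => by linarith⟩

theorem continuous_clamp : Continuous clamp := by unfold clamp; fun_prop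

theorem continuous_colCoord (hγ : model.IsGeodesic γ) : Continuous fun t => colCoord (γ t) :=
  hγ.continuous _

theorem continuous_rowCoord (hγ : model.IsGeodesic γ) : Continuous fun t => rowCoord (γ t) :=
  hγ.continuous _

theorem continuous_shearCoord (hγ : model.IsGeodesic γ) : Continuous fun t => shearCoord (γ t) :=
  (continuous_colCoord hγ).sub (continuous_clamp.comp (continuous_rowCoord hγ))

/-- `eq_ray_of_locally_straight` in coordinates; it allows the ray to start and end on the boundary
of `Ω`. -/
theorem ray_of {X : (ℤ × ℤ → ℝ) → ℝ} {Ω : Set (ℝ × ℝ)} (hX : Continuous fun t => X (γ t))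
    (hY : Continuous fun t => rowCoord (γ t))
    (hloc : ∀ t, (X (γ t), rowCoord (γ t)) ∈ Ω →
      ∃ α β : ℝ, α ^ 2 + α * β + β ^ 2 = 1 ∧ ∃ ε > 0, ∀ s : ℝ, |s| < ε →
      X (γ (t + s)) = X (γ t) + s * α ∧ rowCoord (γ (t + s)) = rowCoord (γ t) + s * β)
    {t₀ a b α β δ : ℝ} (hδ : 0 < δ)
    (h0 : ∀ s, 0 ≤ s → s < δ →
      X (γ (t₀ + s)) = a + s * α ∧ rowCoord (γ (t₀ + s)) = b + s * β) {S : ℝ}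
    (hΩ : ∀ s, 0 < s → s < S → (a + s * α, b + s * β) ∈ Ω) :
    ∀ s, 0 ≤ s → s ≤ S → X (γ (t₀ + s)) = a + s * α ∧ rowCoord (γ (t₀ + s)) = b + s * β := by
  intro s hs hsS
  have := eq_ray_of_locally_straight (f := fun t => (X (γ t), rowCoord (γ t))) (hX.prodMk hY)
    (Ω := Ω) (fun t ht => by
      obtain ⟨α, β, -, ε, hε, H⟩ := hloc t ht
      exact ⟨(α, β), ε, hε, fun s hs => Prod.ext (H s hs).1 (H s hs).2⟩)
    (z := (a, b)) (u := (α, β)) hδ (fun s hs hsδ => Prod.ext (h0 s hs hsδ).1 (h0 s hs hsδ).2)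
    (fun s h1 h2 => hΩ s h1 h2) s hs hsS
  exact ⟨congrArg Prod.fst this, congrArg Prod.snd this⟩

theorem ray₀ (hγ : model.IsGeodesic γ) {t₀ a b α β δ : ℝ} (hδ : 0 < δ)
    (h0 : ∀ s, 0 ≤ s → s < δ →
      colCoord (γ (t₀ + s)) = a + s * α ∧ rowCoord (γ (t₀ + s)) = b + s * β) {S : ℝ}
    (hΩ : ∀ s, 0 < s → s < S → (a + s * α, b + s * β) ∈ region₀) :
    ∀ s, 0 ≤ s → s ≤ S →
      colCoord (γ (t₀ + s)) = a + s * α ∧ rowCoord (γ (t₀ + s)) = b + s * β :=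
  ray_of (continuous_colCoord hγ) (continuous_rowCoord hγ) (fun _ => exists_direction₀ hγ) hδ h0 hΩ

theorem ray₁ (hγ : model.IsGeodesic γ) {t₀ a b α β δ : ℝ} (hδ : 0 < δ)
    (h0 : ∀ s, 0 ≤ s → s < δ →
      shearCoord (γ (t₀ + s)) = a + s * α ∧ rowCoord (γ (t₀ + s)) = b + s * β) {S : ℝ}
    (hΩ : ∀ s, 0 < s → s < S → (a + s * α, b + s * β) ∈ region₁) :
    ∀ s, 0 ≤ s → s ≤ S →
      shearCoord (γ (t₀ + s)) = a + s * α ∧ rowCoord (γ (t₀ + s)) = b + s * β :=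
  ray_of (continuous_shearCoord hγ) (continuous_rowCoord hγ) (fun _ => exists_direction₁ hγ) hδ h0
    hΩ

end Geodesic

end SemiParadoxist

/-! ### Lines that have to meet the vertical line. -/

namespace SemiParadoxist

open SManifold Complex

/-- The vertical lines to the right of the two special vertices. -/
def vertical (c : ℝ) : Set (ℤ × ℤ → ℝ) :=
  {x | x ∈ model.points ∧ 2 * shearCoord x + rowCoord x = c}

section Universal

variable {γ : ℝ → ℤ × ℤ → ℝ}

/-- A ray in the region on the right which approaches a vertical line meets it. -/
theorem exists_mem_vertical (hγ : model.IsGeodesic γ) {t₀ a b α β δ c S : ℝ} (hδ : 0 < δ)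
    (h0 : ∀ s, 0 ≤ s → s < δ →
      shearCoord (γ (t₀ + s)) = a + s * α ∧ rowCoord (γ (t₀ + s)) = b + s * β)
    (hS : 0 ≤ S) (hc : 2 * (a + S * α) + (b + S * β) = c)
    (hΩ : ∀ s, 0 < s → s < S → (a + s * α, b + s * β) ∈ region₁) :
    ∃ t, γ t ∈ vertical c := by
  obtain ⟨h1, h2⟩ := ray₁ hγ hδ h0 hΩ S hS le_rfl
  exact ⟨t₀ + S, hγ.mem_points _, by rw [h1, h2, hc]⟩

/-- The time at which a moving point meets a vertical line. -/
theorem exists_time {a b α β c : ℝ} (h : 0 < 2 * α + β) (hc : 2 * a + b ≤ c) :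
    ∃ S, 0 ≤ S ∧ 2 * (a + S * α) + (b + S * β) = c := by
  refine ⟨(c - (2 * a + b)) / (2 * α + β), div_nonneg (by linarith) h.le, ?_⟩
  field_simp
  ring

/-- This makes the whole side of `vertical c` away from the special edge flat, for every positive
`c`. -/
theorem mem_region₁_of_pos {a b : ℝ} (h : 0 < 2 * a + b) : (a, b) ∈ region₁ := by
  change 0 < a + b ∨ b < 0 ∨ 1 < b
  by_contra! hc
  linarith [hc.1, hc.2.1]

/-- A curve from the right of a vertical line, directed to the left, meets the line. -/
theorem exists_mem_vertical_of_right (hγ : model.IsGeodesic γ) {t₀ a b α β δ c : ℝ} (hδ : 0 < δ)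
    (h0 : ∀ s, 0 ≤ s → s < δ →
      shearCoord (γ (t₀ + s)) = a + s * α ∧ rowCoord (γ (t₀ + s)) = b + s * β)
    (hc : 0 < c) (hac : c ≤ 2 * a + b) (hdir : 2 * α + β < 0) : ∃ t, γ t ∈ vertical c := by
  obtain ⟨S, hS, e⟩ := exists_time (a := -a) (b := -b) (α := -α) (β := -β) (c := -c)
    (by linarith) (by linarith)
  refine exists_mem_vertical hγ hδ h0 hS (c := c) (by linarith) fun s _ hs => ?_
  apply mem_region₁_of_pos
  nlinarith

/-- A curve through a point on the right of a vertical line either meets the line or is vertical. -/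
theorem exists_mem_vertical_or (hγ : model.IsGeodesic γ) {c d : ℝ} (hc : 0 < c) (hcd : c ≤ d)
    {t₀ : ℝ} (h : γ t₀ ∈ vertical d) : (∃ t, γ t ∈ vertical c) ∨ Set.range γ = vertical d := by
  obtain ⟨-, hd⟩ := h
  have hreg : (shearCoord (γ t₀), rowCoord (γ t₀)) ∈ region₁ := mem_region₁_of_pos (by linarith)
  obtain ⟨α, β, hαβ, ε, hε, H⟩ := exists_direction₁ hγ hreg
  set a := shearCoord (γ t₀)
  set b := rowCoord (γ t₀)
  have hf : ∀ s, 0 ≤ s → s < ε →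
      shearCoord (γ (t₀ + s)) = a + s * α ∧ rowCoord (γ (t₀ + s)) = b + s * β :=
    fun s h0 hs => H s (by rwa [abs_of_nonneg h0])
  have hr : ∀ s, 0 ≤ s → s < ε → shearCoord (γ (-(-t₀ + s))) = a + s * -α ∧
      rowCoord (γ (-(-t₀ + s))) = b + s * -β := fun s h0 hs => by
    have := H (-s) (by rwa [abs_neg, abs_of_nonneg h0])
    rw [show -(-t₀ + s) = t₀ + -s by ring]
    exact ⟨by rw [this.1]; ring, by rw [this.2]; ring⟩
  rcases lt_trichotomy (2 * α + β) 0 with hdir | hdir | hdir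
  · exact Or.inl (exists_mem_vertical_of_right hγ hε hf hc (by linarith) hdir)
  -- The motion keeps `2 * a + b = d`, so it stays in the chart for all times in both directions; as
  -- `β ≠ 0`, it sweeps out all of `vertical d`.
  · right
    have hreg' : ∀ s, (a + s * α, b + s * β) ∈ region₁ := fun s => by
      apply mem_region₁_of_pos
      have : 2 * (a + s * α) + (b + s * β) = d := by linear_combination hd + s * hdir
      linarith
    have hall : ∀ s, shearCoord (γ (t₀ + s)) = a + s * α ∧ rowCoord (γ (t₀ + s)) = b + s * β := by
      intro s
      rcases le_total 0 s with hs | hs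
      · exact ray₁ hγ hε hf (S := s) (fun s _ _ => hreg' s) s hs le_rfl
      · have := ray₁ hγ.reverse hε hr (S := -s) (fun s _ _ => by
          have := hreg' (-s)
          rwa [neg_mul, neg_mul, ← mul_neg, ← mul_neg] at this) (-s) (by linarith) le_rfl
        beta_reduce at this
        rw [show -(-t₀ + -s) = t₀ + s by ring, neg_mul_neg, neg_mul_neg] at this
        exact this
    have hβ : β ≠ 0 := by
      rintro rfl
      have : α = 0 := by linarith
      subst this
      norm_num at hαβ
    ext x
    constructor
    · rintro ⟨t, rfl⟩
      have := hall (t - t₀)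
      rw [add_sub_cancel] at this
      refine ⟨hγ.mem_points t, ?_⟩
      rw [this.1, this.2]
      linear_combination hd + (t - t₀) * hdir
    · rintro ⟨hx, hxd⟩
      obtain ⟨h1, h2⟩ := hall ((rowCoord x - b) / β)
      have e2 : rowCoord (γ (t₀ + (rowCoord x - b) / β)) = rowCoord x := by
        rw [h2]; field_simp; ring
      have e1 : shearCoord (γ (t₀ + (rowCoord x - b) / β)) = shearCoord x := by
        have : (rowCoord x - b) / β * β = rowCoord x - b := by field_simp
        rw [h1]
        linear_combination hd / 2 - hxd / 2 + (rowCoord x - b) / β / 2 * hdir - this / 2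
      refine ⟨_, eq_of_coords (hγ.mem_points _) hx ?_ e2⟩
      unfold shearCoord at e1
      rw [e2] at e1
      linarith
  · obtain ⟨t, ht⟩ :=
      exists_mem_vertical_of_right hγ.reverse hε hr hc (c := c) (by linarith) (by linarith)
    exact Or.inl ⟨_, ht⟩

theorem coords_single (v : ℤ × ℤ) :
    colCoord (Pi.single v 1) = v.1 ∧ rowCoord (Pi.single v 1) = v.2 :=
  ⟨wsum_single _ _, wsum_single _ _⟩

theorem single_mem_points (v : ℤ × ℤ) : (Pi.single v 1 : ℤ × ℤ → ℝ) ∈ model.points := by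
  obtain ⟨w, hw⟩ := exists_isLinkCycle v
  exact ⟨_, hw.mem 0, single_mem_disk (by simp)⟩

/-- Coordinates determine a point of the model, so membership in a triangle can be checked in the
plane. -/
theorem mem_disk_left {x : ℤ × ℤ → ℝ} (hx : x ∈ model.points) {i j : ℤ} (h : Turned i j)
    (h1 : i ≤ colCoord x) (h2 : rowCoord x ≤ j + 1) (h3 : colCoord x - i ≤ rowCoord x - j) :
    x ∈ disk {(i, j), (i, j + 1), (i + 1, j + 1)} := by
  obtain ⟨y, hy, e1, e2⟩ := exists_left h1 h2 h3
  rwa [eq_of_coords hx ⟨_, Face.left _ _ h, hy⟩ e1.symm e2.symm]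

theorem mem_disk_right {x : ℤ × ℤ → ℝ} (hx : x ∈ model.points) {i j : ℤ} (h : Turned i j)
    (h1 : colCoord x ≤ i + 1) (h2 : j ≤ rowCoord x) (h3 : rowCoord x - j ≤ colCoord x - i) :
    x ∈ disk {(i, j), (i + 1, j), (i + 1, j + 1)} := by
  obtain ⟨y, hy, e1, e2⟩ := exists_right h1 h2 h3
  rwa [eq_of_coords hx ⟨_, Face.right _ _ h, hy⟩ e1.symm e2.symm]

theorem mem_disk_lower {x : ℤ × ℤ → ℝ} (hx : x ∈ model.points) {i j : ℤ} (h : ¬ Turned i j)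
    (h1 : i ≤ colCoord x) (h2 : j ≤ rowCoord x) (h3 : colCoord x - i + (rowCoord x - j) ≤ 1) :
    x ∈ disk {(i, j), (i + 1, j), (i, j + 1)} := by
  obtain ⟨y, hy, e1, e2⟩ := exists_lower h1 h2 h3
  rwa [eq_of_coords hx ⟨_, Face.lower _ _ h, hy⟩ e1.symm e2.symm]

theorem mem_disk_upper {x : ℤ × ℤ → ℝ} (hx : x ∈ model.points) {i j : ℤ} (h : ¬ Turned i j)
    (h1 : colCoord x ≤ i + 1) (h2 : rowCoord x ≤ j + 1)
    (h3 : 1 ≤ colCoord x - i + (rowCoord x - j)) :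
    x ∈ disk {(i + 1, j), (i, j + 1), (i + 1, j + 1)} := by
  obtain ⟨y, hy, e1, e2⟩ := exists_upper h1 h2 h3
  rwa [eq_of_coords hx ⟨_, Face.upper _ _ h, hy⟩ e1.symm e2.symm]

/-- A curve which reaches the elliptic vertex along the edge from the left leaves it upwards to the
right. -/
theorem leaves_elliptic (hγ : model.IsGeodesic γ) {T δ : ℝ} (hδ : 0 < δ) (hδ1 : δ ≤ 1)
    (h : ∀ s, 0 ≤ s → s < δ → colCoord (γ (T - s)) = -s ∧ rowCoord (γ (T - s)) = 1) :
    ∃ ε > 0, ∀ s, 0 ≤ s → s < ε → shearCoord (γ (T + s)) = -1 + s * (1 / √3) ∧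
      rowCoord (γ (T + s)) = 1 + s * (1 / √3) := by
  have h00 := h 0 le_rfl hδ
  rw [sub_zero, neg_zero] at h00
  have hT : γ T = Pi.single (0, 1) 1 := by
    obtain ⟨e1, e2⟩ := coords_single (0, 1)
    refine eq_of_coords (hγ.mem_points T) (single_mem_points _) ?_ ?_
    · rw [e1, h00.1]; simp
    · rw [e2, h00.2]; simp
  have hB : model.BisectsAt γ T := (hγ T).resolve_left fun h => h.ne_single _ hT
  have hdeg : model.degree (0, 1) = 5 := by rw [degree_eq]; rfl
  obtain ⟨ε, hε, H⟩ := hB.of_edge isLinkCycle_link5 hdeg hT hδ (by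
    intro s hs0 hs
    obtain ⟨e1, e2⟩ := h s hs0.le hs
    have hx := mem_disk_upper (hγ.mem_points (T - s)) (i := -1) (j := 0) (by unfold Turned; omega)
      (by rw [e1]; push_cast; linarith) (by rw [e2]; simp) (by rw [e1, e2]; push_cast; linarith)
    obtain ⟨f0, f1, f2, f3, -⟩ := mem_upper hx
    rw [e1] at f2
    rw [e2] at f1
    refine ⟨?_, fun v hv hv' => ?_⟩
    · change 0 < γ (T - s) (-1, 0 + 1)
      rw [f2]; push_cast; linarith
    · by_cases hv0 : v = (-1 + 1, 0)
      · rw [hv0, f1]; norm_num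
      · exact f0 v hv0 hv' hv)
  refine ⟨ε, hε, fun s h0 hs => ?_⟩
  obtain ⟨hx, e1, e2⟩ := H s h0 hs
  -- `link5` begins with the left neighbour, along whose edge the curve arrives. Hence its entries 2
  -- and 3, the right and upper neighbours, span the triangle into which the curve leaves.
  change γ (T + s) (0 + 1, 1) = _ at e1
  change γ (T + s) (0, 1 + 1) = _ at e2
  obtain ⟨-, f1, f2, f3, -⟩ := mem_lower (i := 0) (j := 1) (x := γ (T + s)) hx
  have g1 : colCoord (γ (T + s)) = s / √3 := by rw [← e1, f2]; simp
  have g2 : rowCoord (γ (T + s)) = 1 + s / √3 := by rw [← e2, f3]; push_cast; ring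
  have : 0 ≤ s / √3 := by positivity
  rw [shearCoord, g1, g2, clamp_of_one_le (by linarith)]
  constructor <;> ring

/-- A curve which crosses the edge between the special vertices from the left is turned. -/
theorem leaves_edge (hγ : model.IsGeodesic γ) {T b α β δ : ℝ} (hδ : 0 < δ) (hα : 0 < α)
    (hb0 : 0 < b) (hb1 : b < 1)
    (h : ∀ s, 0 ≤ s → s < δ →
      colCoord (γ (T - s)) = -s * α ∧ rowCoord (γ (T - s)) = b - s * β) :
    ∃ ε > 0, ∀ s, 0 ≤ s → s < ε → shearCoord (γ (T + s)) = -b + s * -β ∧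
      rowCoord (γ (T + s)) = b + s * (α + β) := by
  have h00 := h 0 le_rfl hδ
  rw [sub_zero, neg_zero, zero_mul, zero_mul, sub_zero] at h00
  obtain ⟨α', β', ε, hε, H⟩ := exists_direction₂ hγ h00.1 (by rw [h00.2]; exact hb0)
    (by rw [h00.2]; exact hb1)
  rw [h00.2] at H
  obtain ⟨r, hr0, hr⟩ := exists_between (lt_min hδ hε)
  have hrδ := hr.trans_le (min_le_left _ _)
  have hrε := hr.trans_le (min_le_right _ _)
  obtain ⟨c1, -, -, c2, -⟩ := H (-r) (by rwa [abs_neg, abs_of_pos hr0])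
  obtain ⟨d1, d2⟩ := h r hr0.le hrδ
  rw [← sub_eq_add_neg, d1] at c1
  have hα' : α' = α := mul_left_cancel₀ (neg_ne_zero.2 hr0.ne') c1.symm
  subst hα'
  have c2 := c2 (by nlinarith)
  rw [← sub_eq_add_neg, d2] at c2
  have hβ' : β' = β := mul_left_cancel₀ hr0.ne' (by linarith)
  subst hβ'
  refine ⟨ε, hε, fun s hs0 hs => ?_⟩
  obtain ⟨g1, g2, g3, -, g4⟩ := H s (by rwa [abs_of_nonneg hs0])
  have g4 := g4 (by positivity)
  -- In the strip `shearCoord = colCoord - rowCoord`, so `(α, β)` becomes `(-β, α + β)`, which is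
  -- multiplication by `ζ`.
  rw [shearCoord, clamp_of_mem g2 g3, g1, g4]
  constructor <;> ring

/-- A curve through the point on the left of the elliptic vertex which is directed to the right, or
downwards, meets the vertical line. -/
theorem exists_mem_vertical_of_left (hγ : model.IsGeodesic γ) {t₀ α β δ : ℝ} (hδ : 0 < δ)
    (hαβ : α ^ 2 + α * β + β ^ 2 = 1)
    (h0 : ∀ s, 0 ≤ s → s < δ →
      colCoord (γ (t₀ + s)) = -1 / 4 + s * α ∧ rowCoord (γ (t₀ + s)) = 1 + s * β)
    (hdir : 0 < 2 * α + β ∨ 2 * α + β = 0 ∧ β < 0) : ∃ t, γ t ∈ vertical (1 / 2) := by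
  rcases lt_trichotomy β 0 with hβ | rfl | hβ
  · have hα : 0 < α := by rcases hdir with h | h <;> linarith
    have hαβ' : 0 ≤ 2 * α + β := by rcases hdir with h | h <;> linarith
    -- The special edge is reached at time `1 / (4 * α)` and height `1 + β / (4 * α)`, which is at
    -- least `1 / 2` and below `1` because `-2 * α ≤ β < 0`.
    have hray := ray₀ hγ hδ h0 (S := 1 / (4 * α)) (fun s _ hs => by
      left
      rw [lt_div_iff₀ (by positivity)] at hs
      dsimp only
      linarith)
    have hT : 0 < 1 / (4 * α) := by positivity
    set S := 1 / (4 * α) with hS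
    have hSα : S * α = 1 / 4 := by rw [hS]; field_simp
    obtain ⟨ε, hε, H⟩ := leaves_edge hγ (T := t₀ + S) (b := 1 + S * β) (α := α) (β := β) hT hα
      (by nlinarith) (by nlinarith) (fun s hs hsS => by
        obtain ⟨e1, e2⟩ := hray (S - s) (by linarith) (by linarith)
        rw [add_sub_assoc, e1, e2]
        constructor <;> linarith)
    have hb : 0 < 1 + S * β := by nlinarith
    -- After the turn the curve approaches the vertical line: `2 * -β + (α + β) = α - β` is
    -- positive.
    obtain ⟨S', hS', e⟩ := exists_time (a := -(1 + S * β)) (b := 1 + S * β) (α := -β) (β := α + β)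
      (c := 1 / 2) (by linarith) (by linarith)
    refine exists_mem_vertical hγ hε H hS' e fun s hs _ => ?_
    left
    have := mul_pos hs hα
    dsimp only
    linarith
  · have hα : α = 1 := by
      rcases hdir with h | h
      · nlinarith
      · exact absurd h.2 (lt_irrefl _)
    subst hα
    have hray := ray₀ hγ hδ h0 (S := 1 / 4) (fun s _ hs => by
      left
      dsimp only
      linarith)
    obtain ⟨ε, hε, H⟩ := leaves_elliptic hγ (T := t₀ + 1 / 4) (δ := 1 / 4) (by norm_num)
      (by norm_num) (fun s hs hsS => by
        obtain ⟨e1, e2⟩ := hray (1 / 4 - s) (by linarith) (by linarith)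
        rw [add_sub_assoc, e1, e2]
        constructor <;> linarith)
    have h3 : 0 < 1 / √(3 : ℝ) := by positivity
    -- Seen from the right, the elliptic vertex is at `(-1, 1)`, and the curve leaves it at 30°
    -- upwards.
    obtain ⟨S', hS', e⟩ := exists_time (a := -1) (b := 1) (α := 1 / √3) (β := 1 / √3)
      (c := 1 / 2) (by linarith) (by norm_num)
    refine exists_mem_vertical hγ hε H hS' e fun s hs _ => ?_
    right; right
    have := mul_pos hs h3
    dsimp only
    linarith
  · have hα : 0 < 2 * α + β := hdir.resolve_right fun h => absurd h.2 hβ.le.not_gt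
    -- A rising curve stays above the strip, where passing to the right description subtracts one
    -- from the column.
    obtain ⟨S', hS', e⟩ := exists_time (a := -5 / 4) (b := 1) (α := α) (β := β)
      (c := 1 / 2) hα (by norm_num)
    refine exists_mem_vertical hγ (t₀ := t₀) hδ (fun s hs hsδ => ?_) hS' e fun s hs _ => ?_
    · obtain ⟨e1, e2⟩ := h0 s hs hsδ
      have : 0 ≤ s * β := by positivity
      rw [shearCoord, e1, e2, clamp_of_one_le (by linarith)]
      exact ⟨by ring, rfl⟩
    · right; right
      have := mul_pos hs hβ
      dsimp only
      linarith

/-- Every curve through the point on the left of the elliptic vertex meets the vertical line. -/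
theorem exists_mem_vertical_of_elliptic (hγ : model.IsGeodesic γ) {t₀ : ℝ}
    (h1 : colCoord (γ t₀) = -1 / 4) (h2 : rowCoord (γ t₀) = 1) :
    ∃ t, γ t ∈ vertical (1 / 2) := by
  obtain ⟨α, β, hαβ, ε, hε, H⟩ := exists_direction₀ hγ (t := t₀) (by
    left; dsimp only; rw [h1]; norm_num)
  rw [h1, h2] at H
  have hf : ∀ s, 0 ≤ s → s < ε →
      colCoord (γ (t₀ + s)) = -1 / 4 + s * α ∧ rowCoord (γ (t₀ + s)) = 1 + s * β :=
    fun s h0 hs => H s (by rwa [abs_of_nonneg h0])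
  have hr : ∀ s, 0 ≤ s → s < ε → colCoord (γ (-(-t₀ + s))) = -1 / 4 + s * -α ∧
      rowCoord (γ (-(-t₀ + s))) = 1 + s * -β := fun s h0 hs => by
    have := H (-s) (by rwa [abs_neg, abs_of_nonneg h0])
    rw [show -(-t₀ + s) = t₀ + -s by ring]
    exact ⟨by rw [this.1]; ring, by rw [this.2]; ring⟩
  have hβ : 2 * α + β = 0 → β ≠ 0 := by
    rintro h rfl
    have : α = 0 := by linarith
    subst this
    norm_num at hαβ
  -- One of the two orientations points to the right, or straight down if the line is perpendicular
  -- to the rows.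
  by_cases hdir : 0 < 2 * α + β ∨ 2 * α + β = 0 ∧ β < 0
  · exact exists_mem_vertical_of_left hγ hε hαβ hf hdir
  · obtain ⟨t, ht⟩ := exists_mem_vertical_of_left hγ.reverse hε (by linarith) hr (by
      push Not at hdir
      rcases hdir.1.lt_or_eq with h | h
      · left; linarith
      · right
        exact ⟨by linarith, by linarith [(hdir.2 h).lt_of_ne (hβ h).symm]⟩)
    exact ⟨_, ht⟩

end Universal

end SemiParadoxist

/-! ### Straightness of affine curves in lattice coordinates. -/

namespace SemiParadoxist

open SManifold Complex

section Straight

/-- The triangle over the edge from `(i, j)` to `(i + 1, j)` of the lattice is realized. -/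
def HasLower (X : (ℤ × ℤ → ℝ) → ℝ) (π : ℤ × ℤ → ℤ × ℤ) (i j : ℤ) : Prop :=
  {π (i, j), π (i + 1, j), π (i, j + 1)} ∈ model.faces ∧
    ∀ x ∈ model.points, i ≤ X x → j ≤ rowCoord x → X x - i + (rowCoord x - j) ≤ 1 →
      x ∈ disk {π (i, j), π (i + 1, j), π (i, j + 1)}

/-- The triangle below the edge from `(i, j + 1)` to `(i + 1, j + 1)` of the lattice is realized. -/
def HasUpper (X : (ℤ × ℤ → ℝ) → ℝ) (π : ℤ × ℤ → ℤ × ℤ) (i j : ℤ) : Prop :=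
  {π (i + 1, j), π (i, j + 1), π (i + 1, j + 1)} ∈ model.faces ∧
    ∀ x ∈ model.points, X x ≤ i + 1 → rowCoord x ≤ j + 1 → 1 ≤ X x - i + (rowCoord x - j) →
      x ∈ disk {π (i + 1, j), π (i, j + 1), π (i + 1, j + 1)}

variable {X : (ℤ × ℤ → ℝ) → ℝ} {pos : ℤ × ℤ → ℂ} {π : ℤ × ℤ → ℤ × ℤ}
  {γ : ℝ → ℤ × ℤ → ℝ} {t a b α β ε : ℝ} {i j : ℤ}

theorem eventually_of_affine {c d : ℝ} (h : 0 < c) :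
    ∀ᶠ s : ℝ in nhds 0, 0 < c + s * d := by
  have : Continuous fun s : ℝ => c + s * d := by fun_prop
  exact this.continuousAt.eventually (lt_mem_nhds (by simpa using h))

/-- A curve which is affine in lattice coordinates, and stays in two adjacent triangles, is
straight. -/
theorem straightAt_of_rhombus (hX : ∀ x ∈ model.points, wsum pos x = X x + rowCoord x * ζ)
    {p q r s : ℤ × ℤ} (hps : p ≠ s) (hp : {p, q, r} ∈ model.faces) (hs : {s, q, r} ∈ model.faces)
    (hqr : ‖pos r - pos q‖ = 1) (hpq : pos p - pos q = (pos r - pos q) * ζ)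
    (hsq : pos s - pos q = (pos r - pos q) * (starRingEnd ℂ) ζ)
    (hαβ : α ^ 2 + α * β + β ^ 2 = 1)
    (h : ∀ᶠ τ in nhds (0 : ℝ), γ (t + τ) ∈ model.points ∧
      X (γ (t + τ)) = a + τ * α ∧ rowCoord (γ (t + τ)) = b + τ * β ∧
      γ (t + τ) ∈ disk {p, q, r} ∪ disk {s, q, r}) : model.StraightAt γ t := by
  obtain ⟨ε, hε, H⟩ := Metric.eventually_nhds_iff.1 h
  refine straightAt_of_affine hps hp hs hqr hpq hsq (z := a + b * ζ)
    (norm_lattice_eq_one hαβ) hε fun τ hτ => ?_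
  obtain ⟨h1, h2, h3, h4⟩ := H (y := τ) (by simpa using hτ)
  refine ⟨h4, ?_⟩
  rw [hX _ h1, h2, h3]
  push_cast; ring

theorem triple_rotate {V : Type*} [DecidableEq V] (p q r : V) :
    ({p, q, r} : Finset V) = {r, p, q} := by
  rw [Finset.pair_comm, Finset.insert_comm, Finset.pair_comm p q]

variable (hX : ∀ x ∈ model.points, wsum pos x = X x + rowCoord x * ζ)
  (hπ : ∀ v, pos (π v) = pos₀ v) (hπi : Function.Injective π)
  (hαβ : α ^ 2 + α * β + β ^ 2 = 1)
  (h : ∀ᶠ τ in nhds (0 : ℝ), γ (t + τ) ∈ model.points ∧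
    X (γ (t + τ)) = a + τ * α ∧ rowCoord (γ (t + τ)) = b + τ * β)

include hX hπ hπi hαβ h

/-- Straightness in the rhombus with a falling diagonal. -/
theorem straightAt_of_square (hl : HasLower X π i j) (hu : HasUpper X π i j)
    (h1 : i < a) (h2 : a < i + 1) (h3 : j < b) (h4 : b < j + 1) : model.StraightAt γ t := by
  have e1 : ({π (i, j), π (i, j + 1), π (i + 1, j)} : Finset (ℤ × ℤ)) =
      {π (i, j), π (i + 1, j), π (i, j + 1)} := by rw [Finset.pair_comm]
  have e2 : ({π (i + 1, j + 1), π (i, j + 1), π (i + 1, j)} : Finset (ℤ × ℤ)) =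
      {π (i + 1, j), π (i, j + 1), π (i + 1, j + 1)} := by
    rw [Finset.pair_comm (π (i, j + 1)), Finset.insert_comm,
      Finset.pair_comm (π (i + 1, j + 1))]
  refine straightAt_of_rhombus (a := a) (b := b) hX (p := π (i + 1, j + 1)) (q := π (i, j + 1))
    (r := π (i + 1, j)) (s := π (i, j)) (hπi.ne (by simp)) (e2 ▸ hu.1) (e1 ▸ hl.1) ?_ ?_ ?_ hαβ ?_
  · rw [hπ, hπ]; apply LatticeAdj.norm_sub; unfold LatticeAdj; dsimp only; omega
  · simp only [hπ, pos₀]; push_cast; linear_combination ζ_sq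
  · simp only [hπ, pos₀, conj_ζ]; push_cast; linear_combination -ζ_sq
  · filter_upwards [h, eventually_of_affine (d := α) (sub_pos.2 h1),
      eventually_of_affine (d := -α) (sub_pos.2 h2), eventually_of_affine (d := β) (sub_pos.2 h3),
      eventually_of_affine (d := -β) (sub_pos.2 h4)] with τ ⟨f1, f2, f3⟩ g1 g2 g3 g4
    refine ⟨f1, f2, f3, ?_⟩
    rw [e1, e2]
    rcases le_total (X (γ (t + τ)) - i + (rowCoord (γ (t + τ)) - j)) 1 with hd | hd
    · exact Or.inr (hl.2 _ f1 (by rw [f2]; linarith) (by rw [f3]; linarith) hd)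
    · exact Or.inl (hu.2 _ f1 (by rw [f2]; linarith) (by rw [f3]; linarith) hd)

/-- Straightness in the rhombus with a horizontal diagonal. -/
theorem straightAt_of_horizontal (hl : HasLower X π i j) (hu : HasUpper X π i (j - 1))
    (h1 : i < a) (h2 : a < i + 1) (h3 : 0 < a - i + (b - j)) (h4 : a - i + (b - j) < 1) :
    model.StraightAt γ t := by
  have ej : j - 1 + 1 = j := by ring
  unfold HasUpper at hu
  rw [ej] at hu
  have e1 : ({π (i, j + 1), π (i, j), π (i + 1, j)} : Finset (ℤ × ℤ)) =
      {π (i, j), π (i + 1, j), π (i, j + 1)} := (triple_rotate _ _ _).symm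
  refine straightAt_of_rhombus (a := a) (b := b) hX (p := π (i, j + 1)) (q := π (i, j)) (r := π (i + 1, j))
    (s := π (i + 1, j - 1)) (hπi.ne (by simp)) (e1 ▸ hl.1) hu.1 ?_ ?_ ?_ hαβ ?_
  · rw [hπ, hπ]; apply LatticeAdj.norm_sub; unfold LatticeAdj; dsimp only; omega
  · simp only [hπ, pos₀]; push_cast; ring
  · simp only [hπ, pos₀, conj_ζ]; push_cast; ring
  · filter_upwards [h, eventually_of_affine (d := α) (sub_pos.2 h1),
      eventually_of_affine (d := -α) (sub_pos.2 h2), eventually_of_affine (d := α + β) h3,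
      eventually_of_affine (d := -(α + β)) (sub_pos.2 h4)] with τ ⟨f1, f2, f3⟩ g1 g2 g3 g4
    refine ⟨f1, f2, f3, ?_⟩
    rw [e1]
    rcases le_total (j : ℝ) (rowCoord (γ (t + τ))) with hd | hd
    · exact Or.inl (hl.2 _ f1 (by rw [f2]; linarith) hd (by rw [f2, f3]; linarith))
    · refine Or.inr (hu.2 _ f1 (by rw [f2]; linarith) (by push_cast; linarith) ?_)
      rw [f2, f3]; push_cast; linarith

/-- Straightness in the rhombus with a rising diagonal. -/
theorem straightAt_of_rising (hl : HasLower X π i j) (hu : HasUpper X π (i - 1) j)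
    (h1 : j < b) (h2 : b < j + 1) (h3 : 0 < a - i + (b - j)) (h4 : a - i + (b - j) < 1) :
    model.StraightAt γ t := by
  have ej : i - 1 + 1 = i := by ring
  unfold HasUpper at hu
  rw [ej] at hu
  have e1 : ({π (i + 1, j), π (i, j + 1), π (i, j)} : Finset (ℤ × ℤ)) =
      {π (i, j), π (i + 1, j), π (i, j + 1)} := by rw [triple_rotate]
  have e2 : ({π (i - 1, j + 1), π (i, j + 1), π (i, j)} : Finset (ℤ × ℤ)) =
      {π (i, j), π (i - 1, j + 1), π (i, j + 1)} := by rw [triple_rotate]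
  refine straightAt_of_rhombus (a := a) (b := b) hX (p := π (i + 1, j)) (q := π (i, j + 1)) (r := π (i, j))
    (s := π (i - 1, j + 1)) (hπi.ne (by simp)) (e1 ▸ hl.1) (e2 ▸ hu.1) ?_ ?_ ?_ hαβ ?_
  · rw [hπ, hπ]; apply LatticeAdj.norm_sub; unfold LatticeAdj; dsimp only; omega
  · simp only [hπ, pos₀]; push_cast; linear_combination ζ_sq
  · simp only [hπ, pos₀, conj_ζ]; push_cast; linear_combination -ζ_sq
  · filter_upwards [h, eventually_of_affine (d := β) (sub_pos.2 h1),
      eventually_of_affine (d := -β) (sub_pos.2 h2), eventually_of_affine (d := α + β) h3,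
      eventually_of_affine (d := -(α + β)) (sub_pos.2 h4)] with τ ⟨f1, f2, f3⟩ g1 g2 g3 g4
    refine ⟨f1, f2, f3, ?_⟩
    rw [e1, e2]
    rcases le_total (i : ℝ) (X (γ (t + τ))) with hd | hd
    · exact Or.inl (hl.2 _ f1 hd (by rw [f3]; linarith) (by rw [f2, f3]; linarith))
    · refine Or.inr (hu.2 _ f1 (by push_cast; linarith) (by rw [f3]; linarith) ?_)
      rw [f2, f3]; push_cast; linarith

end Straight

theorem hasLower₀ {i j : ℤ} (h : ¬ Turned i j) : HasLower colCoord id i j :=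
  ⟨Face.lower i j h, fun _ hx => mem_disk_lower hx h⟩

theorem hasUpper₀ {i j : ℤ} (h : ¬ Turned i j) : HasUpper colCoord id i j :=
  ⟨Face.upper i j h, fun _ hx => mem_disk_upper hx h⟩

/-- The vertex of the model at a given lattice position, as seen from the right. -/
def shear (v : ℤ × ℤ) : ℤ × ℤ := (if 1 ≤ v.2 then v.1 + 1 else v.1, v.2)

theorem unshear_shear (v : ℤ × ℤ) : unshear (shear v) = v := by
  unfold unshear shear
  ext
  · dsimp only; split_ifs <;> omega
  · rfl

/-- Undoing the shift sends the lower triangle of the lattice square `i` in the strip to the right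
half of the turned square `i`. Only the triangles over the left half of row 0 are missing. -/
theorem hasLower₁ {i j : ℤ} (h : ¬ (j = 0 ∧ i < 0)) : HasLower shearCoord shear i j := by
  unfold HasLower shear shearCoord
  dsimp only
  rcases lt_trichotomy j 0 with hj | rfl | hj
  · have hj' : (j : ℝ) + 1 ≤ 0 := by exact_mod_cast hj
    rw [if_neg (by omega), if_neg (by omega), if_neg (by omega)]
    have hT : ¬ Turned i j := by unfold Turned; omega
    refine ⟨Face.lower i j hT, fun x hx h1 h2 h3 => ?_⟩
    have := clamp_nonneg (rowCoord x)
    by_cases hr : rowCoord x ≤ 0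
    · rw [clamp_of_nonpos hr] at h1 h3
      exact mem_disk_lower hx hT (by linarith) h2 (by linarith)
    · linarith
  · rw [if_neg (by omega), if_neg (by omega), if_pos (by omega)]
    have hT : Turned i 0 := ⟨rfl, by omega⟩
    refine ⟨Face.right i 0 hT, fun x hx h1 h2 h3 => ?_⟩
    push_cast at *
    have hi : (0 : ℝ) ≤ i := by exact_mod_cast hT.2
    have hr : rowCoord x ≤ 1 := by
      by_contra! hc
      rw [clamp_of_one_le hc.le] at h1 h3
      linarith
    rw [clamp_of_mem h2 hr] at h1 h3
    exact mem_disk_right hx hT (by linarith) (by push_cast; linarith) (by push_cast; linarith)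
  · have hj' : (1 : ℝ) ≤ j := by exact_mod_cast hj
    rw [if_pos (by omega), if_pos (by omega), if_pos (by omega)]
    have hT : ¬ Turned (i + 1) j := by unfold Turned; omega
    refine ⟨Face.lower (i + 1) j hT, fun x hx h1 h2 h3 => ?_⟩
    rw [clamp_of_one_le (by linarith)] at h1 h3
    exact mem_disk_lower hx hT (by push_cast; linarith) h2 (by push_cast; linarith)

/-- In the strip, the upper triangle of the lattice square `i` comes from the left half of the
turned square `i + 1`; hence `i = -1` is still realized here, though not in `hasLower₁`. -/
theorem hasUpper₁ {i j : ℤ} (h : ¬ (j = 0 ∧ i < -1)) : HasUpper shearCoord shear i j := by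
  unfold HasUpper shear shearCoord
  dsimp only
  rcases lt_trichotomy j 0 with hj | rfl | hj
  · have hj' : (j : ℝ) + 1 ≤ 0 := by exact_mod_cast hj
    rw [if_neg (by omega), if_neg (by omega), if_neg (by omega)]
    have hT : ¬ Turned i j := by unfold Turned; omega
    refine ⟨Face.upper i j hT, fun x hx h1 h2 h3 => ?_⟩
    rw [clamp_of_nonpos (by linarith)] at h1 h3
    exact mem_disk_upper hx hT (by linarith) h2 (by linarith)
  · rw [if_neg (by omega), if_pos (by omega), if_pos (by omega)]
    have hT : Turned (i + 1) 0 := ⟨rfl, by omega⟩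
    refine ⟨Face.left (i + 1) 0 hT, fun x hx h1 h2 h3 => ?_⟩
    push_cast at *
    have h0 : 0 ≤ rowCoord x := by
      by_contra! hc
      rw [clamp_of_nonpos hc.le] at h1 h3
      linarith
    rw [clamp_of_mem h0 (by linarith)] at h1 h3
    exact mem_disk_left hx hT (by push_cast; linarith) (by push_cast; linarith)
      (by push_cast; linarith)
  · have hj' : (1 : ℝ) ≤ j := by exact_mod_cast hj
    rw [if_pos (by omega), if_pos (by omega), if_pos (by omega)]
    have hT : ¬ Turned (i + 1) j := by unfold Turned; omega
    refine ⟨Face.upper (i + 1) j hT, fun x hx h1 h2 h3 => ?_⟩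
    by_cases hr : 1 ≤ rowCoord x
    · rw [clamp_of_one_le hr] at h1 h3
      exact mem_disk_upper hx hT (by push_cast; linarith) h2 (by push_cast; linarith)
    · have := clamp_nonneg (rowCoord x)
      have : clamp (rowCoord x) ≤ 1 := max_le zero_le_one (min_le_left _ _)
      linarith

/-! ### Straight curves in the two large charts, and the vertical lines. -/

section Existence

variable {γ : ℝ → ℤ × ℤ → ℝ} {t a b α β : ℝ}

theorem floor_strict {a : ℝ} (h : ∀ i : ℤ, a ≠ i) : (⌊a⌋ : ℝ) < a ∧ a < ⌊a⌋ + 1 :=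
  ⟨(Int.floor_le a).lt_of_ne (h _).symm, Int.lt_floor_add_one a⟩

/-- A point that is no vertex lies inside a rhombus of two adjacent triangles: across a horizontal
edge if `b` is an integer, across an edge between two rows in one column if `a` is, and in an open
square otherwise. The region ensures that the triangles needed are not turned. -/
theorem straightAt₀ (hαβ : α ^ 2 + α * β + β ^ 2 = 1) (hreg : (a, b) ∈ region₀)
    (hv : ∀ i j : ℤ, ¬ (a = i ∧ b = j))
    (h : ∀ᶠ τ in nhds (0 : ℝ), γ (t + τ) ∈ model.points ∧
      colCoord (γ (t + τ)) = a + τ * α ∧ rowCoord (γ (t + τ)) = b + τ * β) :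
    model.StraightAt γ t := by
  have hX : ∀ x ∈ model.points, wsum pos₀ x = colCoord x + rowCoord x * ζ := fun _ => wsum_pos₀
  have hpos : ∀ v, pos₀ (id v) = pos₀ v := fun _ => rfl
  have key : ∀ i j : ℤ, (i : ℝ) ≤ a → (j : ℝ) ≤ b → b < j + 1 → ¬ Turned i j := by
    rintro i j h1 h2 h3 ⟨rfl, hi⟩
    have : (0 : ℝ) ≤ i := by exact_mod_cast hi
    push_cast at *
    rcases hreg with h | h | h <;> dsimp only at h <;> linarith
  by_cases hb : ∃ j : ℤ, b = j
  · obtain ⟨j, rfl⟩ := hb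
    have ha : ∀ i : ℤ, a ≠ i := fun i hi => hv i j ⟨hi, rfl⟩
    obtain ⟨h1, h2⟩ := floor_strict ha
    refine straightAt_of_horizontal hX hpos Function.injective_id hαβ h (i := ⌊a⌋) (j := j)
      (hasLower₀ (key _ _ h1.le le_rfl (by linarith))) (hasUpper₀ ?_) h1 h2 (by linarith)
      (by linarith)
    rintro ⟨hj, hi⟩
    have : (0 : ℝ) ≤ ⌊a⌋ := by exact_mod_cast hi
    have hj : j = 1 := by omega
    subst hj
    push_cast at hreg
    rcases hreg with h | h | h <;> dsimp only at h <;> linarith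
  · push Not at hb
    obtain ⟨h3, h4⟩ := floor_strict hb
    by_cases ha : ∃ i : ℤ, a = i
    · obtain ⟨i, rfl⟩ := ha
      have hT := key i ⌊b⌋ le_rfl h3.le h4
      refine straightAt_of_rising hX hpos Function.injective_id hαβ h (i := i) (j := ⌊b⌋)
        (hasLower₀ hT) (hasUpper₀ fun hc => hT ⟨hc.1, by have := hc.2; omega⟩) h3 h4
        (by linarith) (by linarith)
    · push Not at ha
      obtain ⟨h1, h2⟩ := floor_strict ha
      have hT := key ⌊a⌋ ⌊b⌋ h1.le h3.le h4
      exact straightAt_of_square hX hpos Function.injective_id hαβ h (hasLower₀ hT)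
        (hasUpper₀ hT) h1 h2 h3 h4

theorem straightAt₁ (hαβ : α ^ 2 + α * β + β ^ 2 = 1) (hreg : (a, b) ∈ region₁)
    (hv : ∀ i j : ℤ, ¬ (a = i ∧ b = j))
    (h : ∀ᶠ τ in nhds (0 : ℝ), γ (t + τ) ∈ model.points ∧
      shearCoord (γ (t + τ)) = a + τ * α ∧ rowCoord (γ (t + τ)) = b + τ * β) :
    model.StraightAt γ t := by
  have hX : ∀ x ∈ model.points, wsum pos₁ x = shearCoord x + rowCoord x * ζ := fun _ => wsum_pos₁
  have hpos : ∀ v, pos₁ (shear v) = pos₀ v := fun v => by rw [pos₁, unshear_shear]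
  have hinj : Function.Injective shear := Function.LeftInverse.injective unshear_shear
  have hreg' : 0 ≤ b → b ≤ 1 → 0 < a + b := fun h0 h1 => by
    rcases hreg with h | h | h
    · exact h
    · exact absurd h h0.not_gt
    · exact absurd h h1.not_gt
  by_cases hb : ∃ j : ℤ, b = j
  · obtain ⟨j, rfl⟩ := hb
    have ha : ∀ i : ℤ, a ≠ i := fun i hi => hv i j ⟨hi, rfl⟩
    obtain ⟨h1, h2⟩ := floor_strict ha
    refine straightAt_of_horizontal hX hpos hinj hαβ h (i := ⌊a⌋) (j := j)
      (hasLower₁ ?_) (hasUpper₁ ?_) h1 h2 (by linarith) (by linarith)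
    · rintro ⟨rfl, hi⟩
      have h0 := hreg' (by simp) (by simp)
      have : (⌊a⌋ : ℝ) + 1 ≤ 0 := by exact_mod_cast hi
      push_cast at h0
      linarith
    · rintro ⟨hj, hi⟩
      have hj : j = 1 := by omega
      subst hj
      have h0 := hreg' (by simp) (by simp)
      have : (⌊a⌋ : ℝ) + 1 ≤ -1 := by exact_mod_cast hi
      push_cast at h0
      linarith
  · push Not at hb
    obtain ⟨h3, h4⟩ := floor_strict hb
    by_cases ha : ∃ i : ℤ, a = i
    · obtain ⟨i, rfl⟩ := ha
      have hT : ¬ (⌊b⌋ = 0 ∧ i < 0) := by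
        rintro ⟨hj, hi⟩
        rw [hj] at h3 h4
        push_cast at h3 h4
        have h0 := hreg' h3.le (by linarith)
        have : (i : ℝ) + 1 ≤ 0 := by exact_mod_cast hi
        linarith
      exact straightAt_of_rising hX hpos hinj hαβ h (i := i) (j := ⌊b⌋)
        (hasLower₁ hT) (hasUpper₁ fun hc => hT ⟨hc.1, by have := hc.2; omega⟩) h3 h4
        (by linarith) (by linarith)
    · push Not at ha
      obtain ⟨h1, h2⟩ := floor_strict ha
      by_cases hT : ⌊b⌋ = 0 ∧ ⌊a⌋ < 0
      · obtain ⟨hj, hi⟩ := hT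
        rw [hj] at h3 h4
        push_cast at h3 h4
        have h0 := hreg' h3.le (by linarith)
        have : (⌊a⌋ : ℝ) + 1 ≤ 0 := by exact_mod_cast hi
        -- The point lies in the upper triangle of the square `(-1, 0)`, whose lower triangle is not
        -- in the chart. The rhombus across the edge from `(0, 0)` to `(0, 1)` serves instead.
        exact straightAt_of_rising hX hpos hinj hαβ h (i := 0) (j := 0)
          (hasLower₁ (by omega)) (hasUpper₁ (by omega)) (by push_cast; linarith)
          (by push_cast; linarith) (by push_cast; linarith) (by push_cast; linarith)
      · exact straightAt_of_square hX hpos hinj hαβ h (hasLower₁ hT)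
          (hasUpper₁ fun hc => hT ⟨hc.1, by have := hc.2; omega⟩) h1 h2 h3 h4

/-- The point of the model with given coordinates, as seen from the right. -/
noncomputable def rightPoint (a b : ℝ) : ℤ × ℤ → ℝ := hat (a + clamp b, b)

theorem rightPoint_spec (a b : ℝ) :
    rightPoint a b ∈ model.points ∧ shearCoord (rightPoint a b) = a ∧
      rowCoord (rightPoint a b) = b ∧ colCoord (rightPoint a b) = a + clamp b := by
  obtain ⟨h1, h2, h3⟩ := hat_spec (a + clamp b, b)
  refine ⟨h1, ?_, h3, h2⟩
  unfold shearCoord rightPoint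
  rw [h2, h3]
  simp

/-- The unit direction with `2 * α + β = 0` is `(-1 / √3, 2 / √3)`. A vertex `(i, j)` on the line
would make `c = 2 * i + j` an integer. -/
theorem isLine_vertical {c : ℝ} (hc : 0 < c) (hc' : ∀ i : ℤ, c ≠ i) :
    model.IsLine (vertical c) := by
  have h3 := sqrt_three_pos
  have h3' := sqrt_three_sq
  have h3'' : (1 / √3) * (1 / √3) = 1 / (3 : ℝ) := by rw [div_mul_div_comm, h3', one_mul]
  refine ⟨fun t => rightPoint (c / 2 + t * -(1 / √3)) (t * (2 * (1 / √3))), fun t => Or.inl ?_, ?_⟩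
  · refine straightAt₁ (a := c / 2 + t * -(1 / √3)) (b := t * (2 * (1 / √3)))
      (α := -(1 / √3)) (β := 2 * (1 / √3)) (by linear_combination 3 * h3'') ?_ ?_ ?_
    · exact mem_region₁_of_pos (by linarith)
    · rintro i j ⟨h1, h2⟩
      exact hc' (2 * i + j) (by push_cast; linarith)
    · refine Filter.Eventually.of_forall fun τ => ?_
      obtain ⟨e1, e2, e3, -⟩ :=
        rightPoint_spec (c / 2 + (t + τ) * -(1 / √3)) ((t + τ) * (2 * (1 / √3)))
      exact ⟨e1, by rw [e2]; ring, by rw [e3]; ring⟩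
  · ext x
    constructor
    · rintro ⟨hx, e⟩
      refine ⟨rowCoord x * (√3 / 2), ?_⟩
      obtain ⟨e1, e2, e3, -⟩ := rightPoint_spec (c / 2 + rowCoord x * (√3 / 2) * -(1 / √3))
        (rowCoord x * (√3 / 2) * (2 * (1 / √3)))
      have f3 : rowCoord x * (√3 / 2) * (2 * (1 / √3)) = rowCoord x := by field_simp
      have f2 : c / 2 + rowCoord x * (√3 / 2) * -(1 / √3) = shearCoord x := by
        linear_combination -f3 / 2 - e / 2
      beta_reduce
      rw [f2, f3] at e1 e2 e3 ⊢
      refine eq_of_coords e1 hx ?_ e3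
      have e2' : colCoord (rightPoint (shearCoord x) (rowCoord x)) -
        clamp (rowCoord (rightPoint (shearCoord x) (rowCoord x))) = shearCoord x := e2
      have : shearCoord x = colCoord x - clamp (rowCoord x) := rfl
      rw [e3] at e2'
      linarith
    · rintro ⟨t, rfl⟩
      obtain ⟨e1, e2, e3, -⟩ := rightPoint_spec (c / 2 + t * -(1 / √3)) (t * (2 * (1 / √3)))
      refine ⟨e1, ?_⟩
      rw [e2, e3]; ring

end Existence

/-! ### Lines through the midpoint of the special edge. -/

section Broken

/-- The line through the midpoint of the edge between the special vertices, with given slope in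
lattice coordinates. -/
noncomputable def brokenLine (r t : ℝ) : ℤ × ℤ → ℝ :=
  -- The direction `(1, r)` is scaled to unit speed. For positive `t` it is turned as in
  -- `leaves_edge`, and the midpoint is at `(-1 / 2, 1 / 2)` seen from the right.
  if t ≤ 0 then hat (t * (1 / √(1 + r + r ^ 2)), 1 / 2 + t * (r / √(1 + r + r ^ 2)))
  else rightPoint (-1 / 2 + t * -(r / √(1 + r + r ^ 2)))
    (1 / 2 + t * (1 / √(1 + r + r ^ 2) + r / √(1 + r + r ^ 2)))

theorem brokenLine_spec {r : ℝ} (hr : 0 < r) : ∃ α β : ℝ, 0 < α ∧ β = r * α ∧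
    α ^ 2 + α * β + β ^ 2 = 1 ∧ (∀ t, brokenLine r t ∈ model.points) ∧
    (∀ t ≤ 0, colCoord (brokenLine r t) = t * α ∧ rowCoord (brokenLine r t) = 1 / 2 + t * β) ∧
    ∀ t > 0, shearCoord (brokenLine r t) = -1 / 2 + t * -β ∧
      rowCoord (brokenLine r t) = 1 / 2 + t * (α + β) := by
  have hN : 0 < √(1 + r + r ^ 2) := Real.sqrt_pos.2 (by positivity)
  have hN2 : √(1 + r + r ^ 2) ^ 2 = 1 + r + r ^ 2 := Real.sq_sqrt (by positivity)
  refine ⟨1 / √(1 + r + r ^ 2), r / √(1 + r + r ^ 2), by positivity, by ring, ?_, fun t => ?_,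
    fun t ht => ?_, fun t ht => ?_⟩
  · field_simp
    exact hN2.symm
  · unfold brokenLine
    split_ifs
    exacts [(hat_spec _).1, (rightPoint_spec _ _).1]
  · rw [brokenLine, if_pos ht]
    exact (hat_spec _).2
  · rw [brokenLine, if_neg (not_le.2 ht)]
    exact ⟨(rightPoint_spec _ _).2.1, (rightPoint_spec _ _).2.2.1⟩

/-- A vertex on the line would give `i * r = j - 1 / 2`: for `i = 0` this contradicts parity, and
otherwise it makes `r` rational. -/
theorem not_lattice_of_irrational {r c α : ℝ} (hr : Irrational r) {i j : ℤ}
    (h1 : c * α = i) (h2 : 1 / 2 + c * (r * α) = j) : False := by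
  have h3 : (i : ℝ) * r = j - 1 / 2 := by rw [← h1]; linarith
  by_cases hi : i = 0
  · subst hi
    have : (2 * j : ℤ) = 1 := by
      have : (2 * j : ℝ) = 1 := by push_cast at h3; linarith
      exact_mod_cast this
    omega
  · refine hr ⟨(j - 1 / 2) / i, ?_⟩
    have : (i : ℝ) ≠ 0 := by exact_mod_cast hi
    push_cast
    rw [← h3]; field_simp

/-- The left half lies in the left chart and the right half in the right one. The midpoint belongs
to neither region, and there the curve is straight in `pos₂`. No vertex is met. -/
theorem isGeodesic_brokenLine {r : ℝ} (hr : 0 < r) (hirr : Irrational r) :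
    model.IsGeodesic (brokenLine r) := by
  obtain ⟨α, β, hα, hβ, hαβ, hpt, hneg, hpos⟩ := brokenLine_spec hr
  have hβ0 : 0 < β := by rw [hβ]; positivity
  intro t
  left
  rcases lt_trichotomy t 0 with ht | rfl | ht
  · refine straightAt₀ (a := t * α) (b := 1 / 2 + t * β) hαβ ?_ ?_ ?_
    · left; exact mul_neg_of_neg_of_pos ht hα
    · rintro i j ⟨h1, h2⟩
      exact not_lattice_of_irrational hirr h1 (hβ ▸ h2)
    · have : ∀ᶠ τ : ℝ in nhds 0, τ < -t := gt_mem_nhds (by linarith)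
      filter_upwards [this] with τ hτ
      obtain ⟨e1, e2⟩ := hneg (t + τ) (by linarith)
      exact ⟨hpt _, by rw [e1]; ring, by rw [e2]; ring⟩
  · refine straightAt_of_affine (pos := pos₂) (a := (-1, 1)) (b := (0, 0)) (c := (0, 1))
      (d := (1, 1)) (z := (1 / 2 : ℝ) * ζ) (u := α + β * ζ) (ε := 1 / 4) (by simp) ?_ ?_ ?_ ?_ ?_
      (norm_lattice_eq_one hαβ) (by norm_num) fun s hs => ?_
    · have := Face.upper (-1) 0 (by unfold Turned; omega)
      norm_num at this
      rw [Finset.insert_comm] at this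
      exact this
    · have := Face.left 0 0 ⟨rfl, le_rfl⟩
      norm_num at this
      rw [triple_rotate] at this
      exact this
    · simp only [pos₂, fold]
      apply LatticeAdj.norm_sub
      unfold LatticeAdj; simp
    · simp [pos₂, fold, pos₀]; linear_combination -ζ_sq
    · simp [pos₂, fold, pos₀, -map_sub]; linear_combination -ζ_mul_conj
    -- As `α` and `β` are at most one, the height changes by at most `1 / 2` while `|s| < 1 / 4`, so
    -- the curve stays in the two triangles.
    · have hα1 : α ≤ 1 := by nlinarith [mul_pos hα hβ0]
      have hβ1 : β ≤ 1 := by nlinarith [mul_pos hα hβ0]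
      rw [abs_lt] at hs
      rw [zero_add]
      rcases le_or_gt s 0 with h0 | h0
      · obtain ⟨e1, e2⟩ := hneg s h0
        have hx := mem_disk_upper (hpt s) (i := -1) (j := 0) (by unfold Turned; omega)
          (by rw [e1]; push_cast; nlinarith) (by rw [e2]; push_cast; nlinarith)
          (by rw [e1, e2]; push_cast; nlinarith)
        norm_num at hx
        refine ⟨Or.inl (by rwa [Finset.insert_comm]), ?_⟩
        rw [(mem_upper₂ hx).2.2.2, e1, e2]
        push_cast; ring
      · obtain ⟨e1, e2⟩ := hpos s h0
        have hc : colCoord (brokenLine r s) = s * α := by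
          have : colCoord (brokenLine r s) =
            shearCoord (brokenLine r s) + clamp (rowCoord (brokenLine r s)) := by
              unfold shearCoord; ring
          rw [this, e1, e2, clamp_of_mem (by nlinarith) (by nlinarith)]
          ring
        have hx := mem_disk_left (hpt s) (i := 0) (j := 0) ⟨rfl, le_rfl⟩
          (by rw [hc]; push_cast; positivity) (by rw [e2]; push_cast; nlinarith)
          (by rw [hc, e2]; push_cast; nlinarith)
        norm_num at hx
        refine ⟨Or.inr (by rwa [← triple_rotate]), ?_⟩
        rw [(mem_left₂ hx).2.2.2, hc, e2]
        push_cast; ring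
  · refine straightAt₁ (a := -1 / 2 + t * -β) (b := 1 / 2 + t * (α + β)) (α := -β) (β := α + β)
      (by linear_combination hαβ) ?_ ?_ ?_
    · left
      have := mul_pos ht hα
      dsimp only; linarith
    · rintro i j ⟨h1, h2⟩
      -- The sum of the two right coordinates is `t * α`, and the negative of the first is `1 / 2 +
      -- t * β`.
      refine not_lattice_of_irrational hirr (c := t) (α := α) (i := i + j) (j := -i) ?_ ?_
      · push_cast; linarith
      · rw [← hβ]; push_cast; linarith
    · have : ∀ᶠ τ : ℝ in nhds 0, -t < τ := lt_mem_nhds (by linarith)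
      filter_upwards [this] with τ hτ
      obtain ⟨e1, e2⟩ := hpos (t + τ) (by linarith)
      exact ⟨hpt _, by rw [e1]; ring, by rw [e2]; ring⟩

/-- The point at parameter `-1` lies below height `1 / 2`, hence on the left half of the other line
as well, and there its displacement from the midpoint determines the slope. -/
theorem brokenLine_injective {r r' : ℝ} (hr : 0 < r) (hr' : 0 < r')
    (h : Set.range (brokenLine r) = Set.range (brokenLine r')) : r = r' := by
  obtain ⟨α, β, hα, hβ, -, -, hneg, -⟩ := brokenLine_spec hr
  obtain ⟨α', β', hα', hβ', -, -, hneg', hpos'⟩ := brokenLine_spec hr'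
  obtain ⟨t, ht⟩ : brokenLine r (-1) ∈ Set.range (brokenLine r') := h ▸ ⟨_, rfl⟩
  obtain ⟨e1, e2⟩ := hneg (-1) (by norm_num)
  have hβ0 : 0 < β := by rw [hβ]; positivity
  have hβ0' : 0 < β' := by rw [hβ']; positivity
  rw [← ht] at e1 e2
  rcases le_or_gt t 0 with h0 | h0
  · obtain ⟨f1, f2⟩ := hneg' t h0
    have h1 : t * α' = -α := by linarith
    have h2 : t * β' = -β := by linarith
    rw [hβ, hβ'] at h2
    have : α * r' = α * r := by linear_combination r' * h1 - h2
    exact (mul_left_cancel₀ hα.ne' this).symm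
  · obtain ⟨-, f2⟩ := hpos' t h0
    have : 0 < t * (α' + β') := by positivity
    linarith

theorem brokenLine_zero {r : ℝ} : brokenLine r 0 = hat (0, 1 / 2) := by
  simp [brokenLine]

/-- Along the right half `2 * shearCoord + rowCoord = -1 / 2 + t * (α - β)`, which does not increase
when `α ≤ β`. On the left half the column is nonpositive and the height at most `1 / 2`, so the
value stays below `1 / 2`. -/
theorem disjoint_brokenLine {r : ℝ} (hr : 1 ≤ r) :
    Disjoint (Set.range (brokenLine r)) (vertical (1 / 2)) := by
  obtain ⟨α, β, hα, hβ, -, -, hneg, hpos⟩ := brokenLine_spec (by linarith : 0 < r)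
  have hβα : α ≤ β := by rw [hβ]; nlinarith
  rw [Set.disjoint_left]
  rintro _ ⟨t, rfl⟩ ⟨-, h⟩
  rcases le_or_gt t 0 with h0 | h0
  · obtain ⟨e1, e2⟩ := hneg t h0
    have hc := clamp_nonneg (rowCoord (brokenLine r t))
    rw [shearCoord, e1] at h
    rcases h0.lt_or_eq with h0 | rfl
    · have := mul_neg_of_neg_of_pos h0 hα
      have : t * β ≤ 0 := by nlinarith
      linarith
    · rw [e2, clamp_of_mem (by norm_num) (by norm_num)] at h
      norm_num at h
  · obtain ⟨e1, e2⟩ := hpos t h0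
    rw [e1, e2] at h
    nlinarith

theorem not_disjoint_brokenLine {r : ℝ} (hr : 0 < r) (hr1 : r < 1) :
    ¬ Disjoint (Set.range (brokenLine r)) (vertical (1 / 2)) := by
  obtain ⟨α, β, hα, hβ, -, hpt, -, hpos⟩ := brokenLine_spec hr
  have hβα : β < α := by rw [hβ]; nlinarith
  have hd : 0 < α - β := by linarith
  rw [Set.not_disjoint_iff]
  -- The solution of `-1 / 2 + t * (α - β) = 1 / 2`.
  refine ⟨_, ⟨1 / (α - β), rfl⟩, hpt _, ?_⟩
  obtain ⟨e1, e2⟩ := hpos (1 / (α - β)) (by positivity)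
  rw [e1, e2]
  field_simp
  ring

theorem isLine_brokenLine {r : ℝ} (hr : 0 < r) (hirr : Irrational r) :
    model.IsLine (Set.range (brokenLine r)) := ⟨_, isGeodesic_brokenLine hr hirr, rfl⟩

end Broken

/-! ### The three points with respect to the line. -/

theorem isLine_vertical_half : model.IsLine (vertical (1 / 2)) := by
  refine isLine_vertical (by norm_num) fun i hi => ?_
  have : (1 : ℝ) = ((2 * i : ℤ) : ℝ) := by push_cast; linarith
  have : (1 : ℤ) = 2 * i := by exact_mod_cast this
  omega

/-- The point lies on `vertical (3 / 2)`, in the flat half plane beyond the line, where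
`exists_mem_vertical_or` leaves no other parallel. -/
theorem isEuclideanPoint : model.IsEuclideanPoint (vertical (1 / 2)) (rightPoint (3 / 4) 0) := by
  obtain ⟨h1, h2, h3, -⟩ := rightPoint_spec (3 / 4) 0
  have hP : rightPoint (3 / 4) 0 ∈ vertical (3 / 2) := ⟨h1, by rw [h2, h3]; norm_num⟩
  have hdisj : Disjoint (vertical (3 / 2)) (vertical (1 / 2)) := by
    rw [Set.disjoint_left]
    rintro x ⟨-, hx⟩ ⟨-, hx'⟩
    rw [hx] at hx'
    norm_num at hx'
  refine ⟨⟨isLine_vertical_half, h1, Set.disjoint_left.1 hdisj hP⟩, vertical (3 / 2),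
    ⟨?_, hP, hdisj⟩, ?_⟩
  · refine isLine_vertical (by norm_num) fun i hi => ?_
    have : (3 : ℝ) = ((2 * i : ℤ) : ℝ) := by push_cast; linarith
    have : (3 : ℤ) = 2 * i := by exact_mod_cast this
    omega
  · rintro m ⟨⟨γ, hγ, rfl⟩, ⟨t₀, ht₀⟩, hm⟩
    refine (exists_mem_vertical_or hγ (c := 1 / 2) (d := 3 / 2) (by norm_num) (by norm_num)
      (t₀ := t₀) (ht₀ ▸ hP)).resolve_left ?_
    rintro ⟨t, ht⟩
    exact Set.disjoint_left.1 hm ⟨t, rfl⟩ ht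

theorem isEllipticPoint : model.IsEllipticPoint (vertical (1 / 2)) (hat (-1 / 4, 1)) := by
  obtain ⟨h1, h2, h3⟩ := hat_spec (-1 / 4, 1)
  refine ⟨⟨isLine_vertical_half, h1, ?_⟩, ?_⟩
  · rintro ⟨-, h⟩
    rw [shearCoord, h2, h3, clamp_of_one_le le_rfl] at h
    norm_num at h
  · rw [Set.eq_empty_iff_forall_notMem]
    rintro m ⟨⟨γ, hγ, rfl⟩, ⟨t₀, ht₀⟩, hm⟩
    obtain ⟨t, ht⟩ := exists_mem_vertical_of_elliptic hγ (t₀ := t₀) (by rw [ht₀, h2])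
      (by rw [ht₀, h3])
    exact Set.disjoint_left.1 hm ⟨t, rfl⟩ ht

/-- The slopes `√2 + n` are irrational and at least one. -/
theorem infinite_parallels : (model.parallels (vertical (1 / 2)) (hat (0, 1 / 2))).Infinite := by
  have h1 : ∀ n : ℕ, 1 ≤ √2 + n := fun n => by
    have : 1 ≤ √(2 : ℝ) := Real.one_le_sqrt.2 (by norm_num)
    have : (0 : ℝ) ≤ n := n.cast_nonneg
    linarith
  refine Set.infinite_of_injective_forall_mem
    (f := fun n : ℕ => Set.range (brokenLine (√2 + n))) (fun n m h => ?_) fun n => ?_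
  · have := brokenLine_injective (by linarith [h1 n]) (by linarith [h1 m]) h
    exact_mod_cast add_left_cancel this
  · exact ⟨isLine_brokenLine (by linarith [h1 n]) (irrational_sqrt_two.add_natCast n),
      ⟨0, brokenLine_zero⟩, disjoint_brokenLine (h1 n)⟩

/-- The slopes `√2 / (n + 2)` are irrational and lie strictly between zero and one. -/
theorem infinite_nonParallels :
    (model.nonParallels (vertical (1 / 2)) (hat (0, 1 / 2))).Infinite := by
  have h0 : ∀ n : ℕ, 0 < √2 / ((n + 2 : ℕ) : ℝ) := fun n => by positivity
  have h1 : ∀ n : ℕ, √2 / ((n + 2 : ℕ) : ℝ) < 1 := fun n => by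
    rw [div_lt_one (by positivity)]
    have : √(2 : ℝ) < 2 := by rw [Real.sqrt_lt' (by norm_num)]; norm_num
    push_cast
    have : (0 : ℝ) ≤ n := n.cast_nonneg
    linarith
  refine Set.infinite_of_injective_forall_mem
    (f := fun n : ℕ => Set.range (brokenLine (√2 / ((n + 2 : ℕ) : ℝ)))) (fun n m h => ?_)
    fun n => ?_
  · have := brokenLine_injective (h0 n) (h0 m) h
    have h2 : √(2 : ℝ) ≠ 0 := by positivity
    rw [div_eq_div_iff (by positivity) (by positivity)] at this
    have := Nat.cast_injective (mul_left_cancel₀ h2 this)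
    omega
  · exact ⟨isLine_brokenLine (h0 n) (irrational_sqrt_two.div_natCast (by omega)),
      ⟨0, brokenLine_zero⟩, not_disjoint_brokenLine (h0 n) (h1 n)⟩

theorem isRegularlyHyperbolicPoint :
    model.IsRegularlyHyperbolicPoint (vertical (1 / 2)) (hat (0, 1 / 2)) := by
  obtain ⟨h1, h2, h3⟩ := hat_spec (0, 1 / 2)
  refine ⟨⟨⟨isLine_vertical_half, h1, ?_⟩, infinite_parallels.nontrivial⟩, infinite_parallels,
    infinite_nonParallels⟩
  rintro ⟨-, h⟩
  rw [shearCoord, h2, h3, clamp_of_mem (by norm_num) (by norm_num)] at h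
  norm_num at h

end SemiParadoxist

theorem mainTheorem1 :
    ∃ (V : Type) (_ : DecidableEq V) (M : SManifold V) (h e : V),
      M.IsModel h e ∧
      (∃ l : Set (V → ℝ), M.IsLine l ∧
        (∃ P : V → ℝ, M.IsEuclideanPoint l P) ∧
        (∃ Q : V → ℝ, M.IsEllipticPoint l Q) ∧
        (∃ R : V → ℝ, M.IsRegularlyHyperbolicPoint l R)) ∧
      M.IsSemiParadoxist := by
  refine ⟨ℤ × ℤ, inferInstance, SemiParadoxist.model, (0, 0), (0, 1), SemiParadoxist.isModel,
    ⟨_, SemiParadoxist.isLine_vertical_half, ⟨_, SemiParadoxist.isEuclideanPoint⟩,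
      ⟨_, SemiParadoxist.isEllipticPoint⟩, ⟨_, SemiParadoxist.isRegularlyHyperbolicPoint⟩⟩,
    ⟨_, _, SemiParadoxist.isEuclideanPoint⟩, ⟨_, _, SemiParadoxist.isEllipticPoint⟩,
    ⟨_, _, SemiParadoxist.isRegularlyHyperbolicPoint⟩⟩
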